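/- Let $\mathbb T=\mathbb R/2\pi\mathbb Z$. For every $\mathfrak U\ge 1$ there exist $C_0\ge 1$ and $\varepsilon_0,\nu_0\in(0,1)$, depending only on $\mathfrak U$, such that the following holds. Let $u\in C^3(\mathbb R)$ satisfy $$\frac1{\mathfrak U}\le u'(y),\qquad \frac{|u''(y)|}{u'(y)}\le\mathfrak U,\qquad \frac{|u'''(y)|}{u'(y)}\le\mathfrak U\qquad\text{for all }y\in\mathbb R,$$ let $\nu\in[0,\nu_0]$, and let $f:[0,\infty)\times\mathbb T\times\mathbb R\to\mathbb R$ be a weak solution, with initial datum $f^{in}$, of either $$\partial_t f+u\,\partial_x f=\nu\,\partial_{yy}f\qquad\text{or}\qquad \partial_t f+u\,\partial_x f=\nu\,\Delta f .$$ Write $g_{\neq}(x,y)=g(x,y)-\frac1{2\pi}\int_{\mathbb T}g(x',y)\,dx'$, $\|g\|=\|g\|_{L^2(\mathbb T\times\mathbb R)}$, $\|g\|_{u'}^2=\|g\|^2+\|u'g\|^2$, and $$\|g\|_{\dot H^{-1}}=\sup\Big\{\Big|\int_{\mathbb T\times\mathbb R} g\,\varphi\Big| : \varphi\in C_c^\infty(\mathbb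 T\times\mathbb R),\ \|\nabla\varphi\|\le 1\Big\}.$$ Assume $\|f^{in}_{\neq}\|_{u'}<\infty$. Then for all $t\ge0$ we have the enhanced diffusion estimate $$\|f_{\neq}(t)\|_{u'}\le C_0\,e^{-\varepsilon_0\nu^{1/3}t}\,\|f^{in}_{\neq}\|_{u'}$$ and the stable mixing estimate $$\|f_{\neq}(t)\|_{\dot H^{-1}}\le C_0\,\frac{e^{-\varepsilon_0\nu^{1/3}t}}{\sqrt{1+t^2}}\Big[\|f^{in}_{\neq}\|_{u'}+\|\partial_y f^{in}_{\neq}\|_{u'}\Big].$$ In particular, if $\nu=0$, then for all $t\ge0$ $$\|f_{\neq}(t)\|_{\dot H^{-1}}\le \frac{C_0}{\sqrt{1+t^2}}\Big[\|f^{in}_{\neq}\|_{u'}+\|\partial_y f^{in}_{\neq}\|_{u'}\Big].$$ Here $\partial_y f^{in}_{\neq}$ is the weak derivative (the mixing estimates are void if it does not exist as a locally integrable function). A weak solution is a function $f$ with $f^{in}$ and every $f(t)$, $t\ge0$, locally integrable on $\mathbb T\times\mathbb R$, with $\sup_{0\le t\le T}\|f_{\neq}(t)\|<\infty$ for every $T$,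 such that for every $\varphi\in C_c^\infty(\mathbb T\times\mathbb R)$ the function $s\mapsto\int f(s)\,(u\,\partial_x\varphi+A\varphi)$ is integrable on bounded intervals and, for all $t\ge0$, $$\int f(t)\,\varphi=\int f^{in}\varphi+\int_0^t\!\int f(s)\,\big(u\,\partial_x\varphi+A\varphi\big)\,ds,$$ where $A=\nu\partial_{yy}$ or $A=\nu\Delta$ respectively. -/

import Mathlib

open MeasureTheory
open scoped ENNReal ContDiff

noncomputable section

namespace ShearFlow

/-- The torus `ℝ / 2πℤ`; its `volume` has total mass `2π`. -/
abbrev Torus : Type := AddCircle (2 * Real.pi)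

instance factTwoPiPos : Fact (0 < 2 * Real.pi) := ⟨Real.two_pi_pos⟩

/-- Partial derivative in the periodic variable `x`. -/
def dX (φ : Torus × ℝ → ℝ) (p : Torus × ℝ) : ℝ :=
  deriv (fun s : ℝ => φ (p.1 + (s : Torus), p.2)) 0

/-- Partial derivative in the variable `y`. -/
def dY (φ : Torus × ℝ → ℝ) (p : Torus × ℝ) : ℝ :=
  deriv (fun s : ℝ => φ (p.1, s)) p.2

/-- Test functions: smooth functions with compact support on `𝕋 × ℝ`. Smoothness is that of the
lift to the covering space `ℝ × ℝ`. -/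
structure IsTest (φ : Torus × ℝ → ℝ) : Prop where
  smooth : ContDiff ℝ ∞ (fun p : ℝ × ℝ => φ ((p.1 : Torus), p.2))
  compact : HasCompactSupport φ

/-- The diffusion operator `ν ∂_yy`. -/
def hypoDiffusion (ν : ℝ) (φ : Torus × ℝ → ℝ) (p : Torus × ℝ) : ℝ :=
  ν * dY (dY φ) p

/-- The diffusion operator `ν Δ`. -/
def fullDiffusion (ν : ℝ) (φ : Torus × ℝ → ℝ) (p : Torus × ℝ) : ℝ :=
  ν * (dX (dX φ) p + dY (dY φ) p)

/-- `f_≠`: the function minus its `x`-average. -/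
def nonzeroModes (f : Torus × ℝ → ℝ) (p : Torus × ℝ) : ℝ :=
  f p - (2 * Real.pi)⁻¹ * ∫ x : Torus, f (x, p.2)

/-- `f` is a weak solution on `[0, ∞)` of `∂_t f + u ∂_x f = A f`, `f(0) = fin`, where `A` is a
formally self-adjoint diffusion operator. At every time `f` is locally integrable, the non-zero
modes of `f` are in `L^∞_loc([0, ∞); L²)`, and the equation, integrated in time, holds against
every test function. No integrability at infinity is imposed on the `x`-average of `f`. -/
structure IsWeakSolution (u : ℝ → ℝ) (A : (Torus × ℝ → ℝ) → Torus × ℝ → ℝ)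
    (fin : Torus × ℝ → ℝ) (f : ℝ → Torus × ℝ → ℝ) : Prop where
  locallyIntegrable_init : LocallyIntegrable fin volume
  locallyIntegrable : ∀ t : ℝ, 0 ≤ t → LocallyIntegrable (f t) volume
  locallyBounded : ∀ T : ℝ, 0 ≤ T → ∃ M : ℝ, ∀ t : ℝ, 0 ≤ t → t ≤ T →
    eLpNorm (nonzeroModes (f t)) 2 volume ≤ ENNReal.ofReal M
  intervalIntegrable : ∀ φ : Torus × ℝ → ℝ, IsTest φ → ∀ t : ℝ, 0 ≤ t →
    IntervalIntegrable (fun s : ℝ => ∫ p, f s p * (u p.2 * dX φ p + A φ p)) volume 0 t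
  weak_eq : ∀ φ : Torus × ℝ → ℝ, IsTest φ → ∀ t : ℝ, 0 ≤ t →
    ∫ p, f t p * φ p =
      (∫ p, fin p * φ p) + ∫ s in (0 : ℝ)..t, ∫ p, f s p * (u p.2 * dX φ p + A φ p)

/-- The weighted norm `(‖f‖² + ‖u' f‖²)^{1/2}`, with value `∞` allowed. -/
def weightedNorm (u : ℝ → ℝ) (f : Torus × ℝ → ℝ) : ℝ≥0∞ :=
  (eLpNorm f 2 volume ^ 2 + eLpNorm (fun p => deriv u p.2 * f p) 2 volume ^ 2) ^ (1 / 2 : ℝ)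

/-- The homogeneous `Ḣ^{-1}` norm of a locally integrable function: the norm of `φ ↦ ∫ f φ` with
respect to `‖∇φ‖_{L²}`, with value `∞` allowed. -/
def hDotNegOneNorm (f : Torus × ℝ → ℝ) : ℝ≥0∞ :=
  ⨆ (φ : Torus × ℝ → ℝ) (_ : IsTest φ)
    (_ : eLpNorm (dX φ) 2 volume ^ 2 + eLpNorm (dY φ) 2 volume ^ 2 ≤ 1),
    ENNReal.ofReal |∫ p, f p * φ p|

/-- `h` is the weak derivative `∂_y g`. -/
structure IsWeakDerivY (g h : Torus × ℝ → ℝ) : Prop where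
  locallyIntegrable : LocallyIntegrable g volume
  locallyIntegrable_deriv : LocallyIntegrable h volume
  integral_eq : ∀ φ : Torus × ℝ → ℝ, IsTest φ → ∫ p, g p * dY φ p = - ∫ p, h p * φ p

/-- The assumption on the shear flow: `u ∈ C³`, `1/U ≤ u'`, `|u''|/u' ≤ U`, `|u'''|/u' ≤ U`. -/
structure IsAdmissibleShear (U : ℝ) (u : ℝ → ℝ) : Prop where
  contDiff : ContDiff ℝ 3 u
  le_deriv : ∀ y : ℝ, 1 / U ≤ deriv u y
  second : ∀ y : ℝ, |iteratedDeriv 2 u y| / deriv u y ≤ U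
  third : ∀ y : ℝ, |iteratedDeriv 3 u y| / deriv u y ≤ U

end ShearFlow

end

/-! After a Fourier series in x, each mode κ ≠ 0 solves ∂_t g + iκu g = ν(∂_yy - σ)g. The part -νσ
only helps, so take σ = 0. The profile G = e^{iκtu}g solves ∂_t G = νD²G with D = e^{iκtu}∂_y
e^{-iκtu} = ∂_y - iκtu', in which the unbounded multiplication by u has disappeared. The vector
field X = ∂_y, acting on the profile, commutes with transport. Its commutators with D involve only
κtu'' and κtu''', and these are dominated by X - D = iκtu' because |u''|, |u'''| ≤ 𝔘u'. Hence ‖XG‖²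
plus a multiple of ‖G‖² grows at most at rate O(ν) (`IsScheme.grad_sq_le`).

Enhanced diffusion. In a window of length τ ~ ν^{-1/3} the energy balance gives a time t₀ in the
first third and a time t₁ in the last third where ν‖DG‖²τ is at most a constant times the initial
energy. Restart the profile at t₀, where X = D; then ‖XG‖ is still of size (ντ)^{-1/2} at t₁, and so
is ‖DG‖. Since X - D = iκ(t₁-t₀)u' there and u' is bounded below, ‖G(t₁)‖² is at most C/(ντ³) times
the initial energy. The energy norm is therefore halved over each window (`IsScheme.half`,
`IsScheme.decay`).

Mixing. The flow and its dual have a conserved pairing. Evaluated at the middle of the time interval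
it is an oscillatory integral of e^{-iκτu} against two profiles; one integration by parts gains
1/(κτ) at the price of one X on either profile, and both profiles have by then decayed
(`IsScheme.norm_inner_phaseOp_le`, `IsScheme.mixing`).

The solution is only weak, so nothing above applies to it directly. Everything is proved for a dual
problem instead, in which ∂_yy is replaced by a second difference quotient of step h and u by a
shear v with v' ≤ N. This is a linear ODE with bounded coefficients on L², so solutions exist at
once, and all estimates are uniform in h and N as long as Nh is small. A cut off and mollified dual
solution is an admissible test function, and the weak equation then bounds ⟨φ, f(t)⟩ up to an
arbitrarily small error (`IsModeSol.dual_error`, `IsModeSol.exists_dual`). Duality also explains the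
weight: the norm ‖u'f‖ is dual to ‖φ/u'‖, and 1/u' is bounded and varies at most exponentially,
whereas u' may be unbounded. Parseval and Cauchy–Schwarz over the modes conclude. -/

open scoped BoundedContinuousFunction

namespace ShearFlow

/-! ### Weighted energy estimates for an abstract unitary shift -/

section Abstract

variable {H : Type*} [NormedAddCommGroup H] [InnerProductSpace ℂ H]

/-- The difference quotient `(T - 1) / h`. -/
noncomputable def diffQuot (h : ℝ) (T : H →L[ℂ] H) : H →L[ℂ] H := ((h⁻¹ : ℝ) : ℂ) • (T - 1)

lemma diffQuot_apply (h : ℝ) (T : H →L[ℂ] H) (v : H) :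
    diffQuot h T v = ((h⁻¹ : ℝ) : ℂ) • (T v - v) := by
  simp [diffQuot]

/-- A unitary shift `T`, with inverse `T'`, together with a self-adjoint weight `M` and its
translate `M₁ = T M T'`, which differs from `M` by `O(h)` relative to the weights. -/
structure IsWeightedShift (h C : ℝ) (T T' M M₁ : H →L[ℂ] H) : Prop where
  pos : 0 < h
  nonneg : 0 ≤ C
  mul_inv : T * T' = 1
  inv_mul : T' * T = 1
  adjoint : ∀ a b : H, inner ℂ a (T' b) = inner ℂ (T a) b
  selfAdjoint : ∀ a b : H, inner ℂ (M a) b = inner ℂ a (M b)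
  selfAdjoint' : ∀ a b : H, inner ℂ (M₁ a) b = inner ℂ a (M₁ b)
  comm : T * M = M₁ * T
  close : ∀ a b : H, ‖inner ℂ (M₁ (M₁ a) - M (M a)) b‖ ≤ h * C * (‖M a‖ * ‖M₁ b‖)

variable {h C : ℝ} {T T' M M₁ : H →L[ℂ] H}

lemma IsWeightedShift.inner_diffQuot (S : IsWeightedShift h C T T' M M₁) (a b : H) :
    inner ℂ a (diffQuot h T' b) = inner ℂ (diffQuot h T a) b := by
  simp only [diffQuot_apply, inner_smul_left, inner_smul_right, inner_sub_left, inner_sub_right,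
    S.adjoint, Complex.conj_ofReal]

/-- A discrete product rule. The adjoint quotient moves onto M²a; since T M² = M₁² T, the quotient
of M²a is M₁² times the quotient of a plus (M₁² - M²)a/h, and `close` makes the last term O(1). -/
lemma IsWeightedShift.form_sub_le (S : IsWeightedShift h C T T' M M₁) (a b : H) :
    ‖inner ℂ (M (M a)) (diffQuot h T' b) - inner ℂ (M₁ (diffQuot h T a)) (M₁ b)‖
      ≤ C * (‖M a‖ * ‖M₁ b‖) := by
  have hT : ∀ v, T (M v) = M₁ (T v) := fun v => DFunLike.congr_fun S.comm v
  have h1 : diffQuot h T (M (M a)) = M₁ (M₁ (diffQuot h T a))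
      + ((h⁻¹ : ℝ) : ℂ) • (M₁ (M₁ a) - M (M a)) := by
    simp only [diffQuot_apply, hT, map_smul, map_sub, smul_sub]
    abel
  rw [S.inner_diffQuot, h1, inner_add_left, S.selfAdjoint', add_sub_cancel_left, inner_smul_left,
    norm_mul]
  have h2 := S.close a b
  have hp := S.pos
  simp only [Complex.conj_ofReal, Complex.norm_real, Real.norm_eq_abs, abs_inv, abs_of_pos hp]
  rw [inv_mul_le_iff₀ hp]
  linarith

lemma IsWeightedShift.re_form_ge (S : IsWeightedShift h C T T' M M₁) (a b : H) :
    -(‖M₁ (diffQuot h T a)‖ * ‖M₁ b‖) - C * (‖M a‖ * ‖M₁ b‖)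
      ≤ (inner ℂ (M (M a)) (diffQuot h T' b)).re := by
  have h1 := S.form_sub_le a b
  have h2 := (Complex.abs_re_le_norm _).trans h1
  rw [Complex.sub_re] at h2
  have h3 := (Complex.abs_re_le_norm _).trans
    (norm_inner_le_norm (𝕜 := ℂ) (M₁ (diffQuot h T a)) (M₁ b))
  rw [abs_le] at h2 h3
  linarith [h2.1, h3.1]

lemma IsWeightedShift.re_form_self_ge (S : IsWeightedShift h C T T' M M₁) (a : H) :
    ‖M₁ (diffQuot h T a)‖ ^ 2 - C * (‖M a‖ * ‖M₁ (diffQuot h T a)‖)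
      ≤ (inner ℂ (M (M a)) (diffQuot h T' (diffQuot h T a))).re := by
  have h2 := (Complex.abs_re_le_norm _).trans (S.form_sub_le a (diffQuot h T a))
  rw [Complex.sub_re, abs_le] at h2
  have h3 : (inner ℂ (M₁ (diffQuot h T a)) (M₁ (diffQuot h T a))).re
      = ‖M₁ (diffQuot h T a)‖ ^ 2 := inner_self_eq_norm_sq (𝕜 := ℂ) _
  rw [h3] at h2
  linarith [h2.1]

/-- Dissipation of the weighted energy. -/
lemma IsWeightedShift.energy (S : IsWeightedShift h C T T' M M₁) (a : H) :
    -(2 * (inner ℂ (M a) (M (diffQuot h T' (diffQuot h T a)))).re)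
      ≤ -‖M₁ (diffQuot h T a)‖ ^ 2 + C ^ 2 * ‖M a‖ ^ 2 := by
  have h1 := S.re_form_self_ge a
  rw [S.selfAdjoint] at h1
  nlinarith [sq_nonneg (‖M₁ (diffQuot h T a)‖ - C * ‖M a‖)]

/-- Commutes X past the discrete Laplacian, keeping an adjoint quotient in front of every term with
a single commutator K so that it can later be moved onto the other factor. The input is [X, T'] =
-T'[X, T]T', the commutator with an inverse. -/
lemma diffQuot_mul_comm_of_inv (h1 : T * T' = 1) (h2 : T' * T = 1) (X K : H →L[ℂ] H)
    (hK : K = X * diffQuot h T - diffQuot h T * X) :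
    X * diffQuot h T' * diffQuot h T = diffQuot h T' * diffQuot h T * X + diffQuot h T' * K
      + diffQuot h T' * (T' * K) + T' * (K * diffQuot h T' - diffQuot h T' * K) := by
  set c : ℂ := ((h⁻¹ : ℝ) : ℂ) with hc
  have e1 : X * T' = T' * X - T' * (X * T - T * X) * T' := by
    rw [mul_sub, sub_mul, mul_assoc T' (X * T), mul_assoc X, h1, mul_one, ← mul_assoc T' T X, h2,
      one_mul]
    abel
  have e2 : X * diffQuot h T' = diffQuot h T' * X - T' * K * T' := by
    rw [hK, diffQuot, diffQuot, ← hc]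
    simp only [mul_smul_comm, smul_mul_assoc, mul_sub, sub_mul, mul_one, one_mul, ← smul_sub] at e1 ⊢
    congr 1
    rw [e1]
    simp only [mul_assoc]
    abel
  have e3 : T' * diffQuot h T = -diffQuot h T' := by
    rw [diffQuot, diffQuot, mul_smul_comm, mul_sub, h2, mul_one, ← smul_neg, neg_sub]
  have e4 : T' * diffQuot h T' = diffQuot h T' * T' := by
    simp [diffQuot, mul_sub, sub_mul]
  have e5 : X * diffQuot h T = diffQuot h T * X + K := by rw [hK]; abel
  calc X * diffQuot h T' * diffQuot h T
      = diffQuot h T' * (X * diffQuot h T) - T' * K * (T' * diffQuot h T) := by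
        rw [e2, sub_mul]; simp only [mul_assoc]
    _ = _ := by
        rw [e3, e5, mul_sub, ← mul_assoc T' (diffQuot h T') K, e4]
        simp only [mul_add, mul_neg, mul_assoc]
        abel

/-- Here x, y, z stand for the norms of Xa, of the quotient of Xa, and of Xa minus the quotient of
a. The dissipation -2y² absorbs every product that contains y by completing the square. -/
lemma dissipation_arith {x y z C c k₁ k₂ k₃ I₁ I₂ I₃ I₄ : ℝ} (hx : 0 ≤ x) (hy : 0 ≤ y)
    (hz : 0 ≤ z) (hC : 0 ≤ C) (hc : 0 ≤ c) (h1 : k₁ ≤ c * z) (h2 : k₂ ≤ c * z) (h3 : k₃ ≤ c * z)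
    (i1 : y ^ 2 - C * (x * y) ≤ I₁) (i2 : -(y * k₁) - C * (x * k₁) ≤ I₂)
    (i3 : -(y * k₂) - C * (x * k₂) ≤ I₃) (i4 : -(x * k₃) ≤ I₄) :
    -(2 * (I₁ + I₂ + I₃ + I₄)) ≤ (C + c + 1) ^ 2 * 8 * (x ^ 2 + z ^ 2) := by
  have j1 := mul_le_mul_of_nonneg_left h1 hy
  have j2 := mul_le_mul_of_nonneg_left h2 hy
  have j3 := mul_le_mul_of_nonneg_left h3 hx
  have k1 := mul_le_mul_of_nonneg_left h1 (mul_nonneg hC hx)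
  have k2 := mul_le_mul_of_nonneg_left h2 (mul_nonneg hC hx)
  have l1 : -2 * y ^ 2 + 2 * y * (C * x + 2 * c * z) ≤ (C * x + 2 * c * z) ^ 2 / 2 := by
    have := sq_nonneg (2 * y - (C * x + 2 * c * z))
    linarith
  have l2 : 0 ≤ C * c := mul_nonneg hC hc
  have l3 : 2 * (x * z) ≤ x ^ 2 + z ^ 2 := by linarith [sq_nonneg (x - z)]
  have l4 : (C * x + 2 * c * z) ^ 2 / 2 ≤ (C ^ 2 + 4 * c ^ 2) * (x ^ 2 + z ^ 2) := by
    linarith [sq_nonneg (C * x - 2 * c * z), sq_nonneg (C * z), sq_nonneg (c * x)]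
  have l5 := mul_le_mul_of_nonneg_left l3 (show 0 ≤ 4 * (C * c) + c by positivity)
  have l6 : (C ^ 2 + 4 * c ^ 2) + (4 * (C * c) + c) ≤ (C + c + 1) ^ 2 * 8 := by
    linarith [sq_nonneg C, sq_nonneg c]
  have l7 := mul_le_mul_of_nonneg_right l6 (add_nonneg (sq_nonneg x) (sq_nonneg z))
  have l8 := mul_nonneg l2 (mul_nonneg hx hz)
  linarith

/-- Dissipation of the weighted energy of `X a`, when the commutators of `X` with the difference
quotients are controlled by `X - diffQuot h T`. -/
lemma IsWeightedShift.energy_commutator (S : IsWeightedShift h C T T' M M₁) (X K : H →L[ℂ] H)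
    (hK : K = X * diffQuot h T - diffQuot h T * X) {c : ℝ} (hc : 0 ≤ c) (a : H)
    (h1 : ‖M₁ (K a)‖ ≤ c * ‖M (X a - diffQuot h T a)‖)
    (h2 : ‖M₁ (T' (K a))‖ ≤ c * ‖M (X a - diffQuot h T a)‖)
    (h3 : ‖M (T' (K (diffQuot h T' a) - diffQuot h T' (K a)))‖
      ≤ c * ‖M (X a - diffQuot h T a)‖) :
    -(2 * (inner ℂ (M (X a)) (M (X (diffQuot h T' (diffQuot h T a))))).re)
      ≤ (C + c + 1) ^ 2 * 8 * (‖M (X a)‖ ^ 2 + ‖M (X a - diffQuot h T a)‖ ^ 2) := by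
  have e := DFunLike.congr_fun (diffQuot_mul_comm_of_inv (h := h) S.mul_inv S.inv_mul X K hK) a
  simp only [mul_apply_eq_comp, add_apply, sub_apply] at e
  rw [e, ← S.selfAdjoint, inner_add_right, inner_add_right, inner_add_right, Complex.add_re,
    Complex.add_re, Complex.add_re]
  have i1 := S.re_form_self_ge (X a)
  have i2 := S.re_form_ge (X a) (K a)
  have i3 := S.re_form_ge (X a) (T' (K a))
  have i4 := (Complex.abs_re_le_norm _).trans (norm_inner_le_norm (𝕜 := ℂ) (M (X a))
    (M (T' (K (diffQuot h T' a) - diffQuot h T' (K a)))))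
  rw [S.selfAdjoint (M (X a)) (T' (K (diffQuot h T' a) - diffQuot h T' (K a)))]
  rw [abs_le] at i4
  exact dissipation_arith (norm_nonneg _) (norm_nonneg _) (norm_nonneg _) S.nonneg hc h1 h2 h3
    i1 i2 i3 i4.1

lemma hasDerivWithinAt_norm_sq {G : ℝ → H} {G' : H} {s : Set ℝ} {t : ℝ} (A : H →L[ℂ] H)
    (hG : HasDerivWithinAt G G' s t) :
    HasDerivWithinAt (fun r => ‖A (G r)‖ ^ 2) (2 * (inner ℂ (A (G t)) (A G')).re) s t := by
  have h1 : HasDerivWithinAt (fun r => A (G r)) (A G') s t :=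
    (A.restrictScalars ℝ).hasFDerivAt.comp_hasDerivWithinAt t hG
  have h2 := h1.inner ℂ h1
  have h3 := (Complex.reCLM.hasFDerivAt).comp_hasDerivWithinAt t h2
  refine (h3.congr_deriv ?_).congr ?_ ?_
  · rw [← inner_conj_symm (A G') (A (G t))]
    simp only [Complex.reCLM_apply, Complex.add_re, Complex.conj_re]
    ring
  · intro r _
    exact (inner_self_eq_norm_sq (𝕜 := ℂ) (A (G r))).symm
  · exact (inner_self_eq_norm_sq (𝕜 := ℂ) (A (G t))).symm

end Abstract

/-! ### Translations, multiplications and phases on L²(ℝ) -/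

/-- Complex-valued square-integrable functions on the line. -/
abbrev L2R : Type := Lp ℂ 2 (volume : Measure ℝ)

/-- `f` is a representative of `v ∈ L²`. -/
def Rep (v : L2R) (f : ℝ → ℂ) : Prop := v =ᵐ[volume] f

lemma rep_self (v : L2R) : Rep v v := Filter.EventuallyEq.rfl

lemma Rep.eq {v w : L2R} {f : ℝ → ℂ} (hv : Rep v f) (hw : Rep w f) : v = w :=
  Lp.ext (hv.trans hw.symm)

lemma Rep.congr {v : L2R} {f g : ℝ → ℂ} (hv : Rep v f) (h : ∀ y, f y = g y) : Rep v g :=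
  hv.trans (Filter.Eventually.of_forall h)

lemma Rep.add {v w : L2R} {f g : ℝ → ℂ} (hv : Rep v f) (hw : Rep w g) :
    Rep (v + w) (fun y => f y + g y) := by
  filter_upwards [Lp.coeFn_add v w, hv, hw] with y h1 h2 h3
  rw [h1, Pi.add_apply, h2, h3]

lemma Rep.sub {v w : L2R} {f g : ℝ → ℂ} (hv : Rep v f) (hw : Rep w g) :
    Rep (v - w) (fun y => f y - g y) := by
  filter_upwards [Lp.coeFn_sub v w, hv, hw] with y h1 h2 h3
  rw [h1, Pi.sub_apply, h2, h3]

lemma Rep.smul {v : L2R} {f : ℝ → ℂ} (c : ℂ) (hv : Rep v f) :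
    Rep (c • v) (fun y => c * f y) := by
  filter_upwards [Lp.coeFn_smul c v, hv] with y h1 h2
  rw [h1, Pi.smul_apply, h2, smul_eq_mul]

lemma ae_comp_add {p : ℝ → Prop} (hp : ∀ᵐ y : ℝ, p y) (s : ℝ) : ∀ᵐ y : ℝ, p (y + s) :=
  (measurePreserving_add_right volume s).quasiMeasurePreserving.ae hp

/-- Translation `v ↦ v (· + s)` on `L²`. -/
noncomputable def trans (s : ℝ) : L2R →L[ℂ] L2R :=
  (Lp.compMeasurePreservingₗᵢ ℂ (fun y : ℝ => y + s)
    (measurePreserving_add_right volume s)).toContinuousLinearMap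

lemma norm_trans (s : ℝ) (v : L2R) : ‖trans s v‖ = ‖v‖ :=
  (Lp.compMeasurePreservingₗᵢ ℂ (fun y : ℝ => y + s)
    (measurePreserving_add_right volume s)).norm_map v

lemma Rep.trans {v : L2R} {f : ℝ → ℂ} (s : ℝ) (hv : Rep v f) :
    Rep (trans s v) (fun y => f (y + s)) := by
  have h1 : Rep (ShearFlow.trans s v) (v ∘ fun y => y + s) :=
    Lp.coeFn_compMeasurePreserving v (measurePreserving_add_right volume s)
  filter_upwards [h1, ae_comp_add hv s] with y h2 h3
  simp [h2, h3]

/-- A pointwise bound by a translate is enough, since translations are isometries. All operators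
below are shifts times multipliers, so their bounds reduce to inequalities between multipliers. -/
lemma Rep.norm_le {v w : L2R} {f g : ℝ → ℂ} (hv : Rep v f) (hw : Rep w g) {c : ℝ} (s : ℝ)
    (hfg : ∀ y, ‖f y‖ ≤ c * ‖g (y + s)‖) : ‖v‖ ≤ c * ‖w‖ := by
  rw [← norm_trans s w]
  refine Lp.norm_le_mul_norm_of_ae_le_mul ?_
  filter_upwards [hv, hw.trans s] with y h1 h2
  rw [h1, h2]
  exact hfg y

lemma Rep.exists_mul {w : L2R} {f g : ℝ → ℂ} (hf : AEStronglyMeasurable f) (hw : Rep w g) {c : ℝ}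
    (hfg : ∀ y, ‖f y‖ ≤ c * ‖g y‖) : ∃ v : L2R, Rep v f ∧ ‖v‖ ≤ c * ‖w‖ := by
  have h1 : MemLp f 2 (volume : Measure ℝ) := by
    refine (Lp.memLp w).of_le_mul (c := c) hf ?_
    filter_upwards [hw] with y hy
    rw [hy]
    exact hfg y
  have h2 : Rep h1.toLp f := h1.coeFn_toLp
  refine ⟨h1.toLp, h2, h2.norm_le hw 0 (by simpa using hfg)⟩

lemma exists_mulBC (a : ℝ →ᵇ ℂ) (v : L2R) :
    ∃ w : L2R, Rep w (fun y => a y * v y) ∧ ‖w‖ ≤ ‖a‖ * ‖v‖ :=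
  Rep.exists_mul (a.continuous.aestronglyMeasurable.mul (Lp.aestronglyMeasurable v)) (rep_self v)
    fun y => by
      rw [Pi.mul_apply, norm_mul]
      exact mul_le_mul_of_nonneg_right (a.norm_coe_le_norm y) (norm_nonneg _)

/-- Multiplication by a bounded continuous function on `L²`. -/
noncomputable def mulBC (a : ℝ →ᵇ ℂ) : L2R →L[ℂ] L2R :=
  LinearMap.mkContinuous
    { toFun := fun v => (exists_mulBC a v).choose
      map_add' := fun v w => by
        refine (exists_mulBC a (v + w)).choose_spec.1.eq ?_
        have h := (exists_mulBC a v).choose_spec.1.add (exists_mulBC a w).choose_spec.1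
        filter_upwards [h, Lp.coeFn_add v w] with y h1 h2
        rw [h1, h2, Pi.add_apply, mul_add]
      map_smul' := fun c v => by
        refine (exists_mulBC a (c • v)).choose_spec.1.eq ?_
        have h := (exists_mulBC a v).choose_spec.1.smul c
        filter_upwards [h, Lp.coeFn_smul c v] with y h1 h2
        rw [RingHom.id_apply, h1, h2, Pi.smul_apply, smul_eq_mul, mul_left_comm] }
    ‖a‖ (fun v => (exists_mulBC a v).choose_spec.2)

lemma Rep.mulBC {v : L2R} {f : ℝ → ℂ} (a : ℝ →ᵇ ℂ) (hv : Rep v f) :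
    Rep (mulBC a v) (fun y => a y * f y) := by
  have h : Rep (ShearFlow.mulBC a v) (fun y => a y * v y) := (exists_mulBC a v).choose_spec.1
  filter_upwards [h, hv] with y h1 h2
  rw [h1, h2]

lemma inner_eq_integral {v w : L2R} {f g : ℝ → ℂ} (hv : Rep v f) (hw : Rep w g) :
    inner ℂ v w = ∫ y, (starRingEnd ℂ) (f y) * g y := by
  rw [L2.inner_def]
  refine integral_congr_ae ?_
  filter_upwards [hv, hw] with y h1 h2
  simp only [h1, h2, RCLike.inner_apply]
  ring

lemma inner_trans (s : ℝ) (v w : L2R) : inner ℂ v (trans s w) = inner ℂ (trans (-s) v) w := by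
  rw [inner_eq_integral (rep_self v) ((rep_self w).trans s),
    inner_eq_integral ((rep_self v).trans (-s)) (rep_self w),
    ← integral_add_right_eq_self _ (-s)]
  simp

lemma inner_mulBC {a b : ℝ →ᵇ ℂ} (hab : ∀ y, a y = (starRingEnd ℂ) (b y)) (v w : L2R) :
    inner ℂ v (mulBC a w) = inner ℂ (mulBC b v) w := by
  rw [inner_eq_integral (rep_self v) ((rep_self w).mulBC a),
    inner_eq_integral ((rep_self v).mulBC b) (rep_self w)]
  congr 1
  ext y
  rw [hab, map_mul]
  ring

lemma trans_trans_neg (s : ℝ) (v : L2R) : trans s (trans (-s) v) = v :=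
  (((rep_self v).trans (-s)).trans s).eq (by simpa using rep_self v)

lemma trans_neg_trans (s : ℝ) (v : L2R) : trans (-s) (trans s v) = v := by
  simpa using trans_trans_neg (-s) v

/-- The unimodular complex number `e^{iθ}`. -/
noncomputable def cis (θ : ℝ) : ℂ := Complex.exp (θ * Complex.I)

lemma norm_cis (θ : ℝ) : ‖cis θ‖ = 1 := Complex.norm_exp_ofReal_mul_I θ

lemma cis_add (a b : ℝ) : cis (a + b) = cis a * cis b := by
  simp [cis, add_mul, Complex.exp_add]

lemma cis_zero : cis 0 = 1 := by simp [cis]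

lemma cis_mul_neg (a : ℝ) : cis a * cis (-a) = 1 := by rw [← cis_add, add_neg_cancel, cis_zero]

lemma conj_cis (a : ℝ) : (starRingEnd ℂ) (cis a) = cis (-a) := by
  simp [cis, ← Complex.exp_conj]

lemma continuous_cis : Continuous cis := by unfold cis; fun_prop

lemma norm_cis_sub_one_le (θ : ℝ) : ‖cis θ - 1‖ ≤ |θ| := by
  have := Real.norm_exp_I_mul_ofReal_sub_one_le (x := θ)
  rwa [mul_comm] at this

lemma le_norm_cis_sub_one {θ : ℝ} (hθ : |θ| ≤ 1) : |θ| / 2 ≤ ‖cis θ - 1‖ := by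
  have h1 : ‖cis θ - 1‖ = 2 * |Real.sin (θ / 2)| := by
    have := Complex.norm_exp_I_mul_ofReal_sub_one θ
    rw [mul_comm Complex.I] at this
    rw [cis, this, Real.norm_eq_abs, abs_mul, abs_two]
  have h2 : |θ| / 4 ≤ |Real.sin (θ / 2)| := by
    have h3 := Real.mul_abs_le_abs_sin (x := θ / 2) (by
      rw [abs_div, abs_two]; linarith [Real.pi_gt_three])
    rw [abs_div, abs_two] at h3
    have h4 : 1 / 2 ≤ 2 / Real.pi := by
      rw [div_le_div_iff₀ two_pos Real.pi_pos]; linarith [Real.pi_lt_four]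
    nlinarith [abs_nonneg θ]
  rw [h1]
  linarith

lemma norm_cis_sub_one_sub_le {θ : ℝ} (hθ : |θ| ≤ 1) : ‖cis θ - 1 - θ * Complex.I‖ ≤ θ ^ 2 := by
  have := Complex.norm_exp_sub_one_sub_id_le (x := θ * Complex.I) (by simpa using hθ)
  simpa [cis] using this

/-- The bounded continuous function `e^{iθ(y)}`. -/
noncomputable def phase (θ : C(ℝ, ℝ)) : ℝ →ᵇ ℂ :=
  BoundedContinuousFunction.ofNormedAddCommGroup (fun y => cis (θ y))
    (continuous_cis.comp θ.continuous) 1 (fun _ => (norm_cis _).le)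

/-- Multiplication by `e^{isu}`. -/
noncomputable def phaseOp (u : C(ℝ, ℝ)) (s : ℝ) : L2R →L[ℂ] L2R := mulBC (phase (s • u))

lemma Rep.phaseOp {v : L2R} {f : ℝ → ℂ} (u : C(ℝ, ℝ)) (s : ℝ) (hv : Rep v f) :
    Rep (phaseOp u s v) (fun y => cis (s * u y) * f y) := hv.mulBC _

lemma norm_phaseOp (u : C(ℝ, ℝ)) (s : ℝ) (v : L2R) : ‖phaseOp u s v‖ = ‖v‖ := by
  refine le_antisymm ?_ ?_
  · simpa using ((rep_self v).phaseOp u s).norm_le (rep_self v) (c := 1) 0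
      (fun y => by simp [norm_cis])
  · simpa using (rep_self v).norm_le ((rep_self v).phaseOp u s) (c := 1) 0
      (fun y => by simp [norm_cis])

lemma phaseOp_add (u : C(ℝ, ℝ)) (s t : ℝ) (v : L2R) :
    phaseOp u s (phaseOp u t v) = phaseOp u (s + t) v := by
  refine (((rep_self v).phaseOp u t).phaseOp u s).eq ?_
  convert (rep_self v).phaseOp u (s + t) using 2
  rw [add_mul, cis_add, mul_assoc]

lemma phaseOp_zero (u : C(ℝ, ℝ)) (v : L2R) : phaseOp u 0 v = v :=
  ((rep_self v).phaseOp u 0).eq (by simpa [cis_zero] using rep_self v)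

lemma inner_phaseOp (u : C(ℝ, ℝ)) (s : ℝ) (v w : L2R) :
    inner ℂ v (phaseOp u s w) = inner ℂ (phaseOp u (-s) v) w :=
  inner_mulBC (fun y => by
    change cis _ = (starRingEnd ℂ) (cis _)
    rw [conj_cis]
    simp) v w

/-- The translation by `h`, conjugated by `e^{isu}`. -/
noncomputable def shiftOp (u : C(ℝ, ℝ)) (h s : ℝ) : L2R →L[ℂ] L2R :=
  phaseOp u s * trans h * phaseOp u (-s)

lemma Rep.shiftOp {v : L2R} {f : ℝ → ℂ} (u : C(ℝ, ℝ)) (h s : ℝ) (hv : Rep v f) :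
    Rep (shiftOp u h s v) (fun y => cis (s * (u y - u (y + h))) * f (y + h)) := by
  have := ((hv.phaseOp u (-s)).trans h).phaseOp u s
  refine Filter.EventuallyEq.trans this (Filter.Eventually.of_forall fun y => ?_)
  simp only
  rw [← mul_assoc, ← cis_add]
  ring_nf

lemma shiftOp_zero (u : C(ℝ, ℝ)) (h : ℝ) : shiftOp u h 0 = trans h := by
  ext1 v
  simp [shiftOp, mul_apply_eq_comp, phaseOp_zero]

lemma norm_shiftOp (u : C(ℝ, ℝ)) (h s : ℝ) (v : L2R) : ‖shiftOp u h s v‖ = ‖v‖ := by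
  simp [shiftOp, mul_apply_eq_comp, norm_phaseOp, norm_trans]

lemma shiftOp_mul_neg (u : C(ℝ, ℝ)) (h s : ℝ) : shiftOp u h s * shiftOp u (-h) s = 1 := by
  ext1 v
  simp only [shiftOp, mul_apply_eq_comp, phaseOp_add, neg_add_cancel, phaseOp_zero,
    trans_trans_neg, add_neg_cancel, one_apply_eq_self]

lemma shiftOp_neg_mul (u : C(ℝ, ℝ)) (h s : ℝ) : shiftOp u (-h) s * shiftOp u h s = 1 := by
  simpa using shiftOp_mul_neg u (-h) s

lemma inner_shiftOp (u : C(ℝ, ℝ)) (h s : ℝ) (v w : L2R) :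
    inner ℂ v (shiftOp u (-h) s w) = inner ℂ (shiftOp u h s v) w := by
  simp only [shiftOp, mul_apply_eq_comp, inner_phaseOp, inner_trans, neg_neg]

/-! ### Slowly varying weights -/

/-- A positive bounded weight that varies at most exponentially. -/
structure IsWeight (V : ℝ) (w : ℝ →ᵇ ℝ) : Prop where
  pos : ∀ y, 0 < w y
  growth : ∀ y s, w (y + s) ≤ Real.exp (V * |s|) * w y

/-- Multiplication by a real weight. -/
noncomputable def weightOp (w : ℝ →ᵇ ℝ) : L2R →L[ℂ] L2R :=
  mulBC (BoundedContinuousFunction.ofNormedAddCommGroup (fun y => (w y : ℂ)) (by fun_prop) ‖w‖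
    (fun y => by simpa using w.norm_coe_le_norm y))

lemma Rep.weightOp {v : L2R} {f : ℝ → ℂ} (w : ℝ →ᵇ ℝ) (hv : Rep v f) :
    Rep (weightOp w v) (fun y => w y * f y) := hv.mulBC _

lemma inner_weightOp (w : ℝ →ᵇ ℝ) (a b : L2R) :
    inner ℂ (weightOp w a) b = inner ℂ a (weightOp w b) :=
  (inner_mulBC (fun y => (Complex.conj_ofReal (w y)).symm) a b).symm

lemma weightOp_phaseOp (w : ℝ →ᵇ ℝ) (u : C(ℝ, ℝ)) (s : ℝ) (v : L2R) :
    weightOp w (phaseOp u s v) = phaseOp u s (weightOp w v) := by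
  refine (((rep_self v).phaseOp u s).weightOp w).eq ?_
  convert ((rep_self v).weightOp w).phaseOp u s using 2
  ring

/-- The weight `w(· + h)`, as an operator. -/
noncomputable def weightOpShift (w : ℝ →ᵇ ℝ) (h : ℝ) : L2R →L[ℂ] L2R :=
  trans h * weightOp w * trans (-h)

lemma Rep.weightOpShift {v : L2R} {f : ℝ → ℂ} (w : ℝ →ᵇ ℝ) (h : ℝ) (hv : Rep v f) :
    Rep (weightOpShift w h v) (fun y => w (y + h) * f y) := by
  have := ((hv.trans (-h)).weightOp w).trans h
  simp only [add_neg_cancel_right] at this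
  exact this

lemma shiftOp_mul_weightOp (u : C(ℝ, ℝ)) (w : ℝ →ᵇ ℝ) (h s : ℝ) :
    shiftOp u h s * weightOp w = weightOpShift w h * shiftOp u h s := by
  ext1 v
  refine (((rep_self v).weightOp w).shiftOp u h s).eq ?_
  refine (((rep_self v).shiftOp u h s).weightOpShift w h).congr fun y => ?_
  ring

lemma inner_weightOpShift (w : ℝ →ᵇ ℝ) (h : ℝ) (a b : L2R) :
    inner ℂ (weightOpShift w h a) b = inner ℂ a (weightOpShift w h b) := by
  rw [inner_eq_integral ((rep_self a).weightOpShift w h) (rep_self b),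
    inner_eq_integral (rep_self a) ((rep_self b).weightOpShift w h)]
  congr 1
  ext y
  simp only [map_mul, Complex.conj_ofReal]
  ring

/-- Factor the difference of squares. The growth bound in either direction gives a difference of
order h, relative to whichever of the two weights is smaller, and the sum is at most twice the
larger one. -/
lemma IsWeight.sq_sub_sq_le {V : ℝ} {w : ℝ →ᵇ ℝ} (hw : IsWeight V w) (hV : 0 ≤ V) {h : ℝ}
    (hh : 0 < h) (hVh : V * h ≤ 1) (y : ℝ) :
    |w (y + h) * w (y + h) - w y * w y| ≤ h * (4 * V) * (w y * w (y + h)) := by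
  have h1 := hw.growth y h
  have h2 := hw.growth (y + h) (-h)
  rw [add_neg_cancel_right, abs_neg] at h2
  rw [abs_of_pos hh] at h1 h2
  have h3 := Real.abs_exp_sub_one_le (x := V * h) (by rwa [abs_of_nonneg (by positivity)])
  rw [abs_of_nonneg (show 0 ≤ V * h by positivity)] at h3
  have h4 := (abs_le.1 h3).2
  have p1 := hw.pos y
  have p2 := hw.pos (y + h)
  have h5 : w (y + h) - w y ≤ 2 * (V * h) * w y := by nlinarith
  have h6 : w y - w (y + h) ≤ 2 * (V * h) * w (y + h) := by nlinarith
  rw [abs_le]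
  constructor
  · rcases le_total (w (y + h)) (w y) with h7 | h7
    · nlinarith [mul_le_mul_of_nonneg_right h6 (add_pos p1 p2).le,
        mul_le_mul_of_nonneg_left h7 (show 0 ≤ 2 * (V * h) * w (y + h) by positivity)]
    · have : 0 ≤ h * (4 * V) * (w y * w (y + h)) := by positivity
      nlinarith
  · rcases le_total (w (y + h)) (w y) with h7 | h7
    · have : 0 ≤ h * (4 * V) * (w y * w (y + h)) := by positivity
      nlinarith
    · nlinarith [mul_le_mul_of_nonneg_right h5 (add_pos p1 p2).le,
        mul_le_mul_of_nonneg_left h7 (show 0 ≤ 2 * (V * h) * w y by positivity)]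

lemma IsWeight.isWeightedShift {V : ℝ} {w : ℝ →ᵇ ℝ} (hw : IsWeight V w) (hV : 0 ≤ V) {h : ℝ}
    (hh : 0 < h) (hVh : V * h ≤ 1) (u : C(ℝ, ℝ)) (s : ℝ) :
    IsWeightedShift h (4 * V) (shiftOp u h s) (shiftOp u (-h) s) (weightOp w)
      (weightOpShift w h) where
  pos := hh
  nonneg := by positivity
  mul_inv := shiftOp_mul_neg u h s
  inv_mul := shiftOp_neg_mul u h s
  adjoint := inner_shiftOp u h s
  selfAdjoint := inner_weightOp w
  selfAdjoint' := inner_weightOpShift w h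
  comm := shiftOp_mul_weightOp u w h s
  close a b := by
    have hp : ∀ y, w (y + h) ≠ 0 := fun y => (hw.pos (y + h)).ne'
    -- The difference M₁² - M² is divided by one factor M₁, which is then moved onto b; the
    -- remaining multiplier is bounded by h · 4V · w(y).
    obtain ⟨d, hd, hn⟩ := Rep.exists_mul (w := weightOp w a) (c := h * (4 * V))
      (f := fun y => (((w (y + h) * w (y + h) - w y * w y) / w (y + h) : ℝ) : ℂ) * a y)
      ((Complex.continuous_ofReal.comp (by fun_prop (disch := exact hp _))).aestronglyMeasurable.mul
        (Lp.aestronglyMeasurable a)) ((rep_self a).weightOp w) (fun y => by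
          have h1 := hw.sq_sub_sq_le hV hh hVh y
          have p1 := hw.pos y
          have p2 := hw.pos (y + h)
          rw [norm_mul, norm_mul, Complex.norm_real, Complex.norm_real, Real.norm_eq_abs,
            Real.norm_eq_abs, abs_div, abs_of_pos p1, abs_of_pos p2, ← mul_assoc]
          gcongr
          rw [div_le_iff₀ p2]
          linarith)
    have h1 : weightOpShift w h (weightOpShift w h a) - weightOp w (weightOp w a)
        = weightOpShift w h d := by
      refine ((((rep_self a).weightOpShift w h).weightOpShift w h).sub
        (((rep_self a).weightOp w).weightOp w)).eq ?_
      refine (hd.weightOpShift w h).congr fun y => ?_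
      have := hp y
      push_cast
      have h2 : (w (y + h) : ℂ) ≠ 0 := by exact_mod_cast this
      field_simp
    rw [h1, inner_weightOpShift]
    refine (norm_inner_le_norm _ _).trans ?_
    rw [← mul_assoc]
    exact mul_le_mul_of_nonneg_right hn (norm_nonneg _)

/-! ### Commutators of the difference quotients -/

/-- Bounds on the first three differences of step `h` of an increasing function. -/
structure IsDiffShear (C c₀ N h : ℝ) (u : C(ℝ, ℝ)) : Prop where
  lower : ∀ y, c₀ * h ≤ u (y + h) - u y
  upper : ∀ y, u (y + h) - u y ≤ N * h
  second : ∀ y, |u (y + h + h) - 2 * u (y + h) + u y| ≤ C * h * (u (y + h) - u y)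
  second' : ∀ y, |u (y + h + h) - 2 * u (y + h) + u y| ≤ C * h * (u (y + h + h) - u (y + h))
  third : ∀ y, |u (y + h + h + h) - 3 * u (y + h + h) + 3 * u (y + h) - u y|
    ≤ C * h ^ 2 * (u (y + h + h) - u (y + h))

/-- The difference quotient for the shift conjugated by `e^{isu}`. -/
noncomputable abbrev covDiff (u : C(ℝ, ℝ)) (h s : ℝ) : L2R →L[ℂ] L2R := diffQuot h (shiftOp u h s)

/-- The adjoint of `covDiff`. -/
noncomputable abbrev covDiff' (u : C(ℝ, ℝ)) (h s : ℝ) : L2R →L[ℂ] L2R :=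
  diffQuot h (shiftOp u (-h) s)

/-- The commutator of the two difference quotients. -/
noncomputable def covComm (u : C(ℝ, ℝ)) (h s : ℝ) : L2R →L[ℂ] L2R :=
  covDiff u h 0 * covDiff u h s - covDiff u h s * covDiff u h 0

lemma Rep.covDiff {v : L2R} {f : ℝ → ℂ} (u : C(ℝ, ℝ)) (h h' s : ℝ) (hv : Rep v f) :
    Rep (diffQuot h (ShearFlow.shiftOp u h' s) v)
      (fun y => (h⁻¹ : ℝ) * (cis (s * (u y - u (y + h'))) * f (y + h') - f y)) := by
  rw [diffQuot_apply]
  exact ((hv.shiftOp u h' s).sub hv).smul _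

/-- The two shifts commute up to a phase, so the commutator is a difference of two phases: the
discrete form of -isu''. -/
lemma Rep.covComm {v : L2R} {f : ℝ → ℂ} (u : C(ℝ, ℝ)) (h s : ℝ) (hv : Rep v f) :
    Rep (covComm u h s v) (fun y => (h⁻¹ : ℝ) ^ 2 * (cis (s * (u (y + h) - u (y + h + h)))
      - cis (s * (u y - u (y + h)))) * f (y + h + h)) := by
  refine (((hv.covDiff u h h s).covDiff u h h 0).sub ((hv.covDiff u h h 0).covDiff u h h s)).congr fun y => ?_
  simp only [zero_mul, cis_zero]
  ring

/-- The discrete form of isu', the multiplier that dominates all commutators. -/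
lemma rep_covDiff_sub {v : L2R} {f : ℝ → ℂ} (u : C(ℝ, ℝ)) (h s : ℝ) (hv : Rep v f) :
    Rep (covDiff u h 0 v - covDiff u h s v)
      (fun y => (h⁻¹ : ℝ) * (1 - cis (s * (u y - u (y + h)))) * f (y + h)) := by
  refine ((hv.covDiff u h h 0).sub (hv.covDiff u h h s)).congr fun y => ?_
  simp only [zero_mul, cis_zero]
  ring

lemma norm_cis_sub_cis_le (a b : ℝ) : ‖cis a - cis b‖ ≤ |a - b| := by
  have h1 : cis a - cis b = cis b * (cis (a - b) - 1) := by
    rw [mul_sub, ← cis_add]; simp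
  rw [h1, norm_mul, norm_cis, one_mul]
  exact norm_cis_sub_one_le _

/-- The first order terms of the two phases combine into a + b, where the caller has cancellation;
what remains is quadratic. -/
lemma norm_two_sub_cis_le {a b e : ℝ} (ha : |a| ≤ e) (hb : |b| ≤ e) (he : e ≤ 1) :
    ‖2 - cis a - cis b‖ ≤ |a + b| + 2 * e ^ 2 := by
  have h1 := norm_cis_sub_one_sub_le (ha.trans he)
  have h2 := norm_cis_sub_one_sub_le (hb.trans he)
  have h3 : 2 - cis a - cis b = -((cis a - 1 - a * Complex.I) + (cis b - 1 - b * Complex.I)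
      + ((a + b : ℝ) : ℂ) * Complex.I) := by push_cast; ring
  rw [h3, norm_neg]
  refine (norm_add₃_le ..).trans ?_
  rw [norm_mul, Complex.norm_I, mul_one, Complex.norm_real, Real.norm_eq_abs]
  have h4 : a ^ 2 ≤ e ^ 2 := by rw [← sq_abs]; gcongr
  have h5 : b ^ 2 ≤ e ^ 2 := by rw [← sq_abs]; gcongr
  linarith

/-- As long as the phase increment is at most one radian, 1 - e^{iθ} is comparable to θ. This is the
reason for the condition |s|Nh ≤ 1 throughout. -/
lemma half_le_norm_one_sub_cis {s d : ℝ} (hd : 0 ≤ d) (h : |s| * d ≤ 1) :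
    |s| * d / 2 ≤ ‖1 - cis (s * -d)‖ := by
  have h1 : |s * -d| = |s| * d := by rw [abs_mul, abs_neg, abs_of_nonneg hd]
  have h2 := le_norm_cis_sub_one (θ := s * -d) (by rwa [h1])
  rwa [h1, norm_sub_rev] at h2

section Bounds

variable {C c₀ N h V : ℝ} {u : C(ℝ, ℝ)} {w : ℝ →ᵇ ℝ}

lemma IsDiffShear.nonneg (hu : IsDiffShear C c₀ N h u) (hc : 0 ≤ c₀) (hh : 0 < h) (y : ℝ) :
    0 ≤ u (y + h) - u y := le_trans (by positivity) (hu.lower y)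

lemma IsDiffShear.mul_le_one (hu : IsDiffShear C c₀ N h u) {s : ℝ}
    (hs : |s| * (N * h) ≤ 1) (y : ℝ) : |s| * (u (y + h) - u y) ≤ 1 :=
  (mul_le_mul_of_nonneg_left (hu.upper y) (abs_nonneg s)).trans hs

lemma IsWeight.le_three_mul (hw : IsWeight V w) (hh : 0 < h) (hVh : V * h ≤ 1) (y : ℝ) :
    w (y + h) ≤ 3 * w y := by
  refine (hw.growth y h).trans ?_
  rw [abs_of_pos hh]
  have h1 : Real.exp (V * h) ≤ Real.exp 1 := Real.exp_le_exp.2 hVh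
  have h2 := Real.exp_one_lt_d9
  have := hw.pos y
  gcongr
  linarith

/-- The discrete form of |su''| ≤ C|su'|: a difference of phases is bounded by the second difference
of u, hence by the first difference, hence by the phase increment. -/
lemma IsDiffShear.norm_cis_sub_le (hu : IsDiffShear C c₀ N h u) (hc : 0 ≤ c₀) (hC : 0 ≤ C)
    (hh : 0 < h) {s : ℝ} (hs : |s| * (N * h) ≤ 1) (y : ℝ) :
    ‖cis (s * (u (y + h) - u (y + h + h))) - cis (s * (u y - u (y + h)))‖
      ≤ 2 * C * h * ‖1 - cis (s * (u (y + h) - u (y + h + h)))‖ := by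
  have h1 := half_le_norm_one_sub_cis (hu.nonneg hc hh (y + h)) (hu.mul_le_one hs (y + h))
  rw [neg_sub] at h1
  refine (norm_cis_sub_cis_le _ _).trans ?_
  have h2 := hu.second' y
  calc |s * (u (y + h) - u (y + h + h)) - s * (u y - u (y + h))|
      = |s| * |u (y + h + h) - 2 * u (y + h) + u y| := by
        rw [← abs_mul, ← abs_neg]; ring_nf
    _ ≤ |s| * (C * h * (u (y + h + h) - u (y + h))) := by gcongr
    _ = 2 * C * h * (|s| * (u (y + h + h) - u (y + h)) / 2) := by ring
    _ ≤ _ := by gcongr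

lemma IsDiffShear.norm_covComm_le (hu : IsDiffShear C c₀ N h u) (hc : 0 ≤ c₀) (hC : 0 ≤ C)
    (hh : 0 < h) (hw : IsWeight V w) {s : ℝ} (hs : |s| * (N * h) ≤ 1) (v : L2R) :
    ‖weightOpShift w h (covComm u h s v)‖
      ≤ 2 * C * ‖weightOp w (covDiff u h 0 v - covDiff u h s v)‖ := by
  refine (((rep_self v).covComm u h s).weightOpShift w h).norm_le
    ((rep_covDiff_sub u h s (rep_self v)).weightOp w) h fun y => ?_
  have h1 := hu.norm_cis_sub_le hc hC hh hs y
  simp only [norm_mul, norm_pow, Complex.norm_real, Real.norm_eq_abs, abs_inv, abs_of_pos hh,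
    abs_of_pos (hw.pos _)]
  have p := hw.pos (y + h)
  calc w (y + h) * (h⁻¹ ^ 2 * ‖cis (s * (u (y + h) - u (y + h + h))) - cis (s * (u y - u (y + h)))‖
        * ‖v (y + h + h)‖)
      ≤ w (y + h) * (h⁻¹ ^ 2 * (2 * C * h * ‖1 - cis (s * (u (y + h) - u (y + h + h)))‖)
        * ‖v (y + h + h)‖) := by gcongr
    _ = _ := by field_simp

/-- Compared with `IsDiffShear.norm_covComm_le`, the weight is now evaluated one step away from the
multiplier; this costs the factor 3. -/
lemma IsDiffShear.norm_shift_covComm_le (hu : IsDiffShear C c₀ N h u) (hc : 0 ≤ c₀) (hC : 0 ≤ C)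
    (hh : 0 < h) (hVh : V * h ≤ 1) (hw : IsWeight V w) {s : ℝ}
    (hs : |s| * (N * h) ≤ 1) (v : L2R) :
    ‖weightOpShift w h (shiftOp u (-h) s (covComm u h s v))‖
      ≤ 6 * C * ‖weightOp w (covDiff u h 0 v - covDiff u h s v)‖ := by
  refine ((((rep_self v).covComm u h s).shiftOp u (-h) s).weightOpShift w h).norm_le
    ((rep_covDiff_sub u h s (rep_self v)).weightOp w) 0 fun y => ?_
  have h1 := hu.norm_cis_sub_le hc hC hh hs (y + -h)
  simp only [neg_add_cancel_right, add_zero] at h1 ⊢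
  simp only [norm_mul, norm_pow, Complex.norm_real, Real.norm_eq_abs, abs_inv, abs_of_pos hh,
    abs_of_pos (hw.pos _), norm_cis, one_mul]
  have p := hw.pos y
  have p1 := hw.pos (y + h)
  have p2 := hw.le_three_mul hh hVh y
  calc w (y + h) * (h⁻¹ ^ 2 * ‖cis (s * (u y - u (y + h))) - cis (s * (u (y + -h) - u y))‖
        * ‖v (y + h)‖)
      ≤ (3 * w y) * (h⁻¹ ^ 2 * (2 * C * h * ‖1 - cis (s * (u y - u (y + h)))‖)
        * ‖v (y + h)‖) := by gcongr
    _ = _ := by field_simp; ring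

/-- The multiplier of the double commutator. Its first order part is the third difference of u, of
size h². The quadratic remainder is a squared second difference, also of size h², and becomes linear
in |s|D because |s|D ≤ 1. -/
lemma IsDiffShear.norm_two_sub_le (hu : IsDiffShear C c₀ N h u) (hc : 0 ≤ c₀) (hC : 0 ≤ C)
    (hh : 0 < h) {s : ℝ} (hs : |s| * (N * h) ≤ 1) (hCh : C * h ≤ 1) (y : ℝ) :
    ‖2 - cis (s * (u (y + h + h + h) - 2 * u (y + h + h) + u (y + h)))
        - cis (s * -(u (y + h + h) - 2 * u (y + h) + u y))‖
      ≤ (2 * C + 4 * C ^ 2) * h ^ 2 * ‖1 - cis (s * (u (y + h) - u (y + h + h)))‖ := by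
  have h1 := half_le_norm_one_sub_cis (hu.nonneg hc hh (y + h)) (hu.mul_le_one hs (y + h))
  rw [neg_sub] at h1
  have h0 := hu.nonneg hc hh (y + h)
  have hm := hu.mul_le_one hs (y + h)
  set D := u (y + h + h) - u (y + h)
  have h2 : |s * (u (y + h + h + h) - 2 * u (y + h + h) + u (y + h))| ≤ C * h * (|s| * D) := by
    rw [abs_mul]
    have := mul_le_mul_of_nonneg_left (hu.second (y + h)) (abs_nonneg s)
    linarith
  have h3 : |s * -(u (y + h + h) - 2 * u (y + h) + u y)| ≤ C * h * (|s| * D) := by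
    rw [abs_mul, abs_neg]
    have := mul_le_mul_of_nonneg_left (hu.second' y) (abs_nonneg s)
    linarith
  have h4 : 0 ≤ |s| * D := by positivity
  have h5 : C * h * (|s| * D) ≤ 1 := by nlinarith
  refine (norm_two_sub_cis_le h2 h3 h5).trans ?_
  have h6 : |s * (u (y + h + h + h) - 2 * u (y + h + h) + u (y + h))
      + s * -(u (y + h + h) - 2 * u (y + h) + u y)| ≤ C * h ^ 2 * (|s| * D) := by
    have := mul_le_mul_of_nonneg_left (hu.third y) (abs_nonneg s)
    rw [← abs_mul] at this
    calc _ = |s * (u (y + h + h + h) - 3 * u (y + h + h) + 3 * u (y + h) - u y)| := by ring_nf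
      _ ≤ _ := by linarith
  have h7 : (|s| * D) ^ 2 ≤ |s| * D := by nlinarith
  have h8 : (C * h * (|s| * D)) ^ 2 ≤ C ^ 2 * h ^ 2 * (|s| * D) := by
    have := mul_le_mul_of_nonneg_left h7 (show 0 ≤ C ^ 2 * h ^ 2 by positivity)
    linarith
  have h9 := mul_le_mul_of_nonneg_left h1 (show 0 ≤ (2 * C + 4 * C ^ 2) * h ^ 2 by positivity)
  linarith

lemma IsDiffShear.norm_double_comm_le (hu : IsDiffShear C c₀ N h u) (hc : 0 ≤ c₀) (hC : 0 ≤ C)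
    (hh : 0 < h) (hVh : V * h ≤ 1) (hCh : C * h ≤ 1) (hw : IsWeight V w) {s : ℝ}
    (hs : |s| * (N * h) ≤ 1) (v : L2R) :
    ‖weightOp w (shiftOp u (-h) s (covComm u h s (covDiff' u h s v)
        - covDiff' u h s (covComm u h s v)))‖
      ≤ 3 * (2 * C + 4 * C ^ 2) * ‖weightOp w (covDiff u h 0 v - covDiff u h s v)‖ := by
  have hr : Rep (weightOp w (shiftOp u (-h) s (covComm u h s (covDiff' u h s v)
        - covDiff' u h s (covComm u h s v)))) (fun y => w y * ((h⁻¹ : ℝ) ^ 3 *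
        (cis (s * (u y - u (y + -h))) * (2 - cis (s * (u (y + -h + h + h) - 2 * u (y + -h + h) + u (y + -h)))
        - cis (s * -(u (y + -h + h) - 2 * u (y + -h) + u (y + -h + -h))))) * v y)) := by
    refine (((((rep_self v).covDiff u h (-h) s).covComm u h s).sub
      (((rep_self v).covComm u h s).covDiff u h (-h) s)).shiftOp u (-h) s |>.weightOp w).congr fun y => ?_
    simp only [neg_add_cancel_right, add_neg_cancel_right]
    -- All phases are written as monomials in e^{isu} at the points y, y ± h and y - 2h; the
    -- identity is then one between rational functions.
    have e : ∀ a b : ℝ, cis (s * (a - b)) = cis (s * a) * cis (-(s * b)) := fun a b => by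
      rw [← cis_add]; ring_nf
    have e1 : cis (s * (u (y + h) - 2 * u y + u (y + -h)))
        = cis (s * u (y + h)) * cis (-(s * u y)) ^ 2 * cis (s * u (y + -h)) := by
      rw [sq, ← cis_add, ← cis_add, ← cis_add]; ring_nf
    have e2 : cis (s * -(u y - 2 * u (y + -h) + u (y + -h + -h)))
        = cis (-(s * u y)) * cis (s * u (y + -h)) ^ 2 * cis (-(s * u (y + -h + -h))) := by
      rw [sq, ← cis_add, ← cis_add, ← cis_add]; ring_nf
    simp only [e1, e2, e]
    have i : ∀ a : ℝ, cis (-a) = (cis a)⁻¹ := fun a =>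
      eq_inv_of_mul_eq_one_right (cis_mul_neg a)
    have n : ∀ a : ℝ, cis a ≠ 0 := fun a => norm_ne_zero_iff.1 (by simp [norm_cis])
    simp only [i]
    have n0 := n (s * u y)
    have n1 := n (s * u (y + h))
    have n2 := n (s * u (y + -h))
    have n3 := n (s * u (y + -h + -h))
    have n4 : (h : ℂ) ≠ 0 := by exact_mod_cast hh.ne'
    push_cast
    field_simp
    ring
  refine hr.norm_le ((rep_covDiff_sub u h s (rep_self v)).weightOp w) (-h) fun y => ?_
  have h1 := hu.norm_two_sub_le hc hC hh hs hCh (y + -h + -h)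
  simp only [neg_add_cancel_right] at h1 ⊢
  simp only [norm_mul, norm_pow, Complex.norm_real, Real.norm_eq_abs, abs_inv, abs_of_pos hh,
    abs_of_pos (hw.pos _), norm_cis, one_mul]
  have p := hw.pos y
  have p1 := hw.pos (y + -h)
  have p2 := hw.le_three_mul hh hVh (y + -h)
  rw [neg_add_cancel_right] at p2
  calc _ ≤ (3 * w (y + -h)) * (h⁻¹ ^ 3 * ((2 * C + 4 * C ^ 2) * h ^ 2 *
        ‖1 - cis (s * (u (y + -h) - u y))‖) * ‖v y‖) := by gcongr
    _ = _ := by field_simp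

end Bounds

/-! ### Linear differential equations with bounded coefficients -/

section LinearODE

variable {E : Type*} [NormedAddCommGroup E] [NormedSpace ℝ E]

lemma glue_hasDerivWithinAt {α β : ℝ → E} {v : ℝ → E → E} {a b c : ℝ} (hab : a ≤ b) (hbc : b ≤ c)
    (hα : ∀ t ∈ Set.Icc a b, HasDerivWithinAt α (v t (α t)) (Set.Icc a b) t)
    (hβ : ∀ t ∈ Set.Icc b c, HasDerivWithinAt β (v t (β t)) (Set.Icc b c) t) (h : α b = β b) :
    ∃ γ : ℝ → E, γ a = α a ∧
      ∀ t ∈ Set.Icc a c, HasDerivWithinAt γ (v t (γ t)) (Set.Icc a c) t := by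
  classical
  set γ : ℝ → E := fun t => if t ≤ b then α t else β t with hγ
  have h1 : ∀ t ∈ Set.Icc a b, γ t = α t := fun t ht => if_pos ht.2
  have h2 : ∀ t ∈ Set.Icc b c, γ t = β t := fun t ht => by
    rcases ht.1.eq_or_lt with rfl | h3
    · rw [← h]; exact if_pos le_rfl
    · exact if_neg (not_le.2 h3)
  refine ⟨γ, h1 a ⟨le_rfl, hab⟩, fun t _ => ?_⟩
  rw [← Set.Icc_union_Icc_eq_Icc hab hbc]
  refine HasDerivWithinAt.union ?_ ?_
  · by_cases h4 : t ∈ Set.Icc a b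
    · rw [h1 t h4]
      exact (hα t h4).congr h1 (h1 t h4)
    · exact HasFDerivWithinAt.of_notMem_closure (by rwa [closure_Icc])
  · by_cases h4 : t ∈ Set.Icc b c
    · rw [h2 t h4]
      exact (hβ t h4).congr h2 (h2 t h4)
    · exact HasFDerivWithinAt.of_notMem_closure (by rwa [closure_Icc])

/-- Global existence for a linear ODE with bounded continuous coefficients. -/
lemma exists_linear_ode [CompleteSpace E] {A : ℝ → E →L[ℝ] E} (hA : Continuous A) {C : ℝ}
    (hC : ∀ t, ‖A t‖ ≤ C) (x₀ : E) {τ : ℝ} (hτ : 0 ≤ τ) :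
    ∃ α : ℝ → E, α 0 = x₀ ∧
      ∀ t ∈ Set.Icc 0 τ, HasDerivWithinAt α (A t (α t)) (Set.Icc 0 τ) t := by
  have hC0 : 0 ≤ C := (norm_nonneg _).trans (hC 0)
  lift C to NNReal using hC0
  -- On the ball of radius ‖x‖ around x the vector field is at most 2C‖x‖, so a step with 2Cd ≤ 1
  -- stays inside. By linearity the length of the step does not depend on x, and finitely many equal
  -- steps reach τ.
  have hloc : ∀ (a : ℝ) (d : ℝ), 0 ≤ d → 2 * C * d ≤ 1 → ∀ x : E, ∃ α : ℝ → E, α a = x ∧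
      ∀ t ∈ Set.Icc a (a + d), HasDerivWithinAt α (A t (α t)) (Set.Icc a (a + d)) t := by
    intro a d hd hCd x
    have hp : IsPicardLindelof (fun t => A t) (tmin := a) (tmax := a + d)
        ⟨a, le_rfl, by linarith⟩ x ‖x‖₊ 0 (C * (2 * ‖x‖₊)) C :=
      { lipschitzOnWith := fun t _ =>
          ((A t).lipschitz.weaken (by exact_mod_cast hC t)).lipschitzOnWith
        continuousOn := fun y _ => (hA.clm_apply continuous_const).continuousOn
        norm_le := fun t _ y hy => by
          refine ((A t).le_opNorm y).trans ?_
          have h1 : ‖y‖ ≤ 2 * ‖x‖ := by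
            have := norm_le_norm_add_norm_sub' y x
            rw [mem_closedBall_iff_norm] at hy
            simp only [coe_nnnorm] at hy
            linarith
          push_cast
          exact mul_le_mul (hC t) h1 (norm_nonneg _) C.2
        mul_max_le := by
          simp only [add_sub_cancel_left, sub_self, max_eq_left hd, NNReal.coe_zero, sub_zero]
          push_cast
          nlinarith [norm_nonneg x] }
    exact hp.exists_eq_forall_mem_Icc_hasDerivWithinAt₀
  obtain ⟨n, hn⟩ := exists_nat_ge (2 * C * τ)
  have key : ∀ k : ℕ, ∃ α : ℝ → E, α 0 = x₀ ∧ ∀ t ∈ Set.Icc 0 (k * (τ / (n + 1))),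
      HasDerivWithinAt α (A t (α t)) (Set.Icc 0 (k * (τ / (n + 1)))) t := by
    intro k
    induction k with
    | zero =>
      obtain ⟨α, h1, h2⟩ := hloc 0 0 le_rfl (by simp) x₀
      exact ⟨α, h1, by simpa using h2⟩
    | succ k ih =>
      obtain ⟨α, h1, h2⟩ := ih
      obtain ⟨β, h3, h4⟩ := hloc (k * (τ / (n + 1))) (τ / (n + 1)) (by positivity) (by
        rw [← mul_div_assoc, div_le_one (by positivity)]; linarith) (α (k * (τ / (n + 1))))
      obtain ⟨γ, h5, h6⟩ := glue_hasDerivWithinAt (v := fun t x => A t x) (by positivity)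
        (le_add_of_nonneg_right (by positivity)) h2 h4 h3.symm
      refine ⟨γ, h5.trans h1, ?_⟩
      have e : ((k + 1 : ℕ) : ℝ) * (τ / (n + 1)) = k * (τ / (n + 1)) + τ / (n + 1) := by
        push_cast; ring
      rw [e]
      exact h6
  have e : ((n + 1 : ℕ) : ℝ) * (τ / (n + 1)) = τ := by push_cast; field_simp
  have := key (n + 1)
  rwa [e] at this

end LinearODE

/-! ### The discretized flow of profiles -/

section Flow

variable {C c₀ N h V : ℝ} {u : C(ℝ, ℝ)} {w : ℝ →ᵇ ℝ}

/-- `G` is the profile `e^{iκtu} g` of a solution `g` on `[0, τ]` of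
`∂_t g + iκu g = ν ∂_yy g`, with `∂_yy` replaced by the second difference quotient of step `h`. -/
def IsFlow (u : C(ℝ, ℝ)) (κ ν h τ : ℝ) (G : ℝ → L2R) : Prop :=
  ∀ t ∈ Set.Icc 0 τ, HasDerivWithinAt G
    (-((ν : ℂ) • covDiff' u h (κ * t) (covDiff u h (κ * t) (G t)))) (Set.Icc 0 τ) t

/-- Only increments of u over one step enter the conjugated shift, and they are at most Nh. The
dependence on s is therefore Lipschitz in operator norm even for unbounded u. -/
lemma norm_shiftOp_sub_le (hu : IsDiffShear C c₀ N h u) (hc : 0 ≤ c₀) (hh : 0 < h) {h' : ℝ}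
    (hh' : h' = h ∨ h' = -h) (s s' : ℝ) :
    ‖shiftOp u h' s - shiftOp u h' s'‖ ≤ N * h * |s - s'| := by
  have hN : 0 ≤ N * h := (hu.nonneg hc hh 0).trans (hu.upper 0)
  refine ContinuousLinearMap.opNorm_le_bound _ (by positivity) fun v => ?_
  refine (((rep_self v).shiftOp u h' s).sub ((rep_self v).shiftOp u h' s')).norm_le (rep_self v) h'
    fun y => ?_
  rw [← sub_mul, norm_mul]
  refine mul_le_mul_of_nonneg_right ((norm_cis_sub_cis_le _ _).trans ?_) (norm_nonneg _)
  rw [← sub_mul, abs_mul, mul_comm]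
  refine mul_le_mul_of_nonneg_right ?_ (abs_nonneg _)
  rcases hh' with rfl | rfl
  · rw [abs_sub_comm, abs_of_nonneg (hu.nonneg hc hh y)]
    exact hu.upper y
  · have h1 := hu.nonneg hc hh (y + -h)
    have h2 := hu.upper (y + -h)
    rw [neg_add_cancel_right] at h1 h2
    rwa [abs_of_nonneg h1]

lemma continuous_shiftOp (hu : IsDiffShear C c₀ N h u) (hc : 0 ≤ c₀) (hh : 0 < h) {h' : ℝ}
    (hh' : h' = h ∨ h' = -h) : Continuous (shiftOp u h') := by
  refine (LipschitzWith.of_dist_le_mul (K := (N * h).toNNReal) fun s s' => ?_).continuous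
  rw [dist_eq_norm, Real.dist_eq]
  refine (norm_shiftOp_sub_le hu hc hh hh' s s').trans ?_
  gcongr
  exact Real.le_coe_toNNReal _

lemma exists_isFlow (hu : IsDiffShear C c₀ N h u) (hc : 0 ≤ c₀) (hh : 0 < h) (κ ν : ℝ) {τ : ℝ}
    (hτ : 0 ≤ τ) (v : L2R) : ∃ G, IsFlow u κ ν h τ G ∧ G 0 = v := by
  have h1 : ∀ h' s (x : L2R), ‖diffQuot h (shiftOp u h' s) x‖ ≤ |h⁻¹| * 2 * ‖x‖ := by
    intro h' s x
    rw [diffQuot_apply, norm_smul, Complex.norm_real, Real.norm_eq_abs, mul_assoc]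
    refine mul_le_mul_of_nonneg_left ((norm_sub_le _ _).trans ?_) (abs_nonneg _)
    rw [norm_shiftOp, two_mul]
  obtain ⟨G, h2, h3⟩ := exists_linear_ode (E := L2R)
    (A := fun t => (-((ν : ℂ) • (covDiff' u h (κ * t) * covDiff u h (κ * t)))).restrictScalars ℝ)
    (by
      have hc1 := continuous_shiftOp hu hc hh (Or.inl rfl)
      have hc2 := continuous_shiftOp hu hc hh (Or.inr rfl)
      refine (ContinuousLinearMap.restrictScalarsL ℂ L2R L2R ℝ ℝ).continuous.comp ?_
      unfold covDiff covDiff' diffQuot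
      fun_prop)
    (C := |ν| * (|h⁻¹| * 2 * (|h⁻¹| * 2))) (fun t => by
      refine ContinuousLinearMap.opNorm_le_bound _ (by positivity) fun x => ?_
      simp only [ContinuousLinearMap.coe_restrictScalars', neg_apply, norm_neg, smul_apply,
        norm_smul, Complex.norm_real, Real.norm_eq_abs, mul_apply_eq_comp]
      rw [mul_assoc |ν|, mul_assoc (|h⁻¹| * 2)]
      refine mul_le_mul_of_nonneg_left ((h1 _ _ _).trans ?_) (abs_nonneg _)
      exact mul_le_mul_of_nonneg_left (h1 _ _ _) (by positivity)) v hτ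
  exact ⟨G, h3, h2⟩

lemma IsFlow.mono {κ ν h τ τ' : ℝ} {G : ℝ → L2R} (hG : IsFlow u κ ν h τ G) (hτ : τ' ≤ τ) :
    IsFlow u κ ν h τ' G := fun t ht =>
  (hG t ⟨ht.1, ht.2.trans hτ⟩).mono (Set.Icc_subset_Icc_right hτ)

/-- Multiplication by a phase translates the parameter s. This allows the time origin of a profile
to be moved. -/
lemma shiftOp_phaseOp (u : C(ℝ, ℝ)) (h a s : ℝ) (v : L2R) :
    shiftOp u h s (phaseOp u a v) = phaseOp u a (shiftOp u h (s - a) v) := by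
  simp only [shiftOp, mul_apply_eq_comp, phaseOp_add]
  congr 1
  · congr 1; ring
  · congr 3; ring

lemma diffQuot_phaseOp (u : C(ℝ, ℝ)) (h h' a s : ℝ) (v : L2R) :
    diffQuot h (shiftOp u h' s) (phaseOp u a v)
      = phaseOp u a (diffQuot h (shiftOp u h' (s - a)) v) := by
  simp only [diffQuot_apply, shiftOp_phaseOp, map_smul, map_sub]

/-- Flows can be restarted at any time. -/
lemma IsFlow.restart {κ ν h τ a : ℝ} {G : ℝ → L2R} (hG : IsFlow u κ ν h τ G) (ha : 0 ≤ a) :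
    IsFlow u κ ν h (τ - a) (fun t => phaseOp u (-(κ * a)) (G (t + a))) := by
  intro t ht
  have h1 : HasDerivWithinAt (fun t => G (t + a)) _ (Set.Icc 0 (τ - a)) t :=
    HasDerivWithinAt.scomp_of_eq (h := fun t => t + a) (t' := Set.Icc 0 τ) t
      (hG (t + a) ⟨by linarith [ht.1], by linarith [ht.2]⟩)
      ((hasDerivWithinAt_id t _).add_const a)
      (fun x hx => ⟨by linarith [hx.1], by linarith [hx.2]⟩) rfl
  have h2 := ((phaseOp u (-(κ * a))).restrictScalars ℝ).hasFDerivAt.comp_hasDerivWithinAt t h1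
  refine h2.congr_deriv ?_
  simp only [ContinuousLinearMap.coe_restrictScalars', one_smul, map_neg, map_smul,
    covDiff, covDiff', diffQuot_phaseOp]
  ring_nf

end Flow

/-! ### Energy estimates and one window of enhanced dissipation -/

lemma le_exp_mul_of_deriv_le {e e' : ℝ → ℝ} {K τ : ℝ}
    (he : ∀ t ∈ Set.Icc 0 τ, HasDerivWithinAt e (e' t) (Set.Icc 0 τ) t)
    (hK : ∀ t ∈ Set.Icc 0 τ, e' t ≤ K * e t) {t : ℝ} (ht : t ∈ Set.Icc 0 τ) :
    e t ≤ Real.exp (K * t) * e 0 := by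
  have hd : ∀ x, HasDerivAt (fun x => Real.exp (-(K * x))) (Real.exp (-(K * x)) * -K) x := fun x => by
    simpa using (((hasDerivAt_id x).const_mul K).neg).exp
  have h1 : AntitoneOn (fun x => Real.exp (-(K * x)) * e x) (Set.Icc 0 τ) := by
    refine antitoneOn_of_hasDerivWithinAt_nonpos (convex_Icc _ _)
      (f' := fun x => Real.exp (-(K * x)) * -K * e x + Real.exp (-(K * x)) * e' x) ?_ ?_ ?_
    · exact fun x hx => ((hd x).continuousAt.continuousWithinAt).mul (he x hx).continuousWithinAt
    · intro x hx
      exact (hd x).hasDerivWithinAt.mul ((he x (interior_subset hx)).mono interior_subset)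
    · intro x hx
      have := mul_le_mul_of_nonneg_left (hK x (interior_subset hx)) (Real.exp_pos (-(K * x))).le
      linarith
  have h2 := h1 ⟨le_rfl, ht.1.trans ht.2⟩ ht ht.1
  simp only [mul_zero, neg_zero, Real.exp_zero, one_mul] at h2
  have h3 := mul_le_mul_of_nonneg_left h2 (Real.exp_pos (K * t)).le
  rwa [← mul_assoc, ← Real.exp_add, add_neg_cancel, Real.exp_zero, one_mul] at h3

/-- In a time interval where the energy is dissipated, the dissipation is small at some time. -/
lemma exists_dissipation_le {e e' D : ℝ → ℝ} {K τ a b : ℝ} (hK0 : 0 ≤ K)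
    (he : ∀ t ∈ Set.Icc 0 τ, HasDerivWithinAt e (e' t) (Set.Icc 0 τ) t)
    (hD : ∀ t ∈ Set.Icc 0 τ, e' t ≤ -D t + K * e t) (hD0 : ∀ t, 0 ≤ D t) (he0 : ∀ t, 0 ≤ e t)
    (ha : 0 ≤ a) (hab : a < b) (hb : b ≤ τ) (hKτ : 2 * (K * τ) ≤ 1) :
    ∃ t ∈ Set.Ioo a b, D t * (b - a) ≤ 2 * e 0 := by
  have hd : ∀ x, HasDerivAt (fun x => Real.exp (-(K * x))) (Real.exp (-(K * x)) * -K) x := fun x => by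
    simpa using (((hasDerivAt_id x).const_mul K).neg).exp
  -- The mean value theorem for e^{-Kx}e(x), whose derivative is at most -e^{-Kx}D(x). The factor
  -- e^{-Kx} stays above 1/2 because 2Kτ ≤ 1.
  obtain ⟨t, ht, h1⟩ := exists_hasDerivAt_eq_slope (fun x => Real.exp (-(K * x)) * e x)
    (fun x => Real.exp (-(K * x)) * -K * e x + Real.exp (-(K * x)) * e' x) hab
    (fun x hx => ((hd x).continuousAt.continuousWithinAt).mul
      ((he x ⟨ha.trans hx.1, hx.2.trans hb⟩).continuousWithinAt.mono
        (Set.Icc_subset_Icc ha hb)))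
    (fun x hx => (hd x).mul ((he x ⟨ha.trans hx.1.le, hx.2.le.trans hb⟩).hasDerivAt
      (Icc_mem_nhds (ha.trans_lt hx.1) (hx.2.trans_le hb))))
  have htτ : t ∈ Set.Icc 0 τ := ⟨ha.trans ht.1.le, ht.2.le.trans hb⟩
  have ha' : a ∈ Set.Icc 0 τ := ⟨ha, hab.le.trans hb⟩
  refine ⟨t, ht, ?_⟩
  have h2 := le_exp_mul_of_deriv_le (K := K) he (fun t ht => (hD t ht).trans (by linarith [hD0 t])) ha'
  have h3 : Real.exp (-(K * a)) * e a ≤ e 0 := by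
    have h3 := mul_le_mul_of_nonneg_left h2 (Real.exp_pos (-(K * a))).le
    rwa [← mul_assoc, ← Real.exp_add, neg_add_cancel, Real.exp_zero, one_mul] at h3
  rw [eq_div_iff (sub_pos.2 hab).ne'] at h1
  have h4 : 0 ≤ Real.exp (-(K * b)) * e b := mul_nonneg (Real.exp_pos _).le (he0 b)
  have h5 := hD t htτ
  have h6 : 1 / 2 ≤ Real.exp (-(K * t)) := by
    have := Real.add_one_le_exp (-(K * t))
    have := mul_le_mul_of_nonneg_left htτ.2 hK0
    linarith
  have h7 : Real.exp (-(K * t)) * D t * (b - a) ≤ e 0 := by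
    have h8 : Real.exp (-(K * t)) * D t
        ≤ -(Real.exp (-(K * t)) * -K * e t + Real.exp (-(K * t)) * e' t) := by
      have := mul_le_mul_of_nonneg_left h5 (Real.exp_pos (-(K * t))).le
      linarith
    have := mul_le_mul_of_nonneg_right h8 (sub_pos.2 hab).le
    linarith
  have h9 : 0 ≤ D t * (b - a) := mul_nonneg (hD0 t) (sub_pos.2 hab).le
  nlinarith

/-- The standing assumptions on the discretized problem. -/
structure IsScheme (V N h : ℝ) (u : C(ℝ, ℝ)) (w : ℝ →ᵇ ℝ) : Prop where
  one_le : 1 ≤ V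
  pos : 0 < h
  mul_le : V * h ≤ 1
  shear : IsDiffShear V V⁻¹ N h u
  weight : IsWeight V w

/-- The constant of the energy estimates. -/
noncomputable def energyConst (V : ℝ) : ℝ := 80000 * V ^ 4

section Scheme

variable {V N h : ℝ} {u : C(ℝ, ℝ)} {w : ℝ →ᵇ ℝ}

lemma IsScheme.nonneg (S : IsScheme V N h u w) : 0 ≤ V := zero_le_one.trans S.one_le

lemma IsScheme.one_le_energyConst (S : IsScheme V N h u w) : 1 ≤ energyConst V := by
  have := one_le_pow₀ S.one_le (n := 4)
  unfold energyConst
  linarith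

lemma IsScheme.norm_weight_le (S : IsScheme V N h u w) (v : L2R) :
    ‖weightOp w v‖ ≤ 3 * ‖weightOpShift w h v‖ := by
  refine ((rep_self v).weightOp w).norm_le ((rep_self v).weightOpShift w h) 0 fun y => ?_
  rw [add_zero, norm_mul, norm_mul, ← mul_assoc, Complex.norm_real, Complex.norm_real,
    Real.norm_eq_abs, Real.norm_eq_abs, abs_of_pos (S.weight.pos _), abs_of_pos (S.weight.pos _)]
  refine mul_le_mul_of_nonneg_right ?_ (norm_nonneg _)
  have h1 := S.weight.growth (y + h) (-h)
  rw [add_neg_cancel_right, abs_neg, abs_of_pos S.pos] at h1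
  refine h1.trans ?_
  have h2 : Real.exp (V * h) ≤ Real.exp 1 := Real.exp_le_exp.2 S.mul_le
  have h3 := Real.exp_one_lt_d9
  have := S.weight.pos (y + h)
  gcongr
  linarith

lemma IsScheme.energy_le (S : IsScheme V N h u w) (s : ℝ) {ν : ℝ} (hν : 0 ≤ ν) (v : L2R) :
    2 * (inner ℂ (weightOp w v)
        (weightOp w (-((ν : ℂ) • covDiff' u h s (covDiff u h s v))))).re
      ≤ -(ν * ‖weightOpShift w h (covDiff u h s v)‖ ^ 2)
        + energyConst V * ν * ‖weightOp w v‖ ^ 2 := by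
  have h1 := (S.weight.isWeightedShift S.nonneg S.pos S.mul_le u s).energy v
  have h2 : (4 * V) ^ 2 ≤ energyConst V := by
    have : V ^ 2 ≤ V ^ 4 := pow_le_pow_right₀ S.one_le (by norm_num)
    unfold energyConst
    nlinarith [sq_nonneg V]
  have h3 := mul_le_mul_of_nonneg_right h2 (mul_nonneg hν (sq_nonneg ‖weightOp w v‖))
  have h4 := mul_le_mul_of_nonneg_left h1 hν
  simp only [map_neg, map_smul, inner_neg_right, inner_smul_right, Complex.neg_re,
    Complex.re_ofReal_mul]
  linarith

/-- Applies `IsWeightedShift.energy_commutator` to X = `covDiff u h 0`. The commutator bounds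
involve X - D, which is estimated by X and D separately; the D part is left for the dissipation of
‖G‖² to absorb. -/
lemma IsScheme.energy_grad_le (S : IsScheme V N h u w) {s : ℝ} (hs : |s| * (N * h) ≤ 1) {ν : ℝ}
    (hν : 0 ≤ ν) (v : L2R) :
    2 * (inner ℂ (weightOp w (covDiff u h 0 v)) (weightOp w (covDiff u h 0
        (-((ν : ℂ) • covDiff' u h s (covDiff u h s v)))))).re
      ≤ energyConst V * ν * (‖weightOp w (covDiff u h 0 v)‖ ^ 2
        + ‖weightOpShift w h (covDiff u h s v)‖ ^ 2) := by
  have hV := S.nonneg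
  have hV2 : V ≤ V ^ 2 := by nlinarith [S.one_le]
  have hc0 : 0 ≤ V⁻¹ := inv_nonneg.2 hV
  set z := ‖weightOp w (covDiff u h 0 v - covDiff u h s v)‖ with hz
  have hz0 : 0 ≤ z := norm_nonneg _
  have b1 := (S.shear.norm_covComm_le hc0 hV S.pos S.weight hs v).trans
    (mul_le_mul_of_nonneg_right (show 2 * V ≤ 18 * V ^ 2 by linarith) hz0)
  have b2 := (S.shear.norm_shift_covComm_le hc0 hV S.pos S.mul_le S.weight hs v).trans
    (mul_le_mul_of_nonneg_right (show 6 * V ≤ 18 * V ^ 2 by linarith) hz0)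
  have b3 := (S.shear.norm_double_comm_le hc0 hV S.pos S.mul_le S.mul_le S.weight hs v).trans
    (mul_le_mul_of_nonneg_right
      (show 3 * (2 * V + 4 * V ^ 2) ≤ 18 * V ^ 2 by linarith) hz0)
  have h1 := (S.weight.isWeightedShift hV S.pos S.mul_le u s).energy_commutator
    (covDiff u h 0) (covComm u h s) rfl (by positivity) v b1 b2 b3
  have h2 : z ≤ ‖weightOp w (covDiff u h 0 v)‖ + 3 * ‖weightOpShift w h (covDiff u h s v)‖ := by
    rw [hz, map_sub]
    exact (norm_sub_le _ _).trans (add_le_add_right (S.norm_weight_le _) _)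
  set x := ‖weightOp w (covDiff u h 0 v)‖
  set y := ‖weightOpShift w h (covDiff u h s v)‖
  have h3 : x ^ 2 + z ^ 2 ≤ 18 * (x ^ 2 + y ^ 2) := by
    have hx : 0 ≤ x := norm_nonneg _
    have : z ^ 2 ≤ (x + 3 * y) ^ 2 := by gcongr
    nlinarith [sq_nonneg (x - 3 * y)]
  -- Source of the constant in `energyConst`: 23² · 8 · 18 = 76176 ≤ 80000.
  have h4 : (4 * V + 18 * V ^ 2 + 1) ^ 2 * 8 * 18 ≤ energyConst V := by
    have h5 : 4 * V + 18 * V ^ 2 + 1 ≤ 23 * V ^ 2 := by nlinarith [S.one_le]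
    have h6 : (4 * V + 18 * V ^ 2 + 1) ^ 2 ≤ (23 * V ^ 2) ^ 2 := by gcongr
    unfold energyConst
    nlinarith [sq_nonneg (V ^ 2)]
  have h5 : (4 * V + 18 * V ^ 2 + 1) ^ 2 * 8 * (x ^ 2 + z ^ 2)
      ≤ energyConst V * (x ^ 2 + y ^ 2) := by
    have h6 := mul_le_mul_of_nonneg_left h3 (show 0 ≤ (4 * V + 18 * V ^ 2 + 1) ^ 2 * 8 by positivity)
    have h7 := mul_le_mul_of_nonneg_right h4 (add_nonneg (sq_nonneg x) (sq_nonneg y))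
    linarith
  have h6 := mul_le_mul_of_nonneg_left (h1.trans h5) hν
  simp only [map_neg, map_smul, inner_neg_right, inner_smul_right, Complex.neg_re,
    Complex.re_ofReal_mul]
  linarith

variable {κ ν τ : ℝ} {G : ℝ → L2R}

lemma IsScheme.hasDeriv_energy (hG : IsFlow u κ ν h τ G) (A : L2R →L[ℂ] L2R) {t : ℝ}
    (ht : t ∈ Set.Icc 0 τ) : HasDerivWithinAt (fun r => ‖A (G r)‖ ^ 2)
      (2 * (inner ℂ (A (G t))
        (A (-((ν : ℂ) • covDiff' u h (κ * t) (covDiff u h (κ * t) (G t)))))).re)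
      (Set.Icc 0 τ) t :=
  hasDerivWithinAt_norm_sq A (hG t ht)

/-- The weighted energy grows at most at rate `ν`. -/
lemma IsScheme.norm_sq_le (S : IsScheme V N h u w) (hν : 0 ≤ ν) (hG : IsFlow u κ ν h τ G) {t : ℝ}
    (ht : t ∈ Set.Icc 0 τ) :
    ‖weightOp w (G t)‖ ^ 2 ≤ Real.exp (energyConst V * ν * t) * ‖weightOp w (G 0)‖ ^ 2 := by
  refine le_exp_mul_of_deriv_le (fun t ht => IsScheme.hasDeriv_energy hG (weightOp w) ht)
    (fun t _ => (S.energy_le (κ * t) hν (G t)).trans ?_) ht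
  have : 0 ≤ ν * ‖weightOpShift w h (covDiff u h (κ * t) (G t))‖ ^ 2 := by positivity
  linarith

/-- Growth of the weighted gradient of the profile. -/
lemma IsScheme.grad_sq_le (S : IsScheme V N h u w) (hν : 0 ≤ ν) (hG : IsFlow u κ ν h τ G)
    (hh : |κ| * τ * (N * h) ≤ 1) {t : ℝ} (ht : t ∈ Set.Icc 0 τ) :
    ‖weightOp w (covDiff u h 0 (G t))‖ ^ 2 ≤ Real.exp (energyConst V * ν * t)
      * (‖weightOp w (covDiff u h 0 (G 0))‖ ^ 2 + energyConst V * ‖weightOp w (G 0)‖ ^ 2) := by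
  have hK := S.one_le_energyConst
  have hNh : 0 ≤ N * h :=
    (S.shear.nonneg (inv_nonneg.2 S.nonneg) S.pos 0).trans (S.shear.upper 0)
  -- In the combination ‖XG‖² + K‖G‖² the dissipation of the second term cancels the ‖DG‖² produced
  -- by the first.
  have h1 := le_exp_mul_of_deriv_le (K := energyConst V * ν)
    (e := fun r => ‖weightOp w (covDiff u h 0 (G r))‖ ^ 2 + energyConst V * ‖weightOp w (G r)‖ ^ 2)
    (fun t ht => (IsScheme.hasDeriv_energy hG (weightOp w * covDiff u h 0) ht).add
      ((IsScheme.hasDeriv_energy hG (weightOp w) ht).const_mul (energyConst V)))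
    (fun t ht => by
      have h2 := S.energy_le (κ * t) hν (G t)
      have h3 := S.energy_grad_le (s := κ * t) (by
        refine le_trans ?_ hh
        rw [abs_mul, abs_of_nonneg ht.1]
        gcongr
        exact ht.2) hν (G t)
      have h4 := mul_le_mul_of_nonneg_left h2 (zero_le_one.trans hK)
      simp only [mul_apply_eq_comp]
      linarith) ht
  have : 0 ≤ energyConst V * ‖weightOp w (G t)‖ ^ 2 := by positivity
  linarith

/-- X - D is multiplication by about isu' and u' ≥ 1/V, so it controls |s|G. The 6 is 2, from
comparing phase and angle, times 3, from shifting the weight by one step. -/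
lemma IsScheme.norm_le_diff (S : IsScheme V N h u w) {s : ℝ} (hs : |s| * (N * h) ≤ 1)
    (v : L2R) :
    |s| * ‖weightOp w v‖ ≤ 6 * V * ‖weightOp w (covDiff u h 0 v - covDiff u h s v)‖ := by
  rw [← abs_abs s, ← Real.norm_eq_abs |s|, ← Complex.norm_real, ← norm_smul]
  refine (((rep_self v).weightOp w).smul _).norm_le
    ((rep_covDiff_sub u h s (rep_self v)).weightOp w) (-h) fun y => ?_
  simp only [neg_add_cancel_right, norm_mul, Complex.norm_real, Real.norm_eq_abs, abs_abs, abs_inv,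
    abs_of_pos S.pos, abs_of_pos (S.weight.pos _)]
  have h1 := half_le_norm_one_sub_cis
    (S.shear.nonneg (inv_nonneg.2 S.nonneg) S.pos (y + -h)) (S.shear.mul_le_one hs (y + -h))
  have h2 := S.shear.lower (y + -h)
  rw [neg_sub, neg_add_cancel_right] at h1
  rw [neg_add_cancel_right] at h2
  have h3 := S.weight.le_three_mul S.pos S.mul_le (y + -h)
  rw [neg_add_cancel_right] at h3
  have hV : 0 < V := zero_lt_one.trans_le S.one_le
  have hp := S.pos
  have h4 : |s| * (V⁻¹ * h) / 2 ≤ ‖1 - cis (s * (u (y + -h) - u y))‖ :=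
    le_trans (by gcongr) h1
  have hw := S.weight.pos (y + -h)
  calc |s| * (w y * ‖v y‖) ≤ |s| * (3 * w (y + -h) * ‖v y‖) := by gcongr
    _ = 6 * V * (w (y + -h) * (h⁻¹ * (|s| * (V⁻¹ * h) / 2) * ‖v y‖)) := by field_simp; ring
    _ ≤ _ := by gcongr

/-- E, E₀, E₁, Eτ are the energies at times 0, t₀, t₁, τ; y and Y are the norms of DG with the
shifted and the unshifted weight, X₁ that of XG at t₁, and k = |κ|(t₁-t₀). The chain is ντX₁² ≤
2(9·6+1)E², ντ(X₁+3y₁)² ≤ (2·110+18·6)E², ντ³E₁² ≤ 9·36·328 V²E². Since 9·36·328 = 106272 is below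
10⁶/8, it follows that E₁² ≤ E²/8 and Eτ² ≤ E²/4. -/
lemma half_arith {V K ν τ E E₀ E₁ Eτ y₀ y₁ Y₀ Y₁ X₁ k : ℝ} (hV : 0 ≤ V) (hν : 0 < ν) (hτ : 0 < τ)
    (hE : 0 ≤ E) (hE1 : 0 ≤ E₁) (hY0 : 0 ≤ Y₀)
    (h1 : 2 * (K * ν * τ) ≤ 1) (h2 : 10 ^ 6 * V ^ 2 ≤ ν * τ ^ 3)
    (hd0 : ν * y₀ ^ 2 * (τ / 3 - 0) ≤ 2 * E ^ 2) (hd1 : ν * y₁ ^ 2 * (τ - 2 * τ / 3) ≤ 2 * E ^ 2)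
    (hY0' : Y₀ ≤ 3 * y₀) (hY1' : Y₁ ≤ 3 * y₁) (hx : X₁ ^ 2 ≤ 2 * (Y₀ ^ 2 + K * E₀ ^ 2))
    (hm : E₀ ^ 2 ≤ 2 * E ^ 2) (hl : Eτ ^ 2 ≤ 2 * E₁ ^ 2) (hz : k * E₁ ≤ 6 * V * (X₁ + Y₁))
    (hk : τ / 3 ≤ k) : Eτ ≤ 1 / 2 * E := by
  have hP : 0 < ν * τ := mul_pos hν hτ
  have a0 : (ν * τ) * y₀ ^ 2 ≤ 6 * E ^ 2 := by linarith
  have a1 : (ν * τ) * y₁ ^ 2 ≤ 6 * E ^ 2 := by linarith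
  have b0 : Y₀ ^ 2 ≤ 9 * y₀ ^ 2 := by
    have : Y₀ ^ 2 ≤ (3 * y₀) ^ 2 := by gcongr
    linarith
  have b1 : K * (ν * τ) * E₀ ^ 2 ≤ E ^ 2 := by
    have := mul_le_mul (show K * (ν * τ) ≤ 1 / 2 by linarith) hm (sq_nonneg _) (by norm_num)
    linarith
  have b2 : (ν * τ) * X₁ ^ 2 ≤ 110 * E ^ 2 := by
    have := mul_le_mul_of_nonneg_left (hx.trans (show 2 * (Y₀ ^ 2 + K * E₀ ^ 2)
      ≤ 2 * (9 * y₀ ^ 2 + K * E₀ ^ 2) by linarith)) hP.le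
    linarith
  have c0 : τ / 3 * E₁ ≤ 6 * V * (X₁ + 3 * y₁) := by
    have i1 := mul_le_mul_of_nonneg_right hk hE1
    have i2 := mul_le_mul_of_nonneg_left hY1' hV
    linarith
  have c1 : (τ / 3 * E₁) ^ 2 ≤ (6 * V * (X₁ + 3 * y₁)) ^ 2 := by gcongr
  have c2 : (X₁ + 3 * y₁) ^ 2 ≤ 2 * X₁ ^ 2 + 18 * y₁ ^ 2 := by linarith [sq_nonneg (X₁ - 3 * y₁)]
  have c3 : (ν * τ) * (X₁ + 3 * y₁) ^ 2 ≤ 328 * E ^ 2 := by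
    have := mul_le_mul_of_nonneg_left c2 hP.le
    linarith
  have c4 : (ν * τ ^ 3) * E₁ ^ 2 ≤ V ^ 2 * (106272 * E ^ 2) := by
    have i1 := mul_le_mul_of_nonneg_left c1 hP.le
    have i2 := mul_le_mul_of_nonneg_left c3 (sq_nonneg V)
    linarith
  have hV2 : 0 < ν * τ ^ 3 := by positivity
  have c5 : V ^ 2 * (106272 * E ^ 2) ≤ (ν * τ ^ 3) * (E ^ 2 / 8) := by
    have := mul_le_mul_of_nonneg_right h2 (sq_nonneg E)
    have : 0 ≤ V ^ 2 * E ^ 2 := by positivity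
    linarith
  have c6 : E₁ ^ 2 ≤ E ^ 2 / 8 := le_of_mul_le_mul_left (c4.trans c5) hV2
  refine (abs_le_of_sq_le_sq' ?_ (by positivity)).2
  linarith

/-- Enhanced dissipation over one time window. -/
lemma IsScheme.half (S : IsScheme V N h u w) (hν : 0 < ν) (hG : IsFlow u κ ν h τ G)
    (hκ : 1 ≤ |κ|) (hτ : 0 < τ) (hh : |κ| * τ * (N * h) ≤ 1)
    (h1 : 2 * (energyConst V * ν * τ) ≤ 1) (h2 : 10 ^ 6 * V ^ 2 ≤ ν * τ ^ 3) :
    ‖weightOp w (G τ)‖ ≤ 1 / 2 * ‖weightOp w (G 0)‖ := by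
  have hK := S.one_le_energyConst
  have hNh : 0 ≤ N * h :=
    (S.shear.nonneg (inv_nonneg.2 S.nonneg) S.pos 0).trans (S.shear.upper 0)
  have hτ' : 2 * (energyConst V * ν * τ) ≤ 1 := h1
  have hexp : ∀ r, r ≤ τ → Real.exp (energyConst V * ν * r) ≤ 2 := fun r hr => by
    have h3 : energyConst V * ν * r ≤ energyConst V * ν * τ := by gcongr
    have h4 : Real.exp (energyConst V * ν * r) ^ 2 ≤ 2 ^ 2 := by
      rw [← Real.exp_nat_mul]
      have h5 : ((2 : ℕ) : ℝ) * (energyConst V * ν * r) ≤ 1 := by push_cast; linarith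
      have := Real.exp_le_exp.2 h5
      have := Real.exp_one_lt_d9
      linarith
    exact abs_le_of_sq_le_sq' h4 two_pos.le |>.2
  have hdis : ∀ a b, 0 ≤ a → a < b → b ≤ τ → ∃ t ∈ Set.Ioo a b,
      ν * ‖weightOpShift w h (covDiff u h (κ * t) (G t))‖ ^ 2 * (b - a)
        ≤ 2 * ‖weightOp w (G 0)‖ ^ 2 := fun a b ha hab hb =>
    exists_dissipation_le (e := fun t => ‖weightOp w (G t)‖ ^ 2) (K := energyConst V * ν)
      (D := fun t => ν * ‖weightOpShift w h (covDiff u h (κ * t) (G t))‖ ^ 2) (by positivity)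
      (fun t ht => IsScheme.hasDeriv_energy hG (weightOp w) ht)
      (fun t _ => S.energy_le (κ * t) hν.le (G t)) (fun t => by positivity)
      (fun t => by positivity) ha hab hb hτ'
  -- The two times with small dissipation lie in the first and the last third, so they are at least
  -- τ/3 apart.
  obtain ⟨t₀, ⟨ha0, hb0⟩, hd0⟩ := hdis 0 (τ / 3) le_rfl (by linarith) (by linarith)
  obtain ⟨t₁, ⟨ha1, hb1⟩, hd1⟩ := hdis (2 * τ / 3) τ (by linarith) (by linarith) le_rfl
  -- With the time origin at t₀ the fields X and D agree initially, so the small dissipation at t₀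
  -- becomes a small initial value of the gradient X.
  have hG0 := hG.restart ha0.le
  have hr : t₁ - t₀ ∈ Set.Icc 0 (τ - t₀) := ⟨by linarith, by linarith⟩
  have hh0 : |κ| * (τ - t₀) * (N * h) ≤ 1 := le_trans (by gcongr; linarith) hh
  have hx := S.grad_sq_le hν.le hG0 hh0 hr
  have hs : |κ * (t₁ - t₀)| * (N * h) ≤ 1 := by
    refine le_trans ?_ hh0
    rw [abs_mul, abs_of_nonneg hr.1]
    gcongr
  have hz := S.norm_le_diff hs (phaseOp u (-(κ * t₀)) (G t₁))
  have e1 : κ * (t₁ - t₀) - -(κ * t₀) = κ * t₁ := by ring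
  simp only [sub_add_cancel, zero_add, diffQuot_phaseOp, weightOp_phaseOp, norm_phaseOp,
    sub_neg_eq_add, ← map_sub] at hx hz
  rw [map_sub] at hz
  have e2 : κ * (t₁ - t₀) + κ * t₀ = κ * t₁ := by ring
  rw [e2] at hz
  have hm := S.norm_sq_le hν.le hG (t := t₀) ⟨ha0.le, by linarith⟩
  have hG1 := hG.restart (a := t₁) (by linarith)
  have hl := S.norm_sq_le hν.le hG1 (t := τ - t₁) ⟨by linarith, le_rfl⟩
  simp only [sub_add_cancel, zero_add, weightOp_phaseOp, norm_phaseOp] at hl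
  have hy0 := S.norm_weight_le (covDiff u h (κ * t₀) (G t₀))
  have hy1 := S.norm_weight_le (covDiff u h (κ * t₁) (G t₁))
  have hsub := norm_sub_le (weightOp w (diffQuot h (shiftOp u h (κ * t₀)) (G t₁)))
    (weightOp w (diffQuot h (shiftOp u h (κ * t₁)) (G t₁)))
  have hl := hl.trans (mul_le_mul_of_nonneg_right (hexp _ (by linarith)) (sq_nonneg _))
  have hm := hm.trans (mul_le_mul_of_nonneg_right (hexp _ (by linarith)) (sq_nonneg _))
  have hx := hx.trans (mul_le_mul_of_nonneg_right (hexp _ (by linarith)) (by positivity))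
  rw [abs_mul, abs_of_nonneg hr.1] at hz
  have hκr : τ / 3 ≤ |κ| * (t₁ - t₀) := by nlinarith
  refine half_arith S.nonneg hν hτ (norm_nonneg _) (norm_nonneg _) (norm_nonneg _)
    h1 h2 hd0 hd1 hy0 hy1 hx hm hl
    (hz.trans (mul_le_mul_of_nonneg_left hsub (by linarith [S.nonneg]))) hκr

end Scheme

/-! ### Exponential decay and oscillatory integration by parts -/

section Decay

variable {V N h : ℝ} {u : C(ℝ, ℝ)} {w : ℝ →ᵇ ℝ} {κ m τ : ℝ} {G : ℝ → L2R}

/-- With ν = m³ the window T = 100V/m has νT³ = 10⁶V³, as `IsScheme.half` requires, and `hmV` says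
exactly that 2KνT ≤ 1. -/
lemma IsScheme.half_pow (S : IsScheme V N h u w) (hm : 0 < m) (hκ : 1 ≤ |κ|)
    (hmV : 200 * V * energyConst V * m ^ 2 ≤ 1) (hh : |κ| * (100 * V / m) * (N * h) ≤ 1)
    (hG : IsFlow u κ (m ^ 3) h τ G) (n : ℕ) (hn : n * (100 * V / m) ≤ τ) :
    ‖weightOp w (G (n * (100 * V / m)))‖ ≤ (1 / 2) ^ n * ‖weightOp w (G 0)‖ := by
  have hV : 0 < V := zero_lt_one.trans_le S.one_le
  have hT : 0 < 100 * V / m := by positivity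
  induction n with
  | zero => simp
  | succ n ih =>
    have e : ((n + 1 : ℕ) : ℝ) * (100 * V / m) = n * (100 * V / m) + 100 * V / m := by
      push_cast; ring
    rw [e] at hn ⊢
    have h1 := (hG.restart (a := n * (100 * V / m)) (by positivity)).mono
      (τ' := 100 * V / m) (by linarith)
    have h2 := S.half (by positivity) h1 hκ hT hh
      (by field_simp; linarith)
      (by
        field_simp
        have : V ^ 2 ≤ V ^ 3 := pow_le_pow_right₀ S.one_le (by norm_num)
        norm_num
        linarith [S.one_le])
    simp only [zero_add, weightOp_phaseOp, norm_phaseOp] at h2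
    rw [add_comm, pow_succ']
    have h3 := ih (by linarith)
    linarith

/-- Enhanced dissipation for the scheme. -/
lemma IsScheme.decay (S : IsScheme V N h u w) (hm : 0 ≤ m) (hκ : 1 ≤ |κ|)
    (hmV : 200 * V * energyConst V * m ^ 2 ≤ 1) (hh : |κ| * (100 * V / m) * (N * h) ≤ 1)
    (hG : IsFlow u κ (m ^ 3) h τ G) {t : ℝ} (ht : t ∈ Set.Icc 0 τ) :
    ‖weightOp w (G t)‖ ≤ 4 * Real.exp (-(m / (200 * V) * t)) * ‖weightOp w (G 0)‖ := by
  have hV : 0 < V := zero_lt_one.trans_le S.one_le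
  have hK := S.one_le_energyConst
  -- For m = 0 the quotient 100V/m is 0, so `hh` is no restriction; nothing decays, and conservation
  -- of the energy suffices.
  rcases hm.eq_or_lt with rfl | hm
  · have h1 := S.norm_sq_le (by norm_num) hG ht
    simp only [ne_eq, OfNat.ofNat_ne_zero, not_false_eq_true, zero_pow, mul_zero, zero_mul,
      Real.exp_zero, one_mul] at h1
    have h2 := (abs_le_of_sq_le_sq' h1 (norm_nonneg _)).2
    simp only [zero_div, zero_mul, neg_zero, Real.exp_zero, mul_one]
    linarith [norm_nonneg (weightOp w (G 0))]
  · set T := 100 * V / m with hT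
    have hT0 : 0 < T := by positivity
    set n := ⌊t / T⌋₊ with hn
    have h1 : n * T ≤ t := by
      have := Nat.floor_le (div_nonneg ht.1 hT0.le)
      rwa [le_div_iff₀ hT0] at this
    have h2 : t < (n + 1) * T := by
      have := Nat.lt_floor_add_one (t / T)
      rwa [div_lt_iff₀ hT0] at this
    have h3 := S.half_pow hm hκ hmV hh hG n (h1.trans ht.2)
    have hn0 : 0 ≤ n * T := by positivity
    have h4 := S.norm_sq_le (by positivity) (hG.restart hn0) (t := t - n * T)
      ⟨by linarith, by linarith [ht.2]⟩
    simp only [sub_add_cancel, zero_add, weightOp_phaseOp, norm_phaseOp] at h4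
    have h5 : Real.exp (energyConst V * m ^ 3 * (t - n * T)) ≤ 2 ^ 2 := by
      have h6 : energyConst V * m ^ 3 * (t - n * T) ≤ energyConst V * m ^ 3 * T := by
        gcongr; linarith
      have h7 : energyConst V * m ^ 3 * T ≤ 1 := by
        rw [hT]; field_simp; linarith
      have := Real.exp_le_exp.2 (h6.trans h7)
      have := Real.exp_one_lt_d9
      linarith
    have h6 : ‖weightOp w (G t)‖ ≤ 2 * ‖weightOp w (G (n * T))‖ := by
      refine (abs_le_of_sq_le_sq' ?_ (by positivity)).2
      rw [mul_pow]
      exact h4.trans (mul_le_mul_of_nonneg_right h5 (sq_nonneg _))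
    -- From 1/2 ≤ e^{-1/2} and t < (n+1)T, with 1/(2T) = m/(200V); the incomplete window costs
    -- e^{1/2} ≤ 2.
    have h7 : (1 / 2 : ℝ) ^ n ≤ 2 * Real.exp (-(m / (200 * V) * t)) := by
      have h8 : Real.exp (1 / 2) ≤ 2 := by
        refine (abs_le_of_sq_le_sq' ?_ two_pos.le).2
        rw [← Real.exp_nat_mul]
        have := Real.exp_one_lt_d9
        norm_num
        linarith
      have h9 : (1 / 2 : ℝ) ≤ Real.exp (-(1 / 2)) := by
        have := inv_anti₀ (Real.exp_pos _) h8
        rw [Real.exp_neg]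
        linarith
      calc (1 / 2 : ℝ) ^ n ≤ Real.exp (-(1 / 2)) ^ n := by gcongr
        _ = Real.exp (n * -(1 / 2)) := (Real.exp_nat_mul _ _).symm
        _ ≤ Real.exp (1 / 2 + -(m / (200 * V) * t)) := by
          refine Real.exp_le_exp.2 ?_
          have h10 : m / (200 * V) * t ≤ m / (200 * V) * ((n + 1) * T) := by gcongr
          have h11 : m / (200 * V) * ((n + 1) * T) = (n + 1) / 2 := by rw [hT]; field_simp; norm_num
          linarith
        _ ≤ _ := by rw [Real.exp_add]; gcongr
    calc ‖weightOp w (G t)‖ ≤ 2 * ((1 / 2) ^ n * ‖weightOp w (G 0)‖) := by linarith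
      _ ≤ 2 * (2 * Real.exp (-(m / (200 * V) * t)) * ‖weightOp w (G 0)‖) := by gcongr
      _ = _ := by ring

/-- The weight `1`. -/
noncomputable def oneWeight : ℝ →ᵇ ℝ := BoundedContinuousFunction.const ℝ 1

lemma isWeight_oneWeight (hV : 0 ≤ V) : IsWeight V oneWeight where
  pos _ := one_pos
  growth _ s := by
    change (1 : ℝ) ≤ Real.exp (V * |s|) * 1
    rw [mul_one]
    exact Real.one_le_exp (by positivity)

lemma weightOp_oneWeight (v : L2R) : weightOp oneWeight v = v :=
  ((rep_self v).weightOp oneWeight).eq ((rep_self v).congr fun y => by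
    change _ = ((1 : ℝ) : ℂ) * _
    simp)

lemma ibp_arith {x₁ x₂ d D D₁ D₂ A B a b c c' : ℝ} (hA : 0 ≤ A) (hB : 0 ≤ B) (ha : 0 ≤ a)
    (hb : 0 ≤ b) (h1 : x₁ ≤ d * B) (h2 : x₂ ≤ D * b) (h3 : d ≤ D₁ + D₂) (h4 : D₁ ≤ c * a)
    (h5 : D₂ ≤ c' * A) (h6 : D ≤ c * A) (hc : c ≤ c') :
    x₁ + x₂ ≤ c' * (a * B + A * B + A * b) := by
  have i1 := mul_le_mul_of_nonneg_right hc ha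
  have i2 := mul_le_mul_of_nonneg_right hc hA
  have i3 := mul_le_mul_of_nonneg_right (show d ≤ c' * a + c' * A by linarith) hB
  have i4 := mul_le_mul_of_nonneg_right (h6.trans i2) hb
  linarith

/-- Discrete integration by parts against the oscillating factor `e^{-isu}`. -/
lemma IsScheme.norm_inner_phaseOp_le (S : IsScheme V N h u w) {s : ℝ} (hs0 : s ≠ 0)
    (hs : |s| * (N * h) ≤ 1) (A B : L2R) :
    ‖inner ℂ A (phaseOp u (-s) B)‖ ≤ 4 * V ^ 2 / |s| *
      (‖covDiff u h 0 A‖ * ‖B‖ + ‖A‖ * ‖B‖ + ‖A‖ * ‖covDiff u h 0 B‖) := by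
  have hp := S.pos
  have hV : 0 < V := zero_lt_one.trans_le S.one_le
  have hV' : V ≤ V ^ 2 := by nlinarith [S.one_le]
  have hsp : 0 < |s| := abs_pos.2 hs0
  -- q is the factor by which e^{-isu} changes under one step, so e^{-isu} is its own difference
  -- divided by q - 1. The function z below, the conjugate of h/(q - 1), plays the role of 1/(su')
  -- in the usual nonstationary phase argument.
  set q : ℝ → ℂ := fun y => cis (s * (u y - u (y + h))) with hq
  have hqc : Continuous q := continuous_cis.comp (by fun_prop)
  have hlow : ∀ y, |s| * h / (2 * V) ≤ ‖1 - q y‖ := fun y => by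
    have h1 := half_le_norm_one_sub_cis
      (S.shear.nonneg (inv_nonneg.2 S.nonneg) S.pos y) (S.shear.mul_le_one hs y)
    rw [neg_sub] at h1
    refine le_trans ?_ h1
    have := S.shear.lower y
    calc |s| * h / (2 * V) = |s| * (V⁻¹ * h) / 2 := by field_simp
      _ ≤ _ := by gcongr
  have hne : ∀ y, 1 - q y ≠ 0 := fun y => norm_pos_iff.1 (lt_of_lt_of_le (by positivity) (hlow y))
  set z : ℝ → ℂ := fun y => (starRingEnd ℂ) ((h : ℂ) / (q y - 1)) with hz
  have hzc : Continuous z := by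
    refine Complex.continuous_conj.comp (continuous_const.div (by fun_prop) fun y => ?_)
    rw [← neg_ne_zero, neg_sub]
    exact hne y
  have hzn : ∀ y, ‖z y‖ ≤ 2 * V / |s| := fun y => by
    rw [hz]
    simp only [RCLike.norm_conj, norm_div, Complex.norm_real, Real.norm_eq_abs, abs_of_pos hp]
    rw [norm_sub_rev, div_le_div_iff₀ (norm_pos_iff.2 (hne y)) hsp]
    have := hlow y
    rw [div_le_iff₀ (by positivity)] at this
    linarith
  -- The discrete form of |(1/(su'))'| = |u''|/(|s|u'²): the second difference of u is relative to
  -- the first, and u' is bounded below.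
  have hzd : ∀ y, ‖(h⁻¹ : ℝ) * (z (y + h) - z y)‖ ≤ 4 * V ^ 2 / |s| := fun y => by
    have h1 := S.shear.norm_cis_sub_le (inv_nonneg.2 S.nonneg) S.nonneg hp hs y
    have h2 : q (y + h) - 1 ≠ 0 := by rw [← neg_ne_zero, neg_sub]; exact hne _
    have h3 : q y - 1 ≠ 0 := by rw [← neg_ne_zero, neg_sub]; exact hne _
    have h4 : z (y + h) - z y = (starRingEnd ℂ) ((h : ℂ) / (q y - 1))
        * (starRingEnd ℂ) ((q y - q (y + h)) / (q (y + h) - 1)) := by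
      rw [hz]
      simp only
      rw [← map_sub, ← map_mul]
      congr 1
      field_simp
      ring
    have h5 : ‖(q y - q (y + h)) / (q (y + h) - 1)‖ ≤ 2 * V * h := by
      rw [norm_div, div_le_iff₀ (norm_pos_iff.2 h2), norm_sub_rev, norm_sub_rev _ 1]
      exact h1
    have h7 := hzn y
    simp only [hz, RCLike.norm_conj] at h7
    have h6 := mul_le_mul h7 h5 (norm_nonneg _) (by positivity)
    rw [h4, norm_mul, norm_mul, RCLike.norm_conj, RCLike.norm_conj, Complex.norm_real,
      Real.norm_eq_abs, abs_inv, abs_of_pos hp]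
    calc _ ≤ h⁻¹ * (2 * V / |s| * (2 * V * h)) :=
          mul_le_mul_of_nonneg_left h6 (by positivity)
      _ = _ := by field_simp; norm_num
  obtain ⟨D, hD, hDn⟩ := Rep.exists_mul (f := fun y => z y * A y) (c := 2 * V / |s|)
    (hzc.aestronglyMeasurable.mul (Lp.aestronglyMeasurable A)) (rep_self A) (fun y => by
      rw [norm_mul]
      exact mul_le_mul_of_nonneg_right (hzn y) (norm_nonneg _))
  obtain ⟨D₁, hD1, hDn1⟩ := Rep.exists_mul (f := fun y => z (y + h) * covDiff u h 0 A y)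
    (c := 2 * V / |s|)
    ((hzc.comp (continuous_add_const h)).aestronglyMeasurable.mul
      (Lp.aestronglyMeasurable (covDiff u h 0 A))) (rep_self (covDiff u h 0 A)) (fun y => by
      rw [norm_mul]
      exact mul_le_mul_of_nonneg_right (hzn _) (norm_nonneg _))
  obtain ⟨D₂, hD2, hDn2⟩ := Rep.exists_mul (f := fun y => ((h⁻¹ : ℝ) * (z (y + h) - z y)) * A y)
    (c := 4 * V ^ 2 / |s|)
    ((continuous_const.mul ((hzc.comp (continuous_add_const h)).sub
      hzc)).aestronglyMeasurable.mul
      (Lp.aestronglyMeasurable A)) (rep_self A) (fun y => by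
      rw [norm_mul]
      exact mul_le_mul_of_nonneg_right (hzd y) (norm_nonneg _))
  have hDD : covDiff u h 0 D = D₁ + D₂ := by
    refine (hD.covDiff u h h 0).eq (Filter.EventuallyEq.trans (hD1.add hD2) ?_)
    filter_upwards [(rep_self A).covDiff u h h 0] with y hy
    rw [hy]
    simp only [zero_mul, cis_zero]
    ring
  have hh' : (h : ℂ) ≠ 0 := by exact_mod_cast hp.ne'
  -- Summation by parts with D = zA: the difference of the oscillating factor is moved onto D and
  -- onto B.
  have hkey : inner ℂ A (phaseOp u (-s) B)
      = -inner ℂ (trans (-h) (covDiff u h 0 D)) (phaseOp u (-s) (trans (-h) B))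
        - inner ℂ D (phaseOp u (-s) (trans (-h) (covDiff u h 0 B))) := by
    have r1 : covDiff u h 0 D = ((h⁻¹ : ℝ) : ℂ) • (trans h D - D) := by
      rw [diffQuot_apply, shiftOp_zero]
    have r2 : covDiff u h 0 B = ((h⁻¹ : ℝ) : ℂ) • (trans h B - B) := by
      rw [diffQuot_apply, shiftOp_zero]
    have r3 : inner ℂ (trans (-h) D) (phaseOp u (-s) (trans (-h) B))
        = inner ℂ D (trans h (phaseOp u (-s) (trans (-h) B))) := by
      rw [inner_trans]
    have r4 : inner ℂ A (phaseOp u (-s) B) = ((h⁻¹ : ℝ) : ℂ) *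
        (inner ℂ D (trans h (phaseOp u (-s) (trans (-h) B))) - inner ℂ D (phaseOp u (-s) B)) := by
      have r5 : Rep (((h⁻¹ : ℝ) : ℂ) • (trans h (phaseOp u (-s) (trans (-h) B))
          - phaseOp u (-s) B)) (fun y => ((h⁻¹ : ℝ) : ℂ) * ((q y - 1) * (cis (-s * u y) * B y))) := by
        refine ((((((rep_self B).trans (-h)).phaseOp u (-s)).trans h).sub
          ((rep_self B).phaseOp u (-s))).smul _).congr fun y => ?_
        simp only [add_neg_cancel_right]
        have : cis (-s * u (y + h)) = q y * cis (-s * u y) := by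
          rw [hq, ← cis_add]; ring_nf
        rw [this]
        ring
      rw [← inner_sub_right, ← inner_smul_right, inner_eq_integral hD r5,
        inner_eq_integral (rep_self A) ((rep_self B).phaseOp u (-s))]
      congr 1
      ext y
      have h3 : q y - 1 ≠ 0 := by rw [← neg_ne_zero, neg_sub]; exact hne _
      rw [hz]
      simp only [map_mul, Complex.conj_conj]
      push_cast
      field_simp
    rw [r4, r1, r2]
    simp only [map_smul, map_sub, inner_smul_left, inner_smul_right, inner_sub_left,
      inner_sub_right, trans_neg_trans, Complex.conj_ofReal, r3]
    ring
  rw [hkey]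
  have n1 : ‖inner ℂ (trans (-h) (covDiff u h 0 D)) (phaseOp u (-s) (trans (-h) B))‖
      ≤ ‖covDiff u h 0 D‖ * ‖B‖ := by
    refine (norm_inner_le_norm _ _).trans ?_
    rw [norm_trans, norm_phaseOp, norm_trans]
  have n2 : ‖inner ℂ D (phaseOp u (-s) (trans (-h) (covDiff u h 0 B)))‖
      ≤ ‖D‖ * ‖covDiff u h 0 B‖ := by
    refine (norm_inner_le_norm _ _).trans ?_
    rw [norm_phaseOp, norm_trans]
  have n3 : ‖covDiff u h 0 D‖ ≤ ‖D₁‖ + ‖D₂‖ := by rw [hDD]; exact norm_add_le _ _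
  have hc : 2 * V / |s| ≤ 4 * V ^ 2 / |s| := by gcongr; linarith
  refine (norm_sub_le _ _).trans ?_
  rw [norm_neg]
  exact ibp_arith (norm_nonneg _) (norm_nonneg _) (norm_nonneg _) (norm_nonneg _) n1 n2 n3 hDn1
    hDn2 hDn hc

end Decay

/-! ### Mixing for the discretized flow -/

section Mixing

variable {V N h : ℝ} {u : C(ℝ, ℝ)} {κ ν m τ : ℝ} {G Γ : ℝ → L2R}

lemma inner_covDiff' (u : C(ℝ, ℝ)) (h s : ℝ) (a b : L2R) :
    inner ℂ a (covDiff' u h s b) = inner ℂ (covDiff u h s a) b := by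
  simp only [diffQuot_apply, inner_smul_left, inner_smul_right, inner_sub_left, inner_sub_right,
    inner_shiftOp, Complex.conj_ofReal]

/-- The flow of `-u` is dual to the flow of `u`. -/
lemma IsFlow.inner_const (hG : IsFlow u κ ν h τ G) (hΓ : IsFlow u (-κ) ν h τ Γ) {s : ℝ}
    (hs : s ∈ Set.Icc 0 τ) :
    inner ℂ (phaseOp u (κ * τ) (Γ (τ - s))) (G s) = inner ℂ (phaseOp u (κ * τ) (Γ τ)) (G 0) := by
  have hd : ∀ t ∈ Set.Icc 0 τ, HasDerivWithinAt
      (fun s => inner ℂ (phaseOp u (κ * τ) (Γ (τ - s))) (G s)) 0 (Set.Icc 0 τ) t := by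
    intro t ht
    have h1 : HasDerivWithinAt (fun t => Γ (τ - t)) _ (Set.Icc 0 τ) t :=
      HasDerivWithinAt.scomp_of_eq (h := fun t => τ - t) (t' := Set.Icc 0 τ) t
        (hΓ (τ - t) ⟨by linarith [ht.2], by linarith [ht.1]⟩)
        ((hasDerivWithinAt_id t _).const_sub τ)
        (fun x hx => ⟨by linarith [hx.2], by linarith [hx.1]⟩) rfl
    have h2 := ((phaseOp u (κ * τ)).restrictScalars ℝ).hasFDerivAt.comp_hasDerivWithinAt t h1
    have h3 := h2.inner ℂ (hG t ht)
    refine h3.congr_deriv ?_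
    -- The phase e^{iκτu} carries the parameter -κ(τ-t) of the dual flow to κt, so both flows see
    -- the same symmetric operator and the two derivatives cancel.
    have e : ∀ (h' : ℝ) (v : L2R), phaseOp u (κ * τ) (diffQuot h (shiftOp u h' (-κ * (τ - t))) v)
        = diffQuot h (shiftOp u h' (κ * t)) (phaseOp u (κ * τ) v) := fun h' v => by
      rw [diffQuot_phaseOp]
      ring_nf
    simp only [ContinuousLinearMap.coe_restrictScalars', neg_smul, one_smul, neg_neg, map_smul, e,
      inner_neg_right, inner_smul_left, inner_smul_right, Complex.conj_ofReal,
      Function.comp_apply]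
    have e2 := inner_covDiff' u h (κ * t) (phaseOp u (κ * τ) (Γ (τ - t)))
      (covDiff u h (κ * t) (G t))
    have e3 := inner_covDiff' u h (κ * t) (G t)
      (covDiff u h (κ * t) (phaseOp u (κ * τ) (Γ (τ - t))))
    rw [e2, ← inner_conj_symm (covDiff' u h (κ * t) (covDiff u h (κ * t)
      (phaseOp u (κ * τ) (Γ (τ - t))))) (G t), e3, inner_conj_symm]
    ring
  have := constant_of_derivWithin_zero (f := fun s => inner ℂ (phaseOp u (κ * τ) (Γ (τ - s))) (G s))
    (a := 0) (b := τ) (fun x hx => (hd x hx).differentiableWithinAt)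
    (fun x hx => (hd x ⟨hx.1, hx.2.le⟩).derivWithin
      (uniqueDiffOn_Icc (hx.1.trans_lt hx.2) x ⟨hx.1, hx.2.le⟩)) s hs
  simpa using this

/-- The constant of the mixing estimate. -/
noncomputable def mixConst (V : ℝ) : ℝ := 400 * V ^ 2 * energyConst V

lemma mix_arith {K e₁ e₂ a A b B A₀ a₀ B₀ b₀ E : ℝ} (hK : 1 ≤ K) (he1 : 0 ≤ e₁)
    (he2 : 0 ≤ e₂) (hE : 0 ≤ E) (hA0 : 0 ≤ A₀) (ha0 : 0 ≤ a₀) (hB0 : 0 ≤ B₀) (hb0 : 0 ≤ b₀)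
    (hA' : 0 ≤ A) (hB' : 0 ≤ B)
    (ha : a ≤ K * e₁ * (a₀ + A₀)) (hb : b ≤ K * e₁ * (b₀ + B₀)) (hA : A ≤ 4 * e₂ * A₀)
    (hB : B ≤ 4 * e₂ * B₀) (h1 : e₁ * e₂ ≤ E) (h2 : e₂ * e₂ ≤ E) :
    a * B + A * B + A * b ≤ 24 * K * E * ((A₀ + a₀) * (B₀ + b₀)) := by
  have i1 : a * B ≤ (K * e₁ * (a₀ + A₀)) * (4 * e₂ * B₀) :=
    mul_le_mul ha hB hB' (by positivity)
  have i2 : A * B ≤ (4 * e₂ * A₀) * (4 * e₂ * B₀) := mul_le_mul hA hB hB' (by positivity)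
  have i3 : A * b ≤ (4 * e₂ * A₀) * (K * e₁ * (b₀ + B₀)) :=
    (mul_le_mul_of_nonneg_left hb hA').trans (mul_le_mul_of_nonneg_right hA (by positivity))
  have P : (A₀ + a₀) * B₀ ≤ (A₀ + a₀) * (B₀ + b₀) := by gcongr; linarith
  have Q : A₀ * (B₀ + b₀) ≤ (A₀ + a₀) * (B₀ + b₀) := by gcongr; linarith
  have R : A₀ * B₀ ≤ (A₀ + a₀) * (B₀ + b₀) :=
    mul_le_mul (by linarith) (by linarith) hB0 (by linarith)
  have j1 : (K * e₁ * (a₀ + A₀)) * (4 * e₂ * B₀) ≤ 4 * K * E * ((A₀ + a₀) * (B₀ + b₀)) := by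
    calc _ = 4 * K * (e₁ * e₂) * ((A₀ + a₀) * B₀) := by ring
      _ ≤ _ := by gcongr
  have j2 : (4 * e₂ * A₀) * (4 * e₂ * B₀) ≤ 16 * K * E * ((A₀ + a₀) * (B₀ + b₀)) := by
    calc _ = 16 * 1 * (e₂ * e₂) * (A₀ * B₀) := by ring
      _ ≤ _ := by gcongr
  have j3 : (4 * e₂ * A₀) * (K * e₁ * (b₀ + B₀)) ≤ 4 * K * E * ((A₀ + a₀) * (B₀ + b₀)) := by
    calc _ = 4 * K * (e₁ * e₂) * (A₀ * (B₀ + b₀)) := by ring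
      _ ≤ _ := by gcongr
  linarith

lemma IsScheme.grad_le (S : IsScheme V N h u oneWeight) (hν : 0 ≤ ν) (hG : IsFlow u κ ν h τ G)
    (hh : |κ| * τ * (N * h) ≤ 1) {t : ℝ} (ht : t ∈ Set.Icc 0 τ) :
    ‖covDiff u h 0 (G t)‖ ≤ energyConst V * Real.exp (energyConst V * ν * t / 2)
      * (‖covDiff u h 0 (G 0)‖ + ‖G 0‖) := by
  have h1 := S.grad_sq_le hν hG hh ht
  have hK := S.one_le_energyConst
  simp only [weightOp_oneWeight] at h1
  refine (abs_le_of_sq_le_sq' (h1.trans ?_) (by positivity)).2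
  have e : Real.exp (energyConst V * ν * t) = Real.exp (energyConst V * ν * t / 2) ^ 2 := by
    rw [← Real.exp_nat_mul]; push_cast; ring_nf
  have e' : ∀ x y z : ℝ, (x * y * z) ^ 2 = y ^ 2 * (x ^ 2 * z ^ 2) := fun x y z => by ring
  rw [e, e']
  refine mul_le_mul_of_nonneg_left ?_ (sq_nonneg _)
  set a := ‖covDiff u h 0 (G 0)‖
  set b := ‖G 0‖
  have ha : 0 ≤ a := norm_nonneg _
  have hb : 0 ≤ b := norm_nonneg _
  have h2 : energyConst V ≤ energyConst V ^ 2 := by nlinarith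
  have h3 := mul_le_mul_of_nonneg_right h2 (sq_nonneg b)
  have h4 := mul_le_mul_of_nonneg_right (hK.trans h2) (sq_nonneg a)
  have h5 : 0 ≤ energyConst V ^ 2 * (2 * a * b) := by positivity
  linarith

/-- Mixing and enhanced dissipation for the scheme. -/
lemma IsScheme.mixing (S : IsScheme V N h u oneWeight) (hm : 0 ≤ m) (hκ : 1 ≤ |κ|)
    (hmV : 200 * V * energyConst V * m ^ 2 ≤ 1) (hh : |κ| * (100 * V / m) * (N * h) ≤ 1)
    (hτ : 0 ≤ τ) (hhτ : |κ| * τ * (N * h) ≤ 1)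
    (hG : IsFlow u κ (m ^ 3) h τ G) (hΓ : IsFlow u (-κ) (m ^ 3) h τ Γ) :
    ‖inner ℂ (Γ 0) (phaseOp u (-(κ * τ)) (G τ))‖ ≤ mixConst V
      * (Real.exp (-(m / (800 * V) * τ)) / √(1 + τ ^ 2))
      * ((‖Γ 0‖ + ‖covDiff u h 0 (Γ 0)‖) * (‖G 0‖ + ‖covDiff u h 0 (G 0)‖)) := by
  have hV : 0 < V := zero_lt_one.trans_le S.one_le
  have hK := S.one_le_energyConst
  have hV2 : 1 ≤ V ^ 2 := one_le_pow₀ S.one_le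
  have hsq : 0 < √(1 + τ ^ 2) := Real.sqrt_pos.2 (by positivity)
  -- For τ ≤ 1 the factor √(1+τ²) is at most 2 and decay alone is enough.
  rcases le_total τ 1 with h1 | h1
  · have h2 := S.decay hm hκ hmV hh hG (t := τ) ⟨hτ, le_rfl⟩
    simp only [weightOp_oneWeight] at h2
    have h3 : √(1 + τ ^ 2) ≤ 2 := by
      rw [Real.sqrt_le_left two_pos.le]; nlinarith
    have h4 : Real.exp (-(m / (200 * V) * τ)) ≤ Real.exp (-(m / (800 * V) * τ)) := by
      gcongr; norm_num
    have h5 : 4 * Real.exp (-(m / (200 * V) * τ))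
        ≤ mixConst V * (Real.exp (-(m / (800 * V) * τ)) / √(1 + τ ^ 2)) := by
      rw [← mul_div_assoc, le_div_iff₀ hsq]
      have h6 : 1 ≤ V ^ 2 * energyConst V := one_le_mul_of_one_le_of_one_le hV2 hK
      calc 4 * Real.exp (-(m / (200 * V) * τ)) * √(1 + τ ^ 2)
          ≤ 4 * Real.exp (-(m / (800 * V) * τ)) * 2 := by gcongr
        _ ≤ mixConst V * Real.exp (-(m / (800 * V) * τ)) := by
          unfold mixConst
          have := Real.exp_pos (-(m / (800 * V) * τ))
          nlinarith
    refine (norm_inner_le_norm _ _).trans ?_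
    rw [norm_phaseOp]
    calc ‖Γ 0‖ * ‖G τ‖ ≤ ‖Γ 0‖ * (4 * Real.exp (-(m / (200 * V) * τ)) * ‖G 0‖) := by gcongr
      _ = 4 * Real.exp (-(m / (200 * V) * τ)) * (‖Γ 0‖ * ‖G 0‖) := by ring
      _ ≤ _ := by
        refine mul_le_mul h5 ?_ (by positivity) (by unfold mixConst; positivity)
        gcongr <;> simp
  · have hτ0 : 0 < τ := by linarith
    have hτ2 : τ / 2 ∈ Set.Icc 0 τ := ⟨by linarith, by linarith⟩
    have hκ' : 1 ≤ |(-κ)| := by rwa [abs_neg]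
    -- The conserved pairing is taken at τ/2, so that each profile has run for half the time while
    -- the phase is still the full κτ.
    have e1 := hG.inner_const hΓ (s := τ) ⟨hτ, le_rfl⟩
    have e2 := hG.inner_const hΓ hτ2
    rw [sub_self] at e1
    rw [sub_half] at e2
    have e3 : inner ℂ (Γ 0) (phaseOp u (-(κ * τ)) (G τ))
        = inner ℂ (Γ (τ / 2)) (phaseOp u (-(κ * τ)) (G (τ / 2))) := by
      rw [inner_phaseOp, inner_phaseOp, neg_neg, e1, e2]
    have hs : |κ * τ| * (N * h) ≤ 1 := by rwa [abs_mul, abs_of_pos hτ0]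
    have h2 := S.norm_inner_phaseOp_le (s := κ * τ)
      (mul_ne_zero (abs_pos.1 (by linarith)) hτ0.ne') hs (Γ (τ / 2)) (G (τ / 2))
    have hK0 : 0 ≤ energyConst V := by linarith
    have g1 := S.grad_le (by positivity) hG hhτ hτ2
    have g2 := S.grad_le (by positivity) hΓ (by rwa [abs_neg]) hτ2
    have d1 := S.decay hm hκ hmV hh hG hτ2
    have d2 := S.decay hm hκ' hmV (by rwa [abs_neg]) hΓ hτ2
    simp only [weightOp_oneWeight] at d1 d2
    -- Decay over half the time gives e^{-mτ/(400V)}. The gradient grows at most like e^{mτ/(800V)},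
    -- because Km² ≤ 1/(200V). The net rate is m/(800V).
    have x1 : Real.exp (energyConst V * m ^ 3 * (τ / 2) / 2)
        * Real.exp (-(m / (200 * V) * (τ / 2))) ≤ Real.exp (-(m / (800 * V) * τ)) := by
      rw [← Real.exp_add]
      refine Real.exp_le_exp.2 ?_
      have h3 : energyConst V * m ^ 2 ≤ 1 / (200 * V) := by
        rw [le_div_iff₀ (by positivity)]; linarith
      have h4 := mul_le_mul_of_nonneg_right h3 (mul_nonneg hm hτ)
      have h5 : m / (200 * V) * (τ / 2) = 1 / (200 * V) * (m * τ) / 2 := by ring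
      have h6 : m / (800 * V) * τ = 1 / (200 * V) * (m * τ) / 4 := by ring
      rw [h5, h6]
      linarith
    have x2 : Real.exp (-(m / (200 * V) * (τ / 2))) * Real.exp (-(m / (200 * V) * (τ / 2)))
        ≤ Real.exp (-(m / (800 * V) * τ)) := by
      rw [← Real.exp_add]
      refine Real.exp_le_exp.2 ?_
      have h5 : m / (200 * V) * (τ / 2) = m / (800 * V) * τ * 2 := by ring
      have : 0 ≤ m / (800 * V) * τ := by positivity
      linarith
    have h3 := mix_arith hK (Real.exp_pos _).le (Real.exp_pos _).le (Real.exp_pos _).le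
      (norm_nonneg (Γ 0)) (norm_nonneg (covDiff u h 0 (Γ 0))) (norm_nonneg (G 0))
      (norm_nonneg (covDiff u h 0 (G 0))) (norm_nonneg _) (norm_nonneg _) g2 g1 d2 d1 x1 x2
    rw [e3]
    refine h2.trans ?_
    have h4 : 4 * V ^ 2 / |κ * τ| ≤ 8 * V ^ 2 / √(1 + τ ^ 2) := by
      rw [div_le_div_iff₀ (abs_pos.2 (mul_ne_zero (abs_pos.1 (by linarith)) hτ0.ne')) hsq]
      have h5 : √(1 + τ ^ 2) ≤ 2 * τ := by
        rw [Real.sqrt_le_left (by positivity)]; nlinarith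
      have h6 : τ ≤ |κ * τ| := by
        rw [abs_mul, abs_of_pos hτ0]; nlinarith
      calc 4 * V ^ 2 * √(1 + τ ^ 2) ≤ 4 * V ^ 2 * (2 * |κ * τ|) := by gcongr; linarith
        _ = _ := by ring
    have hX := norm_nonneg (Γ 0)
    have hX' := norm_nonneg (covDiff u h 0 (Γ 0))
    have hY := norm_nonneg (G 0)
    have hY' := norm_nonneg (covDiff u h 0 (G 0))
    have hq : 0 ≤ 8 * V ^ 2 / √(1 + τ ^ 2) := by positivity
    refine (mul_le_mul h4 h3 (add_nonneg (add_nonneg (mul_nonneg (norm_nonneg _) (norm_nonneg _))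
      (mul_nonneg (norm_nonneg _) (norm_nonneg _))) (mul_nonneg (norm_nonneg _) (norm_nonneg _)))
      hq).trans ?_
    have hP : 0 ≤ (‖Γ 0‖ + ‖covDiff u h 0 (Γ 0)‖) * (‖G 0‖ + ‖covDiff u h 0 (G 0)‖) :=
      mul_nonneg (add_nonneg hX hX') (add_nonneg hY hY')
    calc _ = 192 * V ^ 2 * energyConst V * (Real.exp (-(m / (800 * V) * τ)) / √(1 + τ ^ 2))
          * ((‖Γ 0‖ + ‖covDiff u h 0 (Γ 0)‖) * (‖G 0‖ + ‖covDiff u h 0 (G 0)‖)) := by ring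
      _ ≤ _ := by
        refine mul_le_mul_of_nonneg_right (mul_le_mul_of_nonneg_right ?_ ?_) hP
        · unfold mixConst
          have : 0 ≤ V ^ 2 * energyConst V := mul_nonneg (sq_nonneg V) hK0
          linarith
        · exact div_nonneg (Real.exp_pos _).le hsq.le

/-- The energy identity. -/
lemma IsFlow.hasDeriv_norm_sq (hG : IsFlow u κ ν h τ G) {t : ℝ} (ht : t ∈ Set.Icc 0 τ) :
    HasDerivWithinAt (fun r => ‖G r‖ ^ 2) (-(2 * ν * ‖covDiff u h (κ * t) (G t)‖ ^ 2))
      (Set.Icc 0 τ) t := by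
  have h1 := hasDerivWithinAt_norm_sq (1 : L2R →L[ℂ] L2R) (hG t ht)
  simp only [one_apply_eq_self, inner_neg_right, inner_smul_right, inner_covDiff', Complex.neg_re,
    Complex.re_ofReal_mul] at h1
  refine h1.congr_deriv ?_
  have : (inner ℂ (covDiff u h (κ * t) (G t)) (covDiff u h (κ * t) (G t))).re
      = ‖covDiff u h (κ * t) (G t)‖ ^ 2 := inner_self_eq_norm_sq (𝕜 := ℂ) _
  rw [this]
  ring

end Mixing

/-! ### Difference bounds and truncation of the shear -/

lemma le_exp_abs_mul {f f' : ℝ → ℝ} {K : ℝ} (hf : ∀ y, HasDerivAt f (f' y) y)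
    (hK : ∀ y, |f' y| ≤ K * f y) (y s : ℝ) : f (y + s) ≤ Real.exp (K * |s|) * f y := by
  rcases le_total 0 s with hs | hs
  · have h1 := le_exp_mul_of_deriv_le (e := fun r => f (y + r)) (e' := fun r => f' (y + r)) (K := K)
      (τ := s) (fun t _ => ((hf (y + t)).comp_const_add y t).hasDerivWithinAt)
      (fun t _ => (le_abs_self _).trans (hK _)) ⟨hs, le_rfl⟩
    simpa [abs_of_nonneg hs] using h1
  · have h1 := le_exp_mul_of_deriv_le (e := fun r => f (y - r)) (e' := fun r => -f' (y - r)) (K := K)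
      (τ := -s) (fun t _ => ((hf (y - t)).comp_const_sub y t).hasDerivWithinAt)
      (fun t _ => (neg_le_abs _).trans (hK _)) ⟨neg_nonneg.2 hs, le_rfl⟩
    simpa [abs_of_nonpos hs] using h1

/-- Cauchy's form of the mean value inequality, since Kv ± F are monotone. Measuring by increments
of v rather than by b - a keeps the bounds relative to u'. -/
lemma abs_sub_le_of_deriv_le {F F' v v' : ℝ → ℝ} {K : ℝ} (hF : ∀ y, HasDerivAt F (F' y) y)
    (hv : ∀ y, HasDerivAt v (v' y) y) (h : ∀ y, |F' y| ≤ K * v' y) {a b : ℝ} (hab : a ≤ b) :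
    |F b - F a| ≤ K * (v b - v a) := by
  have h1 : Monotone fun y => K * v y - F y :=
    monotone_of_hasDerivAt_nonneg (fun y => ((hv y).const_mul K).sub (hF y))
      fun y => by simpa using (le_abs_self _).trans (h y)
  have h2 : Monotone fun y => K * v y + F y :=
    monotone_of_hasDerivAt_nonneg (fun y => ((hv y).const_mul K).add (hF y))
      fun y => by
        have := (neg_le_abs _).trans (h y)
        simp only [Pi.zero_apply]
        linarith
  have h3 := h1 hab
  have h4 := h2 hab
  simp only at h3 h4
  rw [abs_le]
  constructor <;> linarith

lemma abs_sub_le_of_abs_deriv_le {f f' : ℝ → ℝ} {K : ℝ} {a b : ℝ} (hab : a ≤ b)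
    (hf : ∀ y, HasDerivAt f (f' y) y) (h : ∀ y ∈ Set.Icc a b, |f' y| ≤ K) :
    |f b - f a| ≤ K * (b - a) := by
  have := (convex_Icc a b).norm_image_sub_le_of_norm_hasDerivWithin_le
    (fun y _ => (hf y).hasDerivWithinAt) h (Set.left_mem_Icc.2 hab) (Set.right_mem_Icc.2 hab)
  rwa [Real.norm_eq_abs, Real.norm_eq_abs, abs_of_nonneg (sub_nonneg.2 hab)] at this

/-- Over one step v₁ changes at most by the factor e < 3, so differences of v₁ are bounded by v₁
itself; `abs_sub_le_of_deriv_le` integrates this to differences of v. The forward first difference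
of v gives `second`, the backward one `second'`, the centred second difference `third`. -/
lemma isDiffShear_of_hasDerivAt {v : C(ℝ, ℝ)} {v₁ v₂ v₃ : ℝ → ℝ} {K c₀ N h : ℝ} (hK : 0 ≤ K)
    (h1 : ∀ y, HasDerivAt v (v₁ y) y) (h2 : ∀ y, HasDerivAt v₁ (v₂ y) y)
    (h3 : ∀ y, HasDerivAt v₂ (v₃ y) y) (hc : 0 < c₀) (b1 : ∀ y, c₀ ≤ v₁ y) (b1' : ∀ y, v₁ y ≤ N)
    (b2 : ∀ y, |v₂ y| ≤ K * v₁ y) (b3 : ∀ y, |v₃ y| ≤ K * v₁ y) (hh : 0 < h) (hKh : K * h ≤ 1) :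
    IsDiffShear (6 * K) c₀ N h v := by
  have hp : ∀ y, 0 < v₁ y := fun y => hc.trans_le (b1 y)
  have hg : ∀ y s, |s| ≤ h → v₁ (y + s) ≤ 3 * v₁ y := fun y s hs => by
    refine (le_exp_abs_mul h2 b2 y s).trans ?_
    have h4 : K * |s| ≤ 1 := (mul_le_mul_of_nonneg_left hs hK).trans hKh
    have h5 := Real.exp_le_exp.2 h4
    have h6 := Real.exp_one_lt_d9
    exact mul_le_mul_of_nonneg_right (by linarith) (hp y).le
  have d1 : ∀ y, |v₁ (y + h) - v₁ y| ≤ 3 * K * h * v₁ y := fun y => by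
    have := abs_sub_le_of_abs_deriv_le (K := K * (3 * v₁ y)) (a := y) (b := y + h) (by linarith) h2
      (fun z hz => (b2 z).trans (mul_le_mul_of_nonneg_left (by
        have := hg y (z - y) (by rw [abs_of_nonneg (by linarith [hz.1])]; linarith [hz.2])
        rwa [add_sub_cancel] at this) hK))
    linarith
  have d1' : ∀ y, |v₁ y - v₁ (y - h)| ≤ 3 * K * h * v₁ y := fun y => by
    have := abs_sub_le_of_abs_deriv_le (K := K * (3 * v₁ y)) (a := y - h) (b := y) (by linarith) h2
      (fun z hz => (b2 z).trans (mul_le_mul_of_nonneg_left (by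
        have := hg y (z - y) (by rw [abs_of_nonpos (by linarith [hz.2])]; linarith [hz.1])
        rwa [add_sub_cancel] at this) hK))
    linarith
  have d2 : ∀ y, |v₁ (y + h) - 2 * v₁ y + v₁ (y - h)| ≤ 6 * K * h ^ 2 * v₁ y := fun y => by
    have e1 : ∀ r, HasDerivAt (fun r => v₁ (y + r) + v₁ (y - r)) (v₂ (y + r) + -v₂ (y - r)) r :=
      fun r => ((h2 (y + r)).comp_const_add y r).add ((h2 (y - r)).comp_const_sub y r)
    have := abs_sub_le_of_abs_deriv_le (K := 6 * K * h * v₁ y) hh.le e1 (fun r hr => by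
      have := abs_sub_le_of_abs_deriv_le (K := K * (3 * v₁ y)) (a := y - r) (b := y + r)
        (by linarith [hr.1]) h3 (fun z hz => (b3 z).trans (mul_le_mul_of_nonneg_left (by
          have := hg y (z - y) (by
            rw [abs_le]; constructor <;> linarith [hz.1, hz.2, hr.2])
          rwa [add_sub_cancel] at this) hK))
      rw [← sub_eq_add_neg]
      refine this.trans ?_
      have := mul_le_mul_of_nonneg_left hr.2 (mul_nonneg hK (hp y).le)
      linarith)
    simp only [add_zero, sub_zero] at this
    calc _ = |v₁ (y + h) + v₁ (y - h) - (v₁ y + v₁ y)| := by ring_nf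
      _ ≤ _ := by linarith
  refine ⟨fun y => ?_, fun y => ?_, fun y => ?_, fun y => ?_, fun y => ?_⟩
  · have : Monotone fun z => v z - c₀ * z :=
      monotone_of_hasDerivAt_nonneg (fun z => (h1 z).sub ((hasDerivAt_id z).const_mul c₀))
        fun z => by simpa using b1 z
    have := this (show y ≤ y + h by linarith)
    simp only at this
    linarith
  · have : Monotone fun z => N * z - v z :=
      monotone_of_hasDerivAt_nonneg (fun z => ((hasDerivAt_id z).const_mul N).sub (h1 z))
        fun z => by simpa using b1' z
    have := this (show y ≤ y + h by linarith)
    simp only at this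
    linarith
  · have := abs_sub_le_of_deriv_le (fun z => ((h1 (z + h)).comp_add_const z h).sub (h1 z)) h1 d1
      (show y ≤ y + h by linarith)
    have e : v (y + h + h) - v (y + h) - (v (y + h) - v y)
      = v (y + h + h) - 2 * v (y + h) + v y := by ring
    simp only [Pi.sub_apply] at this
    rw [e] at this
    refine this.trans ?_
    have h5 : 0 ≤ v (y + h) - v y := sub_nonneg.2
      ((monotone_of_hasDerivAt_nonneg h1 fun z => (hp z).le) (show y ≤ y + h by linarith))
    have : 0 ≤ K * h * (v (y + h) - v y) := by positivity
    linarith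
  · have := abs_sub_le_of_deriv_le (fun z => (h1 z).sub ((h1 (z - h)).comp_sub_const z h)) h1 d1'
      (show y + h ≤ y + h + h by linarith)
    simp only [Pi.sub_apply, add_sub_cancel_right] at this
    have e : v (y + h + h) - v (y + h) - (v (y + h) - v y)
      = v (y + h + h) - 2 * v (y + h) + v y := by ring
    rw [e] at this
    refine this.trans ?_
    have h5 : 0 ≤ v (y + h + h) - v (y + h) := sub_nonneg.2
      ((monotone_of_hasDerivAt_nonneg h1 fun z => (hp z).le) (show y + h ≤ y + h + h by linarith))
    have : 0 ≤ K * h * (v (y + h + h) - v (y + h)) := by positivity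
    linarith
  · have := abs_sub_le_of_deriv_le (fun z => (((h1 (z + h)).comp_add_const z h).sub
      ((h1 z).const_mul 2)).add ((h1 (z - h)).comp_sub_const z h)) h1 d2
      (show y + h ≤ y + h + h by linarith)
    simp only [Pi.add_apply, Pi.sub_apply, add_sub_cancel_right] at this
    calc _ = |v (y + h + h + h) - 2 * v (y + h + h) + v (y + h)
        - (v (y + h + h) - 2 * v (y + h) + v y)| := by ring_nf
      _ ≤ _ := this

section Admissible

variable {U : ℝ} {u : ℝ → ℝ}

lemma IsAdmissibleShear.pos (hu : IsAdmissibleShear U u) (hU : 1 ≤ U) (y : ℝ) : 0 < deriv u y :=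
  lt_of_lt_of_le (by positivity) (hu.le_deriv y)

lemma IsAdmissibleShear.hasDerivAt (hu : IsAdmissibleShear U u) (y : ℝ) :
    HasDerivAt u (deriv u y) y :=
  (hu.contDiff.differentiable (by norm_num) y).hasDerivAt

lemma IsAdmissibleShear.hasDerivAt_deriv (hu : IsAdmissibleShear U u) (y : ℝ) :
    HasDerivAt (deriv u) (iteratedDeriv 2 u y) y := by
  have h : ContDiff ℝ 2 (deriv u) := (contDiff_succ_iff_deriv (n := 2).1 hu.contDiff).2.2
  rw [iteratedDeriv_succ, iteratedDeriv_one]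
  exact (h.differentiable (by norm_num) y).hasDerivAt

lemma IsAdmissibleShear.hasDerivAt_deriv2 (hu : IsAdmissibleShear U u) (y : ℝ) :
    HasDerivAt (iteratedDeriv 2 u) (iteratedDeriv 3 u y) y := by
  rw [iteratedDeriv_succ (n := 2)]
  exact (hu.contDiff.differentiable_iteratedDeriv 2 (by norm_num) y).hasDerivAt

lemma IsAdmissibleShear.second_le (hu : IsAdmissibleShear U u) (hU : 1 ≤ U) (y : ℝ) :
    |iteratedDeriv 2 u y| ≤ U * deriv u y := by
  have := hu.second y
  rwa [div_le_iff₀ (hu.pos hU y)] at this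

lemma IsAdmissibleShear.third_le (hu : IsAdmissibleShear U u) (hU : 1 ≤ U) (y : ℝ) :
    |iteratedDeriv 3 u y| ≤ U * deriv u y := by
  have := hu.third y
  rwa [div_le_iff₀ (hu.pos hU y)] at this

lemma IsAdmissibleShear.continuous_deriv (hu : IsAdmissibleShear U u) : Continuous (deriv u) :=
  hu.contDiff.continuous_deriv (by norm_num)

lemma IsAdmissibleShear.deriv_growth (hu : IsAdmissibleShear U u) (hU : 1 ≤ U) (y s : ℝ) :
    deriv u (y + s) ≤ Real.exp (U * |s|) * deriv u y :=
  le_exp_abs_mul hu.hasDerivAt_deriv (hu.second_le hU) y s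

/-- The weight `1 / u'`. -/
noncomputable def invDeriv (hu : IsAdmissibleShear U u) (hU : 1 ≤ U) : ℝ →ᵇ ℝ :=
  BoundedContinuousFunction.ofNormedAddCommGroup (fun y => (deriv u y)⁻¹)
    (hu.continuous_deriv.inv₀ fun y => (hu.pos hU y).ne') U (fun y => by
      rw [norm_inv, Real.norm_eq_abs, abs_of_pos (hu.pos hU y)]
      refine inv_le_of_inv_le₀ (by positivity) ?_
      simpa using hu.le_deriv y)

lemma isWeight_invDeriv (hu : IsAdmissibleShear U u) (hU : 1 ≤ U) {V : ℝ} (hV : U ≤ V) :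
    IsWeight V (invDeriv hu hU) where
  pos y := inv_pos.2 (hu.pos hU y)
  growth y s := by
    change (deriv u (y + s))⁻¹ ≤ Real.exp (V * |s|) * (deriv u y)⁻¹
    have h1 := hu.deriv_growth hU (y + s) (-s)
    rw [add_neg_cancel_right, abs_neg] at h1
    have h2 : Real.exp (U * |s|) ≤ Real.exp (V * |s|) := by gcongr
    have p := hu.pos hU y
    have q := hu.pos hU (y + s)
    rw [← div_eq_mul_inv, le_div_iff₀ p, inv_mul_le_iff₀ q]
    nlinarith

/-- Truncation of the shear: `v' = N u' / (N + u')`. -/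
lemma IsAdmissibleShear.exists_trunc (hu : IsAdmissibleShear U u) (hU : 1 ≤ U) {N : ℝ}
    (hN : 1 ≤ N) : ∃ v : C(ℝ, ℝ),
      (∀ h, 0 < h → 18 * U ^ 2 * h ≤ 1 → IsDiffShear (18 * U ^ 2) (18 * U ^ 2)⁻¹ N h v) ∧
      ∀ R B, (∀ y, |y| ≤ R → deriv u y ≤ B) → ∀ y, |y| ≤ R → |v y - u y| ≤ B ^ 2 * R / N := by
  have hN0 : 0 < N := by linarith
  have hp := hu.pos hU
  -- v' = Φ(u') with Φ(p) = Np/(N+p) is at most N and at most u'. As pΦ'(p) ≤ Φ(p) and p²|Φ''(p)| ≤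
  -- 2Φ(p), the relative bounds survive with U + 2U² ≤ 3U².
  set v₁ : ℝ → ℝ := fun y => N * deriv u y / (N + deriv u y) with hv1
  set v₂ : ℝ → ℝ := fun y => N ^ 2 * iteratedDeriv 2 u y / (N + deriv u y) ^ 2 with hv2
  set v₃ : ℝ → ℝ := fun y => N ^ 2 * iteratedDeriv 3 u y / (N + deriv u y) ^ 2
    - 2 * N ^ 2 * iteratedDeriv 2 u y ^ 2 / (N + deriv u y) ^ 3 with hv3
  have hne : ∀ y, N + deriv u y ≠ 0 := fun y => by linarith [hp y, (add_pos hN0 (hp y)).ne']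
  have hc1 : Continuous v₁ := (continuous_const.mul hu.continuous_deriv).div
    (continuous_const.add hu.continuous_deriv) hne
  have h1 : ∀ y, HasDerivAt (fun y => u 0 + ∫ s in (0 : ℝ)..y, v₁ s) (v₁ y) y := fun y =>
    (intervalIntegral.integral_hasDerivAt_right (hc1.intervalIntegrable _ _)
      hc1.stronglyMeasurable.stronglyMeasurableAtFilter hc1.continuousAt).const_add _
  have h2 : ∀ y, HasDerivAt v₁ (v₂ y) y := fun y => by
    have := ((hu.hasDerivAt_deriv y).const_mul N).div ((hu.hasDerivAt_deriv y).const_add N) (hne y)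
    refine this.congr_deriv ?_
    rw [hv2]
    have := hne y
    field_simp
    ring
  have h3 : ∀ y, HasDerivAt v₂ (v₃ y) y := fun y => by
    have := ((hu.hasDerivAt_deriv2 y).const_mul (N ^ 2)).div
      (((hu.hasDerivAt_deriv y).const_add N).pow 2) (pow_ne_zero 2 (hne y))
    refine this.congr_deriv ?_
    rw [hv3]
    have := hne y
    simp only [Pi.pow_apply]
    field_simp
    push_cast
    ring
  have b1 : ∀ y, (18 * U ^ 2)⁻¹ ≤ v₁ y := fun y => by
    rw [hv1]
    have h4 := hu.le_deriv y
    have p := hp y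
    rw [div_le_iff₀ (by linarith)] at h4
    rw [inv_le_iff_one_le_mul₀ (by positivity)]
    simp only
    rw [div_mul_eq_mul_div, le_div_iff₀ (by linarith)]
    have i0 : 1 ≤ deriv u y * U ^ 2 := by
      calc (1 : ℝ) ≤ deriv u y * U * U := one_le_mul_of_one_le_of_one_le h4 hU
        _ = _ := by ring
    have i1 : N ≤ N * (deriv u y * U ^ 2) := le_mul_of_one_le_right hN0.le i0
    have i2 : deriv u y ≤ N * (deriv u y * U ^ 2) := by
      have : 1 ≤ N * U ^ 2 := one_le_mul_of_one_le_of_one_le hN (one_le_pow₀ hU)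
      nlinarith
    linarith
  have b1' : ∀ y, v₁ y ≤ N := fun y => by
    have p := hp y
    rw [hv1]
    simp only
    rw [div_le_iff₀ (by linarith)]
    nlinarith
  have b2 : ∀ y, |v₂ y| ≤ 3 * U ^ 2 * v₁ y := fun y => by
    have p := hp y
    have q := hu.second_le hU y
    rw [hv1, hv2]
    simp only
    rw [abs_div, abs_mul, abs_of_pos (show 0 < N ^ 2 by positivity),
      abs_of_pos (show 0 < (N + deriv u y) ^ 2 by positivity), mul_div_assoc',
      div_le_div_iff₀ (by positivity) (by positivity)]
    calc N ^ 2 * |iteratedDeriv 2 u y| * (N + deriv u y)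
        ≤ N ^ 2 * (U * deriv u y) * (N + deriv u y) := by gcongr
      _ = U * (N * deriv u y) * (N * (N + deriv u y)) := by ring
      _ ≤ (3 * U ^ 2) * (N * deriv u y) * ((N + deriv u y) * (N + deriv u y)) := by
        gcongr
        · nlinarith
        · linarith
      _ = _ := by ring
  have b3 : ∀ y, |v₃ y| ≤ 3 * U ^ 2 * v₁ y := fun y => by
    have p := hp y
    have q := hu.third_le hU y
    have q2 := hu.second_le hU y
    have q3 : iteratedDeriv 2 u y ^ 2 ≤ (U * deriv u y) ^ 2 := by
      rw [← sq_abs]; gcongr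
    have s : 0 < N + deriv u y := by linarith
    rw [hv1, hv3]
    simp only
    refine (abs_sub _ _).trans ?_
    rw [abs_div, abs_mul, abs_div, abs_mul, abs_of_pos (show 0 < N ^ 2 by positivity),
      abs_of_pos (show 0 < (N + deriv u y) ^ 2 by positivity),
      abs_of_pos (show 0 < (N + deriv u y) ^ 3 by positivity),
      abs_of_pos (show 0 < 2 * N ^ 2 by positivity), abs_of_nonneg (sq_nonneg (iteratedDeriv 2 u y))]
    have i1 : N ^ 2 * |iteratedDeriv 3 u y| / (N + deriv u y) ^ 2
        ≤ U * (N * deriv u y / (N + deriv u y)) := by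
      rw [mul_div_assoc', div_le_div_iff₀ (by positivity) s]
      calc N ^ 2 * |iteratedDeriv 3 u y| * (N + deriv u y)
          ≤ N ^ 2 * (U * deriv u y) * (N + deriv u y) := by gcongr
        _ = U * (N * deriv u y) * (N * (N + deriv u y)) := by ring
        _ ≤ U * (N * deriv u y) * ((N + deriv u y) * (N + deriv u y)) := by gcongr; linarith
        _ = _ := by ring
    have i2 : 2 * N ^ 2 * iteratedDeriv 2 u y ^ 2 / (N + deriv u y) ^ 3
        ≤ 2 * U ^ 2 * (N * deriv u y / (N + deriv u y)) := by
      rw [mul_div_assoc', div_le_div_iff₀ (by positivity) s]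
      calc 2 * N ^ 2 * iteratedDeriv 2 u y ^ 2 * (N + deriv u y)
          ≤ 2 * N ^ 2 * (U * deriv u y) ^ 2 * (N + deriv u y) := by gcongr
        _ = 2 * U ^ 2 * (N * deriv u y) * (N * deriv u y * (N + deriv u y)) := by ring
        _ ≤ 2 * U ^ 2 * (N * deriv u y)
            * ((N + deriv u y) * (N + deriv u y) * (N + deriv u y)) := by
          gcongr <;> linarith
        _ = _ := by ring
    have i3 : U * (N * deriv u y / (N + deriv u y))
        ≤ U ^ 2 * (N * deriv u y / (N + deriv u y)) := by
      gcongr; nlinarith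
    linarith
  refine ⟨⟨fun y => u 0 + ∫ s in (0 : ℝ)..y, v₁ s,
    continuous_iff_continuousAt.2 fun y => (h1 y).continuousAt⟩, fun h hh hhU => ?_,
    fun R B hB y hy => ?_⟩
  -- The constant 18U² is the 6 of `isDiffShear_of_hasDerivAt` times 3U².
  · have := isDiffShear_of_hasDerivAt (v := ⟨fun y => u 0 + ∫ s in (0 : ℝ)..y, v₁ s,
      continuous_iff_continuousAt.2 fun y => (h1 y).continuousAt⟩) (K := 3 * U ^ 2) (N := N)
      (by positivity) h1 h2 h3 (by positivity) b1 b1' b2 b3 hh (by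
        have : 0 ≤ U ^ 2 * h := by positivity
        linarith)
    convert this using 1
    ring
  · change |u 0 + (∫ s in (0 : ℝ)..y, v₁ s) - u y| ≤ _
    have hd : ∀ z, HasDerivAt (fun y => u 0 + (∫ s in (0 : ℝ)..y, v₁ s) - u y)
        (v₁ z - deriv u z) z := fun z => (h1 z).sub (hu.hasDerivAt z)
    have hb : ∀ z, |z| ≤ R → |v₁ z - deriv u z| ≤ B ^ 2 / N := fun z hz => by
      have p := hp z
      have q := hB z hz
      have e : v₁ z - deriv u z = -(deriv u z ^ 2 / (N + deriv u z)) := by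
        rw [hv1]
        have := hne z
        field_simp
        ring
      rw [e, abs_neg, abs_of_nonneg (by positivity)]
      gcongr
      linarith
    have hR : 0 ≤ R := (abs_nonneg y).trans hy
    have key := (convex_Icc (-R) R).norm_image_sub_le_of_norm_hasDerivWithin_le
      (fun z _ => (hd z).hasDerivWithinAt) (fun z hz => hb z (abs_le.2 hz))
      (x := 0) (y := y) (Set.mem_Icc.2 ⟨by linarith, hR⟩) (abs_le.1 hy)
    simp only [intervalIntegral.integral_same, add_zero, sub_self, sub_zero, Real.norm_eq_abs] at key
    refine key.trans ?_
    calc B ^ 2 / N * |y| ≤ B ^ 2 / N * R := by gcongr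
      _ = _ := by ring

end Admissible

/-! ### Convolution and mollification on L² -/

lemma continuous_trans (g : L2R) : Continuous fun s => trans s g :=
  (continuous_const (y := g)).compMeasurePreservingLp
    (g := fun s : ℝ => (⟨fun y => y + s, by fun_prop⟩ : C(ℝ, ℝ)))
    (ContinuousMap.continuous_of_continuous_uncurry _ (by
      change Continuous fun p : ℝ × ℝ => p.2 + p.1
      fun_prop))
    (fun s => measurePreserving_add_right volume s) (by norm_num)

lemma trans_add (s t : ℝ) (v : L2R) : trans s (trans t v) = trans (s + t) v :=
  (((rep_self v).trans t).trans s).eq (by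
    simpa only [add_assoc] using (rep_self v).trans (s + t))

lemma trans_zero (v : L2R) : trans 0 v = v := ((rep_self v).trans 0).eq (by
    simpa only [add_zero] using rep_self v)

section Conv

variable {ρ ρ' : ℝ → ℝ}

lemma integrable_smul_trans (hρ : Integrable ρ) (g : L2R) :
    Integrable fun s => (ρ s : ℂ) • trans (-s) g :=
  (hρ.ofReal (𝕜 := ℂ)).smul_bdd (f := fun s => trans (-s) g) ‖g‖
    ((continuous_trans g).comp continuous_neg).aestronglyMeasurable
    (Filter.Eventually.of_forall fun s => (norm_trans (-s) g).le)

lemma norm_integral_smul_le {Φ : ℝ → L2R} {E : ℝ} (hρ : Integrable ρ)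
    (h : ∀ s, ρ s ≠ 0 → ‖Φ s‖ ≤ E) : ‖∫ s, (ρ s : ℂ) • Φ s‖ ≤ (∫ s, |ρ s|) * E := by
  rw [← integral_mul_const]
  refine norm_integral_le_of_norm_le (hρ.abs.mul_const E) (Filter.Eventually.of_forall fun s => ?_)
  rw [norm_smul, Complex.norm_real, Real.norm_eq_abs]
  rcases eq_or_ne (ρ s) 0 with h0 | h0
  · simp [h0]
  · exact mul_le_mul_of_nonneg_left (h s h0) (abs_nonneg _)

/-- Convolution with an integrable function on `L²`. -/
noncomputable def conv (hρ : Integrable ρ) : L2R →L[ℂ] L2R :=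
  LinearMap.mkContinuous
    { toFun := fun g => ∫ s, (ρ s : ℂ) • trans (-s) g
      map_add' := fun g g' => by
        simp only [map_add, smul_add]
        exact integral_add (integrable_smul_trans hρ g) (integrable_smul_trans hρ g')
      map_smul' := fun c g => by
        simp only [map_smul, RingHom.id_apply]
        rw [← integral_smul]
        simp only [smul_comm c] }
    (∫ s, |ρ s|) (fun g => norm_integral_smul_le hρ fun s _ => (norm_trans (-s) g).le)

lemma conv_apply (hρ : Integrable ρ) (g : L2R) : conv hρ g = ∫ s, (ρ s : ℂ) • trans (-s) g := rfl

lemma norm_conv_le (hρ : Integrable ρ) (g : L2R) : ‖conv hρ g‖ ≤ (∫ s, |ρ s|) * ‖g‖ :=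
  norm_integral_smul_le hρ fun s _ => (norm_trans (-s) g).le

lemma map_conv (hρ : Integrable ρ) (A : L2R →L[ℂ] L2R) (g : L2R) :
    A (conv hρ g) = ∫ s, (ρ s : ℂ) • A (trans (-s) g) := by
  rw [conv_apply, ← A.integral_comp_comm (integrable_smul_trans hρ g)]
  simp only [map_smul]

lemma trans_conv (hρ : Integrable ρ) (h : ℝ) (g : L2R) :
    trans h (conv hρ g) = conv hρ (trans h g) := by
  rw [map_conv, conv_apply]
  simp only [trans_add, add_comm]

lemma trans_conv_eq (hρ : Integrable ρ) (h : ℝ) (g : L2R) :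
    trans h (conv hρ g) = conv (hρ.comp_add_right h) g := by
  rw [map_conv, conv_apply, ← integral_add_right_eq_self _ h]
  simp only [trans_add, neg_add_rev, add_neg_cancel_left]

lemma diffQuot_conv (hρ : Integrable ρ) (u : C(ℝ, ℝ)) (h h' : ℝ) (g : L2R) :
    diffQuot h (shiftOp u h' 0) (conv hρ g) = conv hρ (diffQuot h (shiftOp u h' 0) g) := by
  simp only [diffQuot_apply, shiftOp_zero, trans_conv, map_smul, map_sub]

lemma covDiff_covDiff_zero (u : C(ℝ, ℝ)) (h : ℝ) (g : L2R) :
    covDiff' u h 0 (covDiff u h 0 g)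
      = (((h ^ 2)⁻¹ : ℝ) : ℂ) • ((2 : ℂ) • g - trans h g - trans (-h) g) := by
  simp only [diffQuot_apply, shiftOp_zero, map_smul, map_sub, trans_neg_trans, ← smul_sub, smul_smul]
  congr 1
  · push_cast; ring
  · rw [two_smul]; abel

/-- Translations can be moved onto the kernel, so the error of the second difference quotient is
itself a convolution, bounded by the L¹ norm of its kernel. The sum on the left is a difference in
disguise: `covDiff'` after `covDiff` is minus the second difference quotient. -/
lemma conv_second_diff (hρ : Integrable ρ) (hρ' : Integrable ρ') (u : C(ℝ, ℝ)) (h : ℝ) (g : L2R) :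
    conv hρ' g + covDiff' u h 0 (covDiff u h 0 (conv hρ g))
      = conv (hρ'.sub (((hρ.comp_add_right h).sub (hρ.const_mul 2)).add
          (hρ.comp_add_right (-h)) |>.const_mul (h ^ 2)⁻¹)) g := by
  rw [covDiff_covDiff_zero, trans_conv_eq, trans_conv_eq]
  simp only [conv_apply]
  have i0 := integrable_smul_trans hρ' g
  have i1 : Integrable fun s => (2 : ℂ) • (ρ s : ℂ) • trans (-s) g :=
    (integrable_smul_trans hρ g).smul (2 : ℂ)
  have i2 := integrable_smul_trans (hρ.comp_add_right h) g
  have i3 := integrable_smul_trans (hρ.comp_add_right (-h)) g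
  have i4 : Integrable fun s => (2 : ℂ) • (ρ s : ℂ) • trans (-s) g - (ρ (s + h) : ℂ) • trans (-s) g :=
    i1.sub i2
  have i5' : Integrable fun s => (2 : ℂ) • (ρ s : ℂ) • trans (-s) g
      - (ρ (s + h) : ℂ) • trans (-s) g - (ρ (s + -h) : ℂ) • trans (-s) g := i4.sub i3
  have i5 : Integrable fun s => (((h ^ 2)⁻¹ : ℝ) : ℂ) • ((2 : ℂ) • (ρ s : ℂ) • trans (-s) g
      - (ρ (s + h) : ℂ) • trans (-s) g - (ρ (s + -h) : ℂ) • trans (-s) g) :=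
    i5'.smul (((h ^ 2)⁻¹ : ℝ) : ℂ)
  rw [← integral_smul, ← integral_sub i1 i2, ← integral_sub i4 i3, ← integral_smul,
    ← integral_add i0 i5]
  congr 1
  ext1 s
  simp only [Pi.sub_apply, Pi.add_apply, smul_smul, ← sub_smul, ← add_smul]
  congr 1
  push_cast
  ring

/-- A smooth probability density supported in `[-δ, δ]`. -/
structure IsMollifier (δ : ℝ) (ρ : ℝ → ℝ) : Prop where
  contDiff : ContDiff ℝ ∞ ρ
  nonneg : ∀ s, 0 ≤ ρ s
  support : ∀ s, ρ s ≠ 0 → |s| ≤ δ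
  integral_eq : ∫ s, ρ s = 1

lemma exists_isMollifier {δ : ℝ} (hδ : 0 < δ) : ∃ ρ, IsMollifier δ ρ := by
  let φ : ContDiffBump (0 : ℝ) := ⟨δ / 2, δ, by linarith, by linarith⟩
  refine ⟨φ.normed volume, φ.contDiff_normed, φ.nonneg_normed, fun s hs => ?_, φ.integral_normed⟩
  have : s ∈ Function.support (φ.normed volume) := hs
  rw [φ.support_normed_eq, mem_ball_zero_iff] at this
  exact this.le

lemma IsMollifier.hasCompactSupport {δ : ℝ} (hρ : IsMollifier δ ρ) : HasCompactSupport ρ :=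
  HasCompactSupport.intro (isCompact_Icc (a := -δ) (b := δ)) fun s hs => by
    by_contra h
    exact hs (abs_le.1 (hρ.support s h))

lemma IsMollifier.integrable {δ : ℝ} (hρ : IsMollifier δ ρ) : Integrable ρ :=
  hρ.contDiff.continuous.integrable_of_hasCompactSupport hρ.hasCompactSupport

lemma IsMollifier.integral_abs {δ : ℝ} (hρ : IsMollifier δ ρ) : ∫ s, |ρ s| = 1 := by
  simp only [abs_of_nonneg (hρ.nonneg _), hρ.integral_eq]

lemma IsMollifier.norm_conv_le {δ : ℝ} (hρ : IsMollifier δ ρ) (g : L2R) :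
    ‖conv hρ.integrable g‖ ≤ ‖g‖ := by
  simpa [hρ.integral_abs] using ShearFlow.norm_conv_le hρ.integrable g

lemma IsMollifier.norm_conv_sub_le {δ E : ℝ} (hρ : IsMollifier δ ρ) (g : L2R)
    (h : ∀ s, |s| ≤ δ → ‖trans (-s) g - g‖ ≤ E) : ‖conv hρ.integrable g - g‖ ≤ E := by
  have e : conv hρ.integrable g - g = ∫ s, (ρ s : ℂ) • (trans (-s) g - g) := by
    have i2 : Integrable fun s => (ρ s : ℂ) • g := hρ.integrable.ofReal.smul_const g
    simp only [smul_sub]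
    rw [integral_sub (integrable_smul_trans hρ.integrable g) i2, integral_smul_const, conv_apply, integral_complex_ofReal,
      hρ.integral_eq, Complex.ofReal_one, one_smul]
  rw [e]
  simpa [hρ.integral_abs] using norm_integral_smul_le hρ.integrable
    fun s hs => h s (hρ.support s hs)

lemma IsMollifier.norm_weightOp_conv_le {δ V : ℝ} (hρ : IsMollifier δ ρ) {w : ℝ →ᵇ ℝ}
    (hw : IsWeight V w) (hV : 0 ≤ V) (g : L2R) :
    ‖weightOp w (conv hρ.integrable g)‖ ≤ Real.exp (V * δ) * ‖weightOp w g‖ := by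
  rw [map_conv]
  have := norm_integral_smul_le (Φ := fun s => weightOp w (trans (-s) g))
    (E := Real.exp (V * δ) * ‖weightOp w g‖) hρ.integrable fun s hs => by
    refine (((rep_self g).trans (-s)).weightOp w).norm_le ((rep_self g).weightOp w) (-s) fun y => ?_
    simp only [norm_mul, Complex.norm_real, Real.norm_eq_abs, abs_of_pos (hw.pos _), ← mul_assoc]
    refine mul_le_mul_of_nonneg_right ?_ (norm_nonneg _)
    have h1 := hw.growth (y + -s) s
    rw [neg_add_cancel_right] at h1
    refine h1.trans (mul_le_mul_of_nonneg_right ?_ (hw.pos _).le)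
    exact Real.exp_le_exp.2 (mul_le_mul_of_nonneg_left (hρ.support s hs) hV)
  simpa [hρ.integral_abs] using this

/-- Taylor's formula, by integrating the bound on ρ''' with respect to the step. -/
lemma exists_third_bound {ρ : ℝ → ℝ} (h : ContDiff ℝ ∞ ρ) (hc : HasCompactSupport ρ) :
    ∃ K, 0 ≤ K ∧ ∀ s h : ℝ, 0 ≤ h →
      |h ^ 2 * deriv (deriv ρ) s - (ρ (s + h) - 2 * ρ s + ρ (s + -h))| ≤ K * h ^ 3 := by
  have h1 : ContDiff ℝ ∞ (deriv ρ) := (contDiff_infty_iff_deriv.1 h).2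
  have h2 : ContDiff ℝ ∞ (deriv (deriv ρ)) := (contDiff_infty_iff_deriv.1 h1).2
  have h3 : ContDiff ℝ ∞ (deriv (deriv (deriv ρ))) := (contDiff_infty_iff_deriv.1 h2).2
  obtain ⟨K, hK⟩ := h3.continuous.bounded_above_of_compact_support hc.deriv.deriv.deriv
  have hd : ∀ {f : ℝ → ℝ}, ContDiff ℝ ∞ f → ∀ y, HasDerivAt f (deriv f y) y := fun hf y =>
    (hf.differentiable (by simp) y).hasDerivAt
  refine ⟨2 * K, mul_nonneg two_pos.le ((norm_nonneg _).trans (hK 0)), fun s a ha => ?_⟩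
  have hK0 : 0 ≤ K := (norm_nonneg _).trans (hK 0)
  have b2 : ∀ r, 0 ≤ r → |2 * deriv (deriv ρ) s
      - (deriv (deriv ρ) (s + r) + deriv (deriv ρ) (s - r))| ≤ 2 * K * r := fun r hr => by
    have i1 := abs_sub_le_of_abs_deriv_le (K := K) (show s ≤ s + r by linarith) (hd h2)
      fun y _ => hK y
    have i2 := abs_sub_le_of_abs_deriv_le (K := K) (show s - r ≤ s by linarith) (hd h2)
      fun y _ => hK y
    rw [abs_le] at *
    constructor <;> linarith [i1.1, i1.2, i2.1, i2.2]
  have b1 : ∀ r, 0 ≤ r → |2 * r * deriv (deriv ρ) s - (deriv ρ (s + r) - deriv ρ (s - r))|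
      ≤ 2 * K * r * r := fun r hr => by
    have e1 : ∀ x, HasDerivAt (fun x => 2 * x * deriv (deriv ρ) s
        - (deriv ρ (s + x) - deriv ρ (s - x))) (2 * deriv (deriv ρ) s
        - (deriv (deriv ρ) (s + x) + deriv (deriv ρ) (s - x))) x := fun x => by
      have := (((hasDerivAt_id x).const_mul 2).mul_const (deriv (deriv ρ) s)).sub
        (((hd h1 (s + x)).comp_const_add s x).sub ((hd h1 (s - x)).comp_const_sub s x))
      refine this.congr_deriv ?_
      ring
    have := abs_sub_le_of_abs_deriv_le (K := 2 * K * r) hr e1 fun y hy => (b2 y hy.1).trans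
      (mul_le_mul_of_nonneg_left hy.2 (by positivity))
    simpa using this
  have e0 : ∀ x, HasDerivAt (fun x => x ^ 2 * deriv (deriv ρ) s
        - (ρ (s + x) - 2 * ρ s + ρ (s - x))) (2 * x * deriv (deriv ρ) s
        - (deriv ρ (s + x) - deriv ρ (s - x))) x := fun x => by
    have := ((hasDerivAt_pow 2 x).mul_const (deriv (deriv ρ) s)).sub
        ((((hd h (s + x)).comp_const_add s x).sub_const (2 * ρ s)).add
          ((hd h (s - x)).comp_const_sub s x))
    refine this.congr_deriv ?_
    norm_num
    ring
  have := abs_sub_le_of_abs_deriv_le (K := 2 * K * a * a) ha e0 fun y hy => (b1 y hy.1).trans (by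
    have := hy.1
    have := hy.2
    gcongr)
  simp only [← sub_eq_add_neg]
  calc _ = |a ^ 2 * deriv (deriv ρ) s - (ρ (s + a) - 2 * ρ s + ρ (s - a)) - (0 ^ 2 * deriv (deriv ρ) s
        - (ρ (s + 0) - 2 * ρ s + ρ (s - 0)))| := by ring_nf
    _ ≤ _ := this
    _ = _ := by ring

lemma IsMollifier.integrable_deriv2 {δ : ℝ} (hρ : IsMollifier δ ρ) :
    Integrable (deriv (deriv ρ)) := by
  have h1 : ContDiff ℝ ∞ (deriv ρ) := (contDiff_infty_iff_deriv.1 hρ.contDiff).2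
  have h2 : ContDiff ℝ ∞ (deriv (deriv ρ)) := (contDiff_infty_iff_deriv.1 h1).2
  exact h2.continuous.integrable_of_hasCompactSupport hρ.hasCompactSupport.deriv.deriv

/-- The kernel of the error is O(h) pointwise and, for h ≤ 1, vanishes outside a fixed interval, so
it is O(h) in L¹. The bound holds on all of L²: no smoothness of g is used. -/
lemma IsMollifier.exists_second_diff_le {δ : ℝ} (hρ : IsMollifier δ ρ) :
    ∃ K, 0 ≤ K ∧ ∀ (u : C(ℝ, ℝ)) (h : ℝ) (g : L2R), 0 < h → h ≤ 1 →
      ‖conv hρ.integrable_deriv2 g + covDiff' u h 0 (covDiff u h 0 (conv hρ.integrable g))‖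
        ≤ K * h * ‖g‖ := by
  obtain ⟨K, hK0, hK⟩ := exists_third_bound hρ.contDiff hρ.hasCompactSupport
  refine ⟨K * (2 * (|δ| + 1)), by positivity, fun u h g hh hh1 => ?_⟩
  rw [conv_second_diff]
  refine (ShearFlow.norm_conv_le _ g).trans (mul_le_mul_of_nonneg_right ?_ (norm_nonneg _))
  have hz : ∀ s, s ∉ Set.Icc (-(|δ| + 1)) (|δ| + 1) → deriv (deriv ρ) s = 0 ∧ ρ (s + h) = 0 ∧
      ρ s = 0 ∧ ρ (s + -h) = 0 := fun s hs => by
    have h0 : ∀ t, |δ| < |t| → ρ t = 0 := fun t ht => by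
      by_contra h
      exact absurd (hρ.support t h) (not_le.2 ((le_abs_self δ).trans_lt ht))
    have h1 : |δ| + 1 < |s| := by
      by_contra h
      exact hs (abs_le.1 (not_lt.1 h))
    have h3 : |h| ≤ 1 := by rwa [abs_of_pos hh]
    refine ⟨?_, h0 _ ?_, h0 _ (by linarith), h0 _ ?_⟩
    · have hev : ρ =ᶠ[nhds s] fun _ => 0 := by
        filter_upwards [(isOpen_lt continuous_const continuous_abs).mem_nhds
          (show |δ| < |s| by linarith)] with t ht using h0 t ht
      rw [hev.deriv.deriv_eq]
      simp
    · have := abs_sub_abs_le_abs_sub s (-h)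
      rw [abs_neg, sub_neg_eq_add] at this
      linarith
    · have := abs_sub_abs_le_abs_sub s h
      rw [sub_eq_add_neg s] at this
      linarith
  have hp : ∀ s, |deriv (deriv ρ) s - (h ^ 2)⁻¹ * (ρ (s + h) - 2 * ρ s + ρ (s + -h))|
      ≤ (Set.Icc (-(|δ| + 1)) (|δ| + 1)).indicator (fun _ => K * h) s := fun s => by
    by_cases hs : s ∈ Set.Icc (-(|δ| + 1)) (|δ| + 1)
    · rw [Set.indicator_of_mem hs]
      have e : deriv (deriv ρ) s - (h ^ 2)⁻¹ * (ρ (s + h) - 2 * ρ s + ρ (s + -h))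
          = (h ^ 2)⁻¹ * (h ^ 2 * deriv (deriv ρ) s - (ρ (s + h) - 2 * ρ s + ρ (s + -h))) := by
        field_simp
      rw [e, abs_mul, abs_of_pos (by positivity), inv_mul_le_iff₀ (by positivity)]
      exact (hK s h hh.le).trans (by ring_nf; rfl)
    · obtain ⟨h1, h2, h3, h4⟩ := hz s hs
      rw [Set.indicator_of_notMem hs, h1, h2, h3, h4]
      simp
  refine (integral_mono_of_nonneg (Filter.Eventually.of_forall fun s => abs_nonneg _)
    ((integrable_indicator_iff measurableSet_Icc).2
      (integrableOn_const (by simp)))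
    (Filter.Eventually.of_forall hp)).trans ?_
  rw [integral_indicator measurableSet_Icc, setIntegral_const]
  simp only [measureReal_def, Real.volume_Icc, smul_eq_mul]
  rw [ENNReal.toReal_ofReal (by linarith [abs_nonneg δ])]
  exact le_of_eq (by ring)

end Conv

section RepConv

open scoped Convolution

variable {ρ : ℝ → ℝ}

lemma inner_conv (hρ : Integrable ρ) (f g : L2R) :
    inner ℂ f (conv hρ g) = ∫ s, (ρ s : ℂ) * inner ℂ f (trans (-s) g) := by
  have := (innerSL ℂ f).integral_comp_comm (integrable_smul_trans hρ g)
  simp only [map_smul, innerSL_apply_apply, smul_eq_mul] at this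
  rw [conv_apply, this]

/-- Identifies the Bochner integral of translates with the pointwise convolution, by pairing with an
arbitrary vector and exchanging the integrals. -/
lemma rep_conv (hρ : Integrable ρ) {g : L2R} {z : ℝ → ℂ} (hz : Rep g z)
    (hm : MemLp (ρ ⋆[ContinuousLinearMap.lsmul ℝ ℝ] z) 2 (volume : Measure ℝ)) :
    Rep (conv hρ g) (ρ ⋆[ContinuousLinearMap.lsmul ℝ ℝ] z) := by
  have h2 : Rep hm.toLp (ρ ⋆[ContinuousLinearMap.lsmul ℝ ℝ] z) := hm.coeFn_toLp
  have hzm : MemLp z 2 (volume : Measure ℝ) := (memLp_congr_ae hz).1 (Lp.memLp g)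
  suffices conv hρ g = hm.toLp by rwa [this]
  refine ext_inner_left ℂ fun f => ?_
  rw [inner_conv, inner_eq_integral (rep_self f) h2]
  have hint : Integrable (fun p : ℝ × ℝ => (starRingEnd ℂ) (f p.1)
      * (ContinuousLinearMap.lsmul ℝ ℝ (ρ p.2) (z (p.1 - p.2)))) (volume.prod volume) := by
    have i1 : Integrable (fun p : ℝ × ℝ => ‖f p.1‖ ^ 2 * |ρ p.2|) (volume.prod volume) :=
      ((Lp.memLp f).integrable_norm_pow (by norm_num)).mul_prod hρ.abs
    have i2 : Integrable (fun p : ℝ × ℝ => |ρ p.2| * ‖z (p.1 - p.2)‖ ^ 2) (volume.prod volume) :=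
      hρ.abs.convolution_integrand (ContinuousLinearMap.mul ℝ ℝ)
        (hzm.integrable_norm_pow (by norm_num))
    refine (i1.add i2).mono' ?_ (Filter.Eventually.of_forall fun p => ?_)
    · exact (Complex.continuous_conj.comp_aestronglyMeasurable
        (Lp.aestronglyMeasurable f).comp_fst).mul
        (hρ.aestronglyMeasurable.convolution_integrand _ hzm.aestronglyMeasurable)
    · simp only [norm_mul, RCLike.norm_conj, ContinuousLinearMap.lsmul_apply, norm_smul,
        Real.norm_eq_abs, Pi.add_apply]
      have := mul_nonneg (abs_nonneg (ρ p.2)) (sq_nonneg (‖f p.1‖ - ‖z (p.1 - p.2)‖))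
      have := mul_nonneg (abs_nonneg (ρ p.2)) (add_nonneg (sq_nonneg ‖f p.1‖)
        (sq_nonneg ‖z (p.1 - p.2)‖))
      linarith
  calc ∫ s, (ρ s : ℂ) * inner ℂ f (trans (-s) g)
      = ∫ s, ∫ y, (starRingEnd ℂ) (f y) * (ContinuousLinearMap.lsmul ℝ ℝ (ρ s) (z (y - s))) := by
        congr 1
        ext1 s
        rw [inner_eq_integral (rep_self f) (hz.trans (-s)), ← integral_const_mul]
        congr 1
        ext1 y
        simp only [ContinuousLinearMap.lsmul_apply, Complex.real_smul, sub_eq_add_neg]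
        ring
    _ = ∫ y, ∫ s, (starRingEnd ℂ) (f y) * (ContinuousLinearMap.lsmul ℝ ℝ (ρ s) (z (y - s))) :=
        (integral_integral_swap hint).symm
    _ = _ := by
        congr 1
        ext1 y
        rw [integral_const_mul]
        rfl

end RepConv

/-! ### Weak solutions of one Fourier mode -/

/-- Test functions on the line. -/
structure IsLineTest (η : ℝ → ℂ) : Prop where
  smooth : ContDiff ℝ ∞ η
  compact : HasCompactSupport η

lemma IsLineTest.deriv {η : ℝ → ℂ} (hη : IsLineTest η) : IsLineTest (deriv η) :=
  ⟨(contDiff_infty_iff_deriv.1 hη.smooth).2, hη.compact.deriv⟩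

lemma IsLineTest.hasDerivAt {η : ℝ → ℂ} (hη : IsLineTest η) (y : ℝ) :
    HasDerivAt η (_root_.deriv η y) y :=
  (hη.smooth.differentiable (by simp) y).hasDerivAt

lemma IsLineTest.exists_rep {η : ℝ → ℂ} (hη : IsLineTest η) {a : ℝ → ℂ} (ha : Continuous a) :
    ∃ e : L2R, Rep e fun y => a y * η y :=
  have h : MemLp (fun y => a y * η y) 2 (volume : Measure ℝ) :=
    (ha.mul hη.smooth.continuous).memLp_of_hasCompactSupport hη.compact.mul_left
  ⟨h.toLp, h.coeFn_toLp⟩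

/-- The dual flow is merely in L²; after cutoff and mollification it may be inserted in the weak
equation. -/
lemma exists_lineTest {δ L : ℝ} {ρ : ℝ → ℝ} (hρ : IsMollifier δ ρ) {χ : ℝ →ᵇ ℝ}
    (hχ : ∀ y, χ y ≠ 0 → |y| ≤ L) (v : L2R) :
    ∃ η, IsLineTest η ∧ Rep (conv hρ.integrable (weightOp χ v)) η ∧
      Rep (conv hρ.integrable_deriv2 (weightOp χ v)) (deriv (deriv η)) ∧
      ∀ y, η y ≠ 0 → |y| ≤ L + δ := by
  open scoped Convolution in
  set z : ℝ → ℂ := fun y => χ y * v y with hz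
  have hr : Rep (weightOp χ v) z := (rep_self v).weightOp χ
  have hzL : ∀ y, z y ≠ 0 → |y| ≤ L := fun y hy => hχ y fun h => hy (by simp [hz, h])
  have hzc : HasCompactSupport z :=
    HasCompactSupport.intro (isCompact_Icc (a := -L) (b := L)) fun s hs => by
      by_contra h
      exact hs (abs_le.1 (hzL s h))
  have hm : MemLp z 2 (volume : Measure ℝ) := (memLp_congr_ae hr).1 (Lp.memLp _)
  have hli : LocallyIntegrable z := hm.locallyIntegrable (by norm_num)
  have hs1 : ContDiff ℝ ∞ (deriv ρ) := (contDiff_infty_iff_deriv.1 hρ.contDiff).2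
  have hs2 : ContDiff ℝ ∞ (deriv (deriv ρ)) := (contDiff_infty_iff_deriv.1 hs1).2
  have key : ∀ {r : ℝ → ℝ}, ContDiff ℝ ∞ r → HasCompactSupport r →
      IsLineTest (r ⋆[ContinuousLinearMap.lsmul ℝ ℝ] z) := fun h1 h2 =>
    ⟨h2.contDiff_convolution_left _ h1 hli, h2.convolution _ hzc⟩
  have hd : ∀ {r : ℝ → ℝ}, ContDiff ℝ ∞ r → HasCompactSupport r →
      deriv (r ⋆[ContinuousLinearMap.lsmul ℝ ℝ] z) = deriv r ⋆[ContinuousLinearMap.lsmul ℝ ℝ] z :=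
    fun h1 h2 => funext fun y =>
      (h2.hasDerivAt_convolution_left _ (h1.of_le (by simp)) hli y).deriv
  have k0 := key hρ.contDiff hρ.hasCompactSupport
  have k2 := key hs2 hρ.hasCompactSupport.deriv.deriv
  refine ⟨ρ ⋆[ContinuousLinearMap.lsmul ℝ ℝ] z, k0, rep_conv _ hr
    (k0.smooth.continuous.memLp_of_hasCompactSupport k0.compact), ?_, fun y hy => ?_⟩
  · rw [hd hρ.contDiff hρ.hasCompactSupport, hd hs1 hρ.hasCompactSupport.deriv]
    exact rep_conv _ hr (k2.smooth.continuous.memLp_of_hasCompactSupport k2.compact)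
  · by_contra hlt
    refine hy (integral_eq_zero_of_ae (Filter.Eventually.of_forall fun t => ?_))
    simp only [ContinuousLinearMap.lsmul_apply, Pi.zero_apply, smul_eq_zero]
    by_contra! h
    have h1 := hρ.support t h.1
    have h2 := hzL _ h.2
    have := abs_add_le (y - t) t
    rw [sub_add_cancel] at this
    linarith

section ModeSol

variable {u : ℝ → ℝ} {κ ν σ : ℝ} {fin : L2R} {f : ℝ → L2R}

/-- The formal adjoint of `-iκu + ν (∂_yy - σ)`. -/
noncomputable def modeAdjoint (u : ℝ → ℝ) (κ ν σ : ℝ) (η : ℝ → ℂ) (y : ℝ) : ℂ :=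
  Complex.I * κ * (u y * η y) + ν * deriv (deriv η) y - ν * σ * η y

/-- `f` is a bounded weak solution of `∂_t f + iκu f = ν (∂_yy - σ) f`, `f(0) = fin`. -/
structure IsModeSol (u : ℝ → ℝ) (κ ν σ : ℝ) (fin : L2R) (f : ℝ → L2R) : Prop where
  bounded : ∀ T, ∃ M, ∀ t ∈ Set.Icc 0 T, ‖f t‖ ≤ M
  integrable : ∀ η a, IsLineTest η → Rep a (modeAdjoint u κ ν σ η) → ∀ t, 0 ≤ t →
    IntervalIntegrable (fun s => inner ℂ a (f s)) volume 0 t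
  weak_eq : ∀ η e a, IsLineTest η → Rep e η → Rep a (modeAdjoint u κ ν σ η) → ∀ t, 0 ≤ t →
    inner ℂ e (f t) = inner ℂ e fin + ∫ s in (0 : ℝ)..t, inner ℂ a (f s)

lemma exists_rep_modeAdjoint (hu : Continuous u) (κ ν σ : ℝ) {η : ℝ → ℂ} (hη : IsLineTest η) :
    ∃ a : L2R, Rep a (modeAdjoint u κ ν σ η) := by
  obtain ⟨e1, h1⟩ := hη.exists_rep (a := fun y => Complex.I * κ * u y - ν * σ) (by fun_prop)
  obtain ⟨e2, h2⟩ := hη.deriv.deriv.exists_rep (a := fun _ => (ν : ℂ)) (by fun_prop)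
  exact ⟨e1 + e2, (h1.add h2).congr fun y => by simp only [modeAdjoint]; ring⟩

/-- Weak continuity in time. For test functions the weak equation writes the pairing as a primitive;
the general case is a uniform limit, by density and the bound on ‖f‖. -/
lemma IsModeSol.continuousOn (hf : IsModeSol u κ ν σ fin f) (hu : Continuous u) (T : ℝ) (e : L2R) :
    ContinuousOn (fun s => inner ℂ e (f s)) (Set.Icc 0 T) := by
  rcases lt_or_ge T 0 with hT | hT
  · simp [Set.Icc_eq_empty (not_le.2 hT)]
  obtain ⟨M, hM⟩ := hf.bounded T
  refine continuousOn_of_uniform_approx_of_continuousOn fun U hU => ?_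
  obtain ⟨ε, hε, hεU⟩ := Metric.mem_uniformity_dist.1 hU
  have hd : Dense {f : L2R | ∃ g : ℝ → ℂ, f =ᵐ[volume] g ∧ HasCompactSupport g ∧ ContDiff ℝ ∞ g} :=
    Lp.dense_hasCompactSupport_contDiff (by norm_num)
  obtain ⟨e', h4, η, h1, h2, h3⟩ := Metric.dense_iff.1 hd e (ε / (|M| + 1)) (by positivity)
  obtain ⟨a, ha⟩ := exists_rep_modeAdjoint hu κ ν σ ⟨h3, h2⟩
  refine ⟨fun s => inner ℂ e' (f s), ?_, fun s hs => hεU ?_⟩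
  · have hc := intervalIntegral.continuousOn_primitive_interval'
      (hf.integrable η a ⟨h3, h2⟩ ha T hT) Set.left_mem_uIcc
    rw [Set.uIcc_of_le hT] at hc
    exact (hc.const_add (inner ℂ e' fin)).congr fun s hs =>
      hf.weak_eq η e' a ⟨h3, h2⟩ h1 ha s hs.1
  · rw [dist_eq_norm, ← inner_sub_left]
    rw [mem_ball_iff_norm'] at h4
    calc ‖inner ℂ (e - e') (f s)‖ ≤ ‖e - e'‖ * ‖f s‖ := norm_inner_le_norm _ _
      _ ≤ ‖e - e'‖ * (|M| + 1) := by
        gcongr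
        linarith [hM s hs, le_abs_self M]
      _ < ε := by rwa [← lt_div_iff₀ (by positivity)]

lemma IsModeSol.hasDerivWithinAt (hf : IsModeSol u κ ν σ fin f) (hu : Continuous u) {η : ℝ → ℂ}
    {e a : L2R} (hη : IsLineTest η) (he : Rep e η) (ha : Rep a (modeAdjoint u κ ν σ η)) {T s : ℝ}
    (hs : s ∈ Set.Icc 0 T) :
    HasDerivWithinAt (fun s => inner ℂ e (f s)) (inner ℂ a (f s)) (Set.Icc 0 T) s := by
  have : Fact (s ∈ Set.Icc 0 T) := ⟨hs⟩
  have hc := hf.continuousOn hu T a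
  have h1 := intervalIntegral.integral_hasDerivWithinAt_right (s := Set.Icc 0 T) (t := Set.Icc 0 T)
    (hf.integrable η a hη ha s hs.1) (hc.stronglyMeasurableAtFilter_nhdsWithin measurableSet_Icc s)
    (hc s hs)
  exact (h1.const_add (inner ℂ e fin)).congr (fun r hr => hf.weak_eq η e a hη he ha r hr.1)
    (hf.weak_eq η e a hη he ha s hs.1)

/-- A product rule in which only x is differentiable in norm, while f is bounded and weakly
continuous. -/
lemma hasDerivWithinAt_inner_moving {x f : ℝ → L2R} {x' : L2R} {S : Set ℝ} {s M : ℝ} {d : ℂ}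
    (hx : HasDerivWithinAt x x' S s) (hM : ∀ r ∈ S, ‖f r‖ ≤ M)
    (hc : ContinuousWithinAt (fun r => inner ℂ x' (f r)) S s)
    (hd : HasDerivWithinAt (fun r => inner ℂ (x s) (f r)) d S s) :
    HasDerivWithinAt (fun r => inner ℂ (x r) (f r)) (inner ℂ x' (f s) + d) S s := by
  have h1 : HasDerivWithinAt (fun r => inner ℂ (x r - x s - (r - s) • x') (f r)) 0 S s := by
    rw [hasDerivWithinAt_iff_isLittleO]
    simp only [sub_self, zero_smul, inner_zero_left, sub_zero, smul_zero]
    refine Asymptotics.IsBigO.trans_isLittleO (Asymptotics.IsBigO.of_bound M ?_)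
      (hasDerivWithinAt_iff_isLittleO.1 hx)
    filter_upwards [self_mem_nhdsWithin] with r hr
    rw [mul_comm]
    exact (norm_inner_le_norm _ _).trans (mul_le_mul_of_nonneg_left (hM r hr) (norm_nonneg _))
  have h2 : HasDerivWithinAt (fun r => ((r - s : ℝ) : ℂ) * inner ℂ x' (f r)) (inner ℂ x' (f s)) S s := by
    rw [hasDerivWithinAt_iff_isLittleO]
    have h3 : (fun r => inner ℂ x' (f r) - inner ℂ x' (f s)) =o[nhdsWithin s S]
        (fun _ => (1 : ℝ)) := by
      rw [Asymptotics.isLittleO_one_iff]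
      simpa using hc.sub_const (inner ℂ x' (f s))
    have h4 := (Asymptotics.isBigO_refl (fun r : ℝ => r - s) (nhdsWithin s S)).smul_isLittleO h3
    simp only [smul_eq_mul, mul_one] at h4
    refine h4.congr_left fun r => ?_
    rw [sub_self, Complex.ofReal_zero, zero_mul, sub_zero, Complex.real_smul, Complex.real_smul,
      mul_sub]
  refine ((h1.add h2).add hd).congr_deriv (by ring) |>.congr (fun r _ => ?_) ?_
  · have e : (r - s) • x' = ((r - s : ℝ) : ℂ) • x' := (Complex.coe_smul _ _).symm
    simp only [Pi.add_apply, e, inner_sub_left, inner_smul_left, Complex.conj_ofReal]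
    ring
  · simp

end ModeSol

/-! ### Cutoffs -/

/-- A cutoff supported in `[-L, L]` with first and second differences bounded by `c`. -/
structure IsCutoff (c L : ℝ) (χ : ℝ →ᵇ ℝ) : Prop where
  nonneg : ∀ y, 0 ≤ χ y
  le_one : ∀ y, χ y ≤ 1
  support : ∀ y, χ y ≠ 0 → |y| ≤ L
  first : ∀ y h, |χ (y + h) - χ y| ≤ c * |h|
  second : ∀ y h, |χ (y + h) + χ (y + -h) - 2 * χ y| ≤ c * h ^ 2

lemma exists_isCutoff {c : ℝ} (hc : 0 < c) (R : ℝ) :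
    ∃ L χ, 0 < L ∧ IsCutoff c L χ ∧ ∀ y, |y| ≤ R → χ y = 1 := by
  let φ : ContDiffBump (0 : ℝ) := ⟨1, 2, by norm_num, by norm_num⟩
  have h0 : ContDiff ℝ ∞ φ := φ.contDiff
  have h1 : ContDiff ℝ ∞ (deriv φ) := (contDiff_infty_iff_deriv.1 h0).2
  have h2 : ContDiff ℝ ∞ (deriv (deriv φ)) := (contDiff_infty_iff_deriv.1 h1).2
  have hd : ∀ {f : ℝ → ℝ}, ContDiff ℝ ∞ f → ∀ y, HasDerivAt f (deriv f y) y := fun hf y =>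
    (hf.differentiable (by simp) y).hasDerivAt
  obtain ⟨K₁, hK₁⟩ := h1.continuous.bounded_above_of_compact_support φ.hasCompactSupport.deriv
  obtain ⟨K₂, hK₂⟩ := h2.continuous.bounded_above_of_compact_support φ.hasCompactSupport.deriv.deriv
  have hp1 : 0 ≤ K₁ := (norm_nonneg _).trans (hK₁ 0)
  have hp2 : 0 ≤ K₂ := (norm_nonneg _).trans (hK₂ 0)
  have first : ∀ y h, |φ (y + h) - φ y| ≤ K₁ * |h| := fun y h => by
    have := convex_univ.norm_image_sub_le_of_norm_hasDerivWithin_le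
      (fun y _ => (hd h0 y).hasDerivWithinAt) (fun y _ => hK₁ y) (Set.mem_univ y)
      (Set.mem_univ (y + h))
    simpa using this
  have first' : ∀ y h, |deriv φ (y + h) - deriv φ y| ≤ K₂ * |h| := fun y h => by
    have := convex_univ.norm_image_sub_le_of_norm_hasDerivWithin_le
      (fun y _ => (hd h1 y).hasDerivWithinAt) (fun y _ => hK₂ y) (Set.mem_univ y)
      (Set.mem_univ (y + h))
    simpa using this
  have second : ∀ y h, 0 ≤ h → |φ (y + h) + φ (y - h) - 2 * φ y| ≤ 2 * K₂ * h ^ 2 := fun y h hh => by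
    have e0 : ∀ x, HasDerivAt (fun x => φ (y + x) + φ (y - x))
        (deriv φ (y + x) + -deriv φ (y - x)) x := fun x =>
      ((hd h0 (y + x)).comp_const_add y x).add ((hd h0 (y - x)).comp_const_sub y x)
    have := abs_sub_le_of_abs_deriv_le (K := 2 * K₂ * h) hh e0 fun x hx => by
      have := first' (y - x) (2 * x)
      rw [show y - x + 2 * x = y + x by ring, abs_of_nonneg (show 0 ≤ 2 * x by linarith [hx.1])] at this
      rw [← sub_eq_add_neg]
      refine this.trans ?_
      have := mul_le_mul_of_nonneg_left hx.2 hp2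
      linarith
    simp only [add_zero, sub_zero] at this
    calc _ = |φ (y + h) + φ (y - h) - (φ y + φ y)| := by ring_nf
      _ ≤ _ := this
      _ = _ := by ring
  -- Stretching a bump by l divides its first and second differences by l and l². The summands make
  -- the plateau contain [-R, R] and each difference bound at most c.
  set l : ℝ := 1 + |R| + K₁ / c + 2 * K₂ / c with hl
  have hl1 : 1 ≤ l := by
    have : 0 ≤ |R| + K₁ / c + 2 * K₂ / c := by positivity
    linarith
  have hlR : |R| ≤ l := by
    have : 0 ≤ 1 + K₁ / c + 2 * K₂ / c := by positivity
    linarith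
  have hlK₁ : K₁ ≤ c * l := by
    have : K₁ / c ≤ l := by
      have : 0 ≤ 1 + |R| + 2 * K₂ / c := by positivity
      linarith
    rwa [div_le_iff₀ hc, mul_comm] at this
  have hlK₂ : 2 * K₂ ≤ c * l := by
    have : 2 * K₂ / c ≤ l := by
      have : 0 ≤ 1 + |R| + K₁ / c := by positivity
      linarith
    rwa [div_le_iff₀ hc, mul_comm l] at this
  have hl0 : 0 < l := by linarith
  refine ⟨2 * l, BoundedContinuousFunction.ofNormedAddCommGroup (fun y => φ (y / l))
    (φ.continuous.comp (continuous_id.div_const l)) 1 (fun y => ?_), by positivity,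
    ⟨fun y => φ.nonneg, fun y => φ.le_one, fun y hy => ?_, fun y h => ?_, fun y h => ?_⟩,
    fun y hy => ?_⟩
  · rw [Real.norm_eq_abs, abs_of_nonneg φ.nonneg]
    exact φ.le_one
  · have : y / l ∈ Function.support φ := hy
    rw [φ.support_eq, mem_ball_zero_iff, Real.norm_eq_abs, abs_div, abs_of_pos hl0,
      div_lt_iff₀ hl0] at this
    exact this.le
  · change |φ ((y + h) / l) - φ (y / l)| ≤ _
    rw [add_div]
    refine (first _ _).trans ?_
    rw [abs_div, abs_of_pos hl0, mul_div_assoc', div_le_iff₀ hl0]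
    calc K₁ * |h| ≤ c * l * |h| := by gcongr
      _ = _ := by ring
  · change |φ ((y + h) / l) + φ ((y + -h) / l) - 2 * φ (y / l)| ≤ _
    have key : |φ (y / l + |h| / l) + φ (y / l - |h| / l) - 2 * φ (y / l)| ≤ c * h ^ 2 := by
      refine (second _ _ (by positivity)).trans ?_
      rw [div_pow, sq_abs, mul_div_assoc', div_le_iff₀ (by positivity)]
      calc 2 * K₂ * h ^ 2 ≤ c * l * h ^ 2 := by gcongr
        _ ≤ c * (l * l) * h ^ 2 := by gcongr; nlinarith
        _ = _ := by ring
    rw [add_div, add_div, neg_div]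
    rcases abs_choice h with e | e
    · rwa [e, sub_eq_add_neg] at key
    · rw [e, neg_div, sub_neg_eq_add, add_comm (φ (y / l + -(h / l)))] at key
      exact key
  · refine φ.one_of_mem_closedBall ?_
    rw [mem_closedBall_zero_iff, Real.norm_eq_abs, abs_div, abs_of_pos hl0, div_le_one hl0]
    exact (hy.trans (le_abs_self R)).trans hlR

section Cutoff

variable {c L h : ℝ} {χ : ℝ →ᵇ ℝ}

lemma norm_weightOp_le_of_le_one {w : ℝ →ᵇ ℝ} (h0 : ∀ y, 0 ≤ w y) (h1 : ∀ y, w y ≤ 1) (g : L2R) :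
    ‖weightOp w g‖ ≤ ‖g‖ := by
  simpa using ((rep_self g).weightOp w).norm_le (rep_self g) (c := 1) 0 fun y => by
    rw [norm_mul, Complex.norm_real, Real.norm_eq_abs, abs_of_nonneg (h0 y), add_zero]
    exact mul_le_mul_of_nonneg_right (h1 y) (norm_nonneg _)

lemma IsCutoff.norm_weightOp_le (hχ : IsCutoff c L χ) (g : L2R) : ‖weightOp χ g‖ ≤ ‖g‖ :=
  norm_weightOp_le_of_le_one hχ.nonneg hχ.le_one g

lemma weightOp_comm (w w' : ℝ →ᵇ ℝ) (g : L2R) :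
    weightOp w (weightOp w' g) = weightOp w' (weightOp w g) :=
  (((rep_self g).weightOp w').weightOp w).eq
    ((((rep_self g).weightOp w).weightOp w').congr fun y => by ring)

lemma IsCutoff.norm_shift_sub_le (hχ : IsCutoff c L χ) (h : ℝ) (g : L2R) :
    ‖weightOpShift χ h g - weightOp χ g‖ ≤ c * |h| * ‖g‖ :=
  (((rep_self g).weightOpShift χ h).sub ((rep_self g).weightOp χ)).norm_le (rep_self g) 0 fun y => by
    rw [← sub_mul, norm_mul, add_zero, ← Complex.ofReal_sub, Complex.norm_real]
    exact mul_le_mul_of_nonneg_right (hχ.first y h) (norm_nonneg _)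

lemma trans_weightOp (w : ℝ →ᵇ ℝ) (h : ℝ) (g : L2R) :
    trans h (weightOp w g) = weightOpShift w h (trans h g) := by
  simp only [weightOpShift, mul_apply_eq_comp, trans_neg_trans]

lemma norm_trans_sub (hh : 0 < h) (u : C(ℝ, ℝ)) (g : L2R) :
    ‖trans h g - g‖ = h * ‖covDiff u h 0 g‖ := by
  rw [diffQuot_apply, shiftOp_zero, norm_smul, Complex.norm_real, Real.norm_eq_abs, abs_inv,
    abs_of_pos hh, mul_inv_cancel_left₀ hh.ne']

lemma norm_trans_neg_sub (h : ℝ) (g : L2R) : ‖trans (-h) g - g‖ = ‖trans h g - g‖ := by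
  rw [← norm_trans h, map_sub, trans_trans_neg, norm_sub_rev]

/-- The discrete form of [χ, ∂_yy] = -2χ'∂_y - χ'': T₁ and T₂ pair a first difference of χ with one
of g, and T₃ is the second difference of χ. -/
lemma IsCutoff.norm_comm_le (hχ : IsCutoff c L χ) (hh : 0 < h) (u : C(ℝ, ℝ)) (g : L2R) :
    ‖weightOp χ (covDiff' u h 0 (covDiff u h 0 g)) - covDiff' u h 0 (covDiff u h 0 (weightOp χ g))‖
      ≤ c * (2 * ‖covDiff u h 0 g‖ + ‖g‖) := by
  set T₁ := weightOpShift χ h (trans h g - g) - weightOp χ (trans h g - g)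
  set T₂ := weightOpShift χ (-h) (trans (-h) g - g) - weightOp χ (trans (-h) g - g)
  set T₃ := weightOpShift χ h g + weightOpShift χ (-h) g - (2 : ℂ) • weightOp χ g
  have e : weightOp χ (covDiff' u h 0 (covDiff u h 0 g))
      - covDiff' u h 0 (covDiff u h 0 (weightOp χ g))
      = (((h ^ 2)⁻¹ : ℝ) : ℂ) • (T₁ + T₂ + T₃) := by
    rw [covDiff_covDiff_zero, covDiff_covDiff_zero, map_smul, ← smul_sub]
    congr 1
    simp only [T₁, T₂, T₃, map_sub, map_add, trans_weightOp, two_smul]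
    abel
  have hn := norm_trans_sub hh u g
  have b1 : ‖T₁‖ ≤ c * h * (h * ‖covDiff u h 0 g‖) := by
    have := hχ.norm_shift_sub_le h (trans h g - g)
    rwa [abs_of_pos hh, hn] at this
  have b2 : ‖T₂‖ ≤ c * h * (h * ‖covDiff u h 0 g‖) := by
    have := hχ.norm_shift_sub_le (-h) (trans (-h) g - g)
    rwa [abs_neg, abs_of_pos hh, norm_trans_neg_sub, hn] at this
  have b3 : ‖T₃‖ ≤ c * h ^ 2 * ‖g‖ :=
    ((((rep_self g).weightOpShift χ h).add ((rep_self g).weightOpShift χ (-h))).sub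
      (((rep_self g).weightOp χ).smul 2)).norm_le (rep_self g) 0 fun y => by
        have e2 : χ (y + h) * g y + χ (y + -h) * g y - 2 * (χ y * g y)
          = ((χ (y + h) + χ (y + -h) - 2 * χ y : ℝ) : ℂ) * g y := by push_cast; ring
        rw [e2, norm_mul, add_zero, Complex.norm_real]
        exact mul_le_mul_of_nonneg_right (hχ.second y h) (norm_nonneg _)
  rw [e, norm_smul, Complex.norm_real, Real.norm_eq_abs, abs_of_pos (by positivity),
    inv_mul_le_iff₀ (by positivity)]
  have := norm_add₃_le (a := T₁) (b := T₂) (c := T₃)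
  calc _ ≤ _ := this
    _ ≤ c * h * (h * ‖covDiff u h 0 g‖) + c * h * (h * ‖covDiff u h 0 g‖) + c * h ^ 2 * ‖g‖ := by
      gcongr
    _ = _ := by ring

lemma IsCutoff.norm_covDiff'_comm_le (hχ : IsCutoff c L χ) (hh : 0 < h) (u : C(ℝ, ℝ)) (g : L2R) :
    ‖weightOp χ (covDiff' u h 0 g) - covDiff' u h 0 (weightOp χ g)‖ ≤ c * ‖g‖ := by
  have e : weightOp χ (covDiff' u h 0 g) - covDiff' u h 0 (weightOp χ g)
      = ((h⁻¹ : ℝ) : ℂ) • -(weightOpShift χ (-h) (trans (-h) g) - weightOp χ (trans (-h) g)) := by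
    simp only [diffQuot_apply, shiftOp_zero, map_smul, map_sub, trans_weightOp, ← smul_sub]
    congr 1
    abel
  have := hχ.norm_shift_sub_le (-h) (trans (-h) g)
  rw [norm_trans, abs_neg, abs_of_pos hh] at this
  rw [e, norm_smul, norm_neg, Complex.norm_real, Real.norm_eq_abs, abs_of_pos (by positivity),
    inv_mul_le_iff₀ hh]
  linarith

end Cutoff

/-! ### Duality between weak solutions and the discrete flow -/

/-- The bounded function `u(max(-L, min(L, y)))`. -/
noncomputable def clampBC (u : C(ℝ, ℝ)) (L : ℝ) (hL : 0 ≤ L) : ℝ →ᵇ ℝ :=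
  (BoundedContinuousFunction.mkOfCompact (u.restrict (Set.Icc (-L) L))).compContinuous
    ⟨Set.projIcc (-L) L (by linarith), continuous_projIcc⟩

lemma clampBC_apply (u : C(ℝ, ℝ)) {L : ℝ} (hL : 0 ≤ L) {y : ℝ} (hy : |y| ≤ L) :
    clampBC u L hL y = u y := by
  change u (Set.projIcc (-L) L (by linarith) y : ℝ) = u y
  rw [Set.projIcc_of_mem _ (abs_le.1 hy)]

/-- The phase is differentiable in operator norm because a is bounded. Unbounded shears are
therefore clamped outside the support of the cutoff. -/
lemma hasDerivAt_phaseOp (a : ℝ →ᵇ ℝ) (s : ℝ) :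
    HasDerivAt (fun s => (phaseOp a.toContinuousMap s).restrictScalars ℝ)
      ((Complex.I • (weightOp a * phaseOp a.toContinuousMap s)).restrictScalars ℝ) s := by
  rw [hasDerivAt_iff_isLittleO_nhds_zero]
  refine Asymptotics.IsBigO.trans_isLittleO (g := fun r : ℝ => r ^ 2)
    (Asymptotics.IsBigO.of_bound (‖a‖ ^ 2) ?_) (Asymptotics.isLittleO_pow_id one_lt_two)
  have : Filter.Tendsto (fun r : ℝ => |r| * ‖a‖) (nhds 0) (nhds 0) := by
    have : Continuous fun r : ℝ => |r| * ‖a‖ := by fun_prop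
    simpa using this.tendsto 0
  filter_upwards [this.eventually_le_const one_pos] with r hr
  refine ContinuousLinearMap.opNorm_le_bound _ (by positivity) fun v => ?_
  have h1 := (((rep_self v).phaseOp a.toContinuousMap (s + r)).sub
    ((rep_self v).phaseOp a.toContinuousMap s)).sub
    (((((rep_self v).phaseOp a.toContinuousMap s).weightOp a).smul Complex.I).smul r)
  refine h1.norm_le (rep_self v) 0 fun y => ?_
  have h2 : |r * a y| ≤ 1 := by
    rw [abs_mul]
    exact (mul_le_mul_of_nonneg_left (a.norm_coe_le_norm y) (abs_nonneg r)).trans hr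
  have e : cis ((s + r) * a.toContinuousMap y) * v y - cis (s * a.toContinuousMap y) * v y
      - r * (Complex.I * (a y * (cis (s * a.toContinuousMap y) * v y)))
      = cis (s * a y) * (cis (r * a y) - 1 - ((r * a y : ℝ) : ℂ) * Complex.I) * v y := by
    change cis ((s + r) * a y) * v y - cis (s * a y) * v y
      - r * (Complex.I * (a y * (cis (s * a y) * v y))) = _
    rw [add_mul, cis_add]
    push_cast
    ring
  rw [e, norm_mul, norm_mul, norm_cis, one_mul, add_zero]
  refine mul_le_mul_of_nonneg_right ((norm_cis_sub_one_sub_le h2).trans ?_) (norm_nonneg _)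
  rw [Real.norm_eq_abs, abs_of_nonneg (sq_nonneg r), mul_pow, mul_comm]
  refine mul_le_mul_of_nonneg_right ?_ (sq_nonneg r)
  exact sq_le_sq' (by linarith [abs_le.1 (a.norm_coe_le_norm y), norm_nonneg a,
    (abs_le.1 (a.norm_coe_le_norm y)).1]) ((le_abs_self _).trans (a.norm_coe_le_norm y))

section Dual

variable {u v : C(ℝ, ℝ)} {κ ν σ c L δ E K M h t : ℝ} {χ : ℝ →ᵇ ℝ} {ρ : ℝ → ℝ} {fin : L2R}
  {f G : ℝ → L2R}

/-- Cut off, then mollify. -/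
noncomputable def smoothCut (hρ : IsMollifier δ ρ) (χ : ℝ →ᵇ ℝ) : L2R →L[ℂ] L2R :=
  conv hρ.integrable * weightOp χ

lemma smoothCut_apply (hρ : IsMollifier δ ρ) (χ : ℝ →ᵇ ℝ) (g : L2R) :
    smoothCut hρ χ g = conv hρ.integrable (weightOp χ g) := rfl

/-- Moving the mollifier past the shear and replacing u by v costs, pointwise, a value |u(y+s) -
v(y)| with y in the support of the cutoff and |s| ≤ δ. -/
lemma norm_shear_comm_le (hρ : IsMollifier δ ρ) (hδ : δ ≤ 1) (hχ : IsCutoff c L χ) (hL : 0 ≤ L)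
    (hE : ∀ y s, |y| ≤ L → |s| ≤ δ → |u (y + s) - v y| ≤ E) (g : L2R) :
    ‖weightOp (clampBC u (L + 1) (by linarith)) (smoothCut hρ χ g)
      - smoothCut hρ χ (weightOp (clampBC v L hL) g)‖ ≤ E * ‖g‖ := by
  set a := clampBC u (L + 1) (by linarith)
  set b := clampBC v L hL
  have i1 : Integrable fun s => (ρ s : ℂ) • weightOp a (trans (-s) (weightOp χ g)) := by
    simpa only [map_smul] using
      (weightOp a).integrable_comp (integrable_smul_trans hρ.integrable (weightOp χ g))
  have i2 := integrable_smul_trans hρ.integrable (weightOp χ (weightOp b g))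
  rw [smoothCut_apply, smoothCut_apply, map_conv, conv_apply, ← integral_sub i1 i2]
  simp only [← smul_sub]
  have := norm_integral_smul_le (Φ := fun s => weightOp a (trans (-s) (weightOp χ g))
    - trans (-s) (weightOp χ (weightOp b g))) (E := E * ‖g‖) hρ.integrable fun s hs => by
      refine (((((rep_self g).weightOp χ).trans (-s)).weightOp a).sub
        ((((rep_self g).weightOp b).weightOp χ).trans (-s))).norm_le (rep_self g) (-s) fun y => ?_
      have e : (a y : ℂ) * (χ (y + -s) * g (y + -s)) - χ (y + -s) * (b (y + -s) * g (y + -s))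
          = (((a y - b (y + -s)) * χ (y + -s) : ℝ) : ℂ) * g (y + -s) := by push_cast; ring
      rw [e, norm_mul, Complex.norm_real, Real.norm_eq_abs]
      refine mul_le_mul_of_nonneg_right ?_ (norm_nonneg _)
      have hs' := hρ.support s hs
      by_cases h0 : χ (y + -s) = 0
      · have h1 := hE 0 s (by simpa using hL) hs'
        rw [h0, mul_zero, abs_zero]
        exact (abs_nonneg _).trans h1
      · have h1 := hχ.support _ h0
        have h2 : |y| ≤ L + 1 := by
          have := abs_add_le (y + -s) s
          rw [neg_add_cancel_right] at this
          linarith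
        have h3 := hE _ s h1 hs'
        rw [neg_add_cancel_right] at h3
        rw [abs_mul, abs_of_nonneg (hχ.nonneg _)]
        change |clampBC u (L + 1) _ y - clampBC v L hL (y + -s)| * _ ≤ _
        rw [clampBC_apply u _ h2, clampBC_apply v _ h1]
        exact (mul_le_of_le_one_right (abs_nonneg _) (hχ.le_one _)).trans h3
  simpa [hρ.integral_abs] using this

lemma weightOp_phaseOp_clampBC (hχ : IsCutoff c L χ) (hL : 0 ≤ L) (s : ℝ) (g : L2R) :
    weightOp χ (phaseOp (clampBC v L hL).toContinuousMap s g) = weightOp χ (phaseOp v s g) := by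
  refine (((rep_self g).phaseOp _ s).weightOp χ).eq
    ((((rep_self g).phaseOp v s).weightOp χ).congr fun y => ?_)
  by_cases h0 : χ y = 0
  · simp [h0]
  · change _ = (χ y : ℂ) * (cis (s * clampBC v L hL y) * g y)
    rw [clampBC_apply v hL (hχ.support y h0)]

lemma hasDerivWithinAt_smoothCut (hρ : IsMollifier δ ρ) (hχ : IsCutoff c L χ) (hL : 0 ≤ L)
    (hG : IsFlow v (-κ) ν h t G) {r : ℝ} (hr : r ∈ Set.Icc 0 t) :
    HasDerivWithinAt (fun r => smoothCut hρ χ (phaseOp v (κ * r) (G r)))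
      (smoothCut hρ χ ((Complex.I * κ) • weightOp (clampBC v L hL) (phaseOp v (κ * r) (G r))
        - (ν : ℂ) • covDiff' v h 0 (covDiff v h 0 (phaseOp v (κ * r) (G r))))) (Set.Icc 0 t) r := by
  set a := clampBC v L hL
  have h1 : HasDerivWithinAt (fun r => (phaseOp a.toContinuousMap (κ * r)).restrictScalars ℝ) _
      (Set.Icc 0 t) r :=
    ((hasDerivAt_phaseOp a (κ * r)).scomp r ((hasDerivAt_id r).const_mul κ)).hasDerivWithinAt
  have h2 := h1.clm_apply (hG r hr)
  have h3 := ((smoothCut hρ χ).restrictScalars ℝ).hasFDerivAt.comp_hasDerivWithinAt r h2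
  have e : ∀ s g, smoothCut hρ χ (phaseOp a.toContinuousMap s g)
      = smoothCut hρ χ (phaseOp v s g) := fun s g => by
    rw [smoothCut_apply, smoothCut_apply, weightOp_phaseOp_clampBC hχ]
  have e' : ∀ s g, smoothCut hρ χ (weightOp a (phaseOp a.toContinuousMap s g))
      = smoothCut hρ χ (weightOp a (phaseOp v s g)) := fun s g => by
    rw [smoothCut_apply, smoothCut_apply, weightOp_comm, weightOp_phaseOp_clampBC hχ, weightOp_comm]
  refine (h3.congr_deriv ?_).congr (fun r _ => ?_) ?_
  · have e2 : covDiff' v h 0 (covDiff v h 0 (phaseOp v (κ * r) (G r)))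
        = phaseOp v (κ * r) (covDiff' v h (-κ * r) (covDiff v h (-κ * r) (G r))) := by
      rw [covDiff, covDiff', diffQuot_phaseOp, diffQuot_phaseOp]
      ring_nf
    rw [e2]
    simp only [ContinuousLinearMap.coe_restrictScalars', mul_one, ContinuousLinearMap.restrictScalars_smul,
      map_add, map_sub, map_smul, map_neg, smul_apply, mul_apply_eq_comp, e, e']
    rw [← sub_eq_add_neg, mul_comm Complex.I, mul_smul]
    rfl
  · simp only [Function.comp_apply, ContinuousLinearMap.coe_restrictScalars', e]
  · simp only [Function.comp_apply, ContinuousLinearMap.coe_restrictScalars', e]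

/-- How far the smoothed dual flow is from solving the true adjoint equation. The three errors are
the mismatch of the shears (E), the second difference quotient in place of ∂_yy (K), and the
commutator with the cutoff (c). -/
lemma norm_adjoint_sub_le (hρ : IsMollifier δ ρ) (hδ : δ ≤ 1) (hχ : IsCutoff c L χ) (hL : 0 ≤ L)
    (hE : ∀ y s, |y| ≤ L → |s| ≤ δ → |u (y + s) - v y| ≤ E) (hν : 0 ≤ ν) (hh : 0 < h) 
    (hK : ∀ g, ‖conv hρ.integrable_deriv2 g + covDiff' v h 0 (covDiff v h 0 (conv hρ.integrable g))‖
        ≤ K * ‖g‖) (hK0 : 0 ≤ K) (g : L2R) :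
    ‖((Complex.I * κ) • weightOp (clampBC u (L + 1) (by linarith)) (smoothCut hρ χ g)
        + (ν : ℂ) • conv hρ.integrable_deriv2 (weightOp χ g))
      - smoothCut hρ χ ((Complex.I * κ) • weightOp (clampBC v L hL) g
        - (ν : ℂ) • covDiff' v h 0 (covDiff v h 0 g))‖
      ≤ (|κ| * E + ν * K + ν * c) * ‖g‖ + 2 * ν * c * ‖covDiff v h 0 g‖ := by
  set A := weightOp (clampBC u (L + 1) (by linarith)) (smoothCut hρ χ g)
      - smoothCut hρ χ (weightOp (clampBC v L hL) g)
  set B := conv hρ.integrable_deriv2 (weightOp χ g)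
    + covDiff' v h 0 (covDiff v h 0 (conv hρ.integrable (weightOp χ g)))
  set C := conv hρ.integrable (weightOp χ (covDiff' v h 0 (covDiff v h 0 g))
      - covDiff' v h 0 (covDiff v h 0 (weightOp χ g)))
  have e : ((Complex.I * κ) • weightOp (clampBC u (L + 1) (by linarith)) (smoothCut hρ χ g)
        + (ν : ℂ) • conv hρ.integrable_deriv2 (weightOp χ g))
      - smoothCut hρ χ ((Complex.I * κ) • weightOp (clampBC v L hL) g
        - (ν : ℂ) • covDiff' v h 0 (covDiff v h 0 g))
      = (Complex.I * κ) • A + (ν : ℂ) • (B + C) := by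
    simp only [A, B, C, map_sub, map_smul, smul_sub, smul_add, diffQuot_conv, smoothCut_apply]
    abel
  have b1 : ‖A‖ ≤ E * ‖g‖ := norm_shear_comm_le hρ hδ hχ hL hE g
  have b2 : ‖B‖ ≤ K * ‖g‖ :=
    (hK _).trans (mul_le_mul_of_nonneg_left (hχ.norm_weightOp_le g) hK0)
  have b3 : ‖C‖ ≤ c * (2 * ‖covDiff v h 0 g‖ + ‖g‖) :=
    (hρ.norm_conv_le _).trans (hχ.norm_comm_le hh v g)
  rw [e]
  refine (norm_add_le _ _).trans ?_
  rw [norm_smul, norm_smul, norm_mul, Complex.norm_I, one_mul, Complex.norm_real, Complex.norm_real,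
    Real.norm_eq_abs, Real.norm_eq_abs, abs_of_nonneg hν]
  have b4 := (norm_add_le B C).trans (add_le_add b2 b3)
  have := mul_le_mul_of_nonneg_left b1 (abs_nonneg κ)
  have := mul_le_mul_of_nonneg_left b4 hν
  linarith

lemma norm_flow_le (hν : 0 ≤ ν) (hG : IsFlow v κ ν h t G) {r : ℝ} (hr : r ∈ Set.Icc 0 t) :
    ‖G r‖ ≤ ‖G 0‖ := by
  have h1 := le_exp_mul_of_deriv_le (K := 0) (fun s hs => hG.hasDeriv_norm_sq hs) (fun s hs => by
    have : 0 ≤ 2 * ν * ‖covDiff v h (κ * s) (G s)‖ ^ 2 := by positivity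
    linarith) hr
  simp only [zero_mul, Real.exp_zero, one_mul] at h1
  exact (abs_le_of_sq_le_sq' h1 (norm_nonneg _)).2

lemma norm_covDiff_phaseOp (u : C(ℝ, ℝ)) (h a : ℝ) (g : L2R) :
    ‖covDiff u h 0 (phaseOp u a g)‖ = ‖covDiff u h (-a) g‖ := by
  rw [covDiff, diffQuot_phaseOp, norm_phaseOp, zero_sub]

/-- The smoothed dual solution x(s), run backwards from time t, almost solves the adjoint equation,
so ⟨x(s), f(s)⟩ is almost constant. The factor e^{-νσ(t-s)} accounts exactly for σ. The error
contains the gradient of the flow, which has no bound uniform in time and is controlled only through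
the dissipation integral. -/
lemma IsModeSol.dual_error (hf : IsModeSol u κ ν σ fin f) (hν : 0 ≤ ν) (hσ : 0 ≤ σ)
    (hρ : IsMollifier δ ρ) (hδ : δ ≤ 1) (hχ : IsCutoff c L χ) (hL : 0 ≤ L) (hc : 0 ≤ c)
    (hE : ∀ y s, |y| ≤ L → |s| ≤ δ → |u (y + s) - v y| ≤ E) (hh : 0 < h) (hE0 : 0 ≤ E)
    (hK : ∀ g, ‖conv hρ.integrable_deriv2 g + covDiff' v h 0 (covDiff v h 0 (conv hρ.integrable g))‖
        ≤ K * ‖g‖) (hK0 : 0 ≤ K) (ht : 0 ≤ t) (hM : ∀ s ∈ Set.Icc 0 t, ‖f s‖ ≤ M)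
    (hG : IsFlow v (-κ) ν h t G) :
    ‖inner ℂ (smoothCut hρ χ (G 0)) (f t) - (Real.exp (-(ν * σ * t)) : ℂ)
        * inner ℂ (smoothCut hρ χ (phaseOp v (κ * t) (G t))) fin‖
      ≤ M * (((|κ| * E + ν * K + ν * c) * ‖G 0‖ + ν * c) * t + c / 2 * ‖G 0‖ ^ 2) := by
  have hM0 : 0 ≤ M := (norm_nonneg _).trans (hM 0 ⟨le_rfl, ht⟩)
  set g : ℝ → L2R := fun r => phaseOp v (κ * r) (G r) with hg
  set x : ℝ → L2R := fun s => (Real.exp (-(ν * σ * (t - s))) : ℂ) • smoothCut hρ χ (g (t - s)) with hx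
  set x' : ℝ → L2R := fun s => (Real.exp (-(ν * σ * (t - s))) : ℂ) •
    ((ν * σ : ℂ) • smoothCut hρ χ (g (t - s))
      - smoothCut hρ χ ((Complex.I * κ) • weightOp (clampBC v L hL) (g (t - s))
        - (ν : ℂ) • covDiff' v h 0 (covDiff v h 0 (g (t - s))))) with hx'
  set Q : L2R → L2R := fun g => (Complex.I * κ) • weightOp (clampBC u (L + 1) (by linarith))
    (smoothCut hρ χ g) + (ν : ℂ) • conv hρ.integrable_deriv2 (weightOp χ g) with hQ
  set q : ℝ → L2R := fun s => (Real.exp (-(ν * σ * (t - s))) : ℂ) •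
    (Q (g (t - s)) - (ν * σ : ℂ) • smoothCut hρ χ (g (t - s))) with hq
  have hmem : ∀ s ∈ Set.Icc 0 t, t - s ∈ Set.Icc 0 t := fun s hs =>
    ⟨by linarith [hs.2], by linarith [hs.1]⟩
  have hdx : ∀ s ∈ Set.Icc 0 t, HasDerivWithinAt x (x' s) (Set.Icc 0 t) s := fun s hs => by
    have h1 : HasDerivWithinAt (fun s => smoothCut hρ χ (g (t - s))) _ (Set.Icc 0 t) s :=
      HasDerivWithinAt.scomp_of_eq (h := fun s => t - s) (t' := Set.Icc 0 t) s
        (hasDerivWithinAt_smoothCut hρ hχ hL hG (hmem s hs))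
        ((hasDerivWithinAt_id s _).const_sub t) hmem rfl
    have h2 : HasDerivAt (fun s => -(ν * σ * (t - s))) (ν * σ) s := by
      have := (((hasDerivAt_id s).const_sub t).const_mul (ν * σ)).neg
      exact this.congr_deriv (by simp)
    refine (h2.exp.ofReal_comp.hasDerivWithinAt.smul h1).congr_deriv ?_
    simp only [hx', smul_sub, neg_smul, one_smul, smul_neg]
    rw [smul_smul]
    push_cast
    abel
  have hdq : ∀ s ∈ Set.Icc 0 t,
      HasDerivWithinAt (fun r => inner ℂ (x s) (f r)) (inner ℂ (q s) (f s)) (Set.Icc 0 t) s :=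
    fun s hs => by
    obtain ⟨η, h1, h2, h3, h4⟩ := exists_lineTest hρ hχ.support (g (t - s))
    have h5 : Rep (Q (g (t - s)) - (ν * σ : ℂ) • smoothCut hρ χ (g (t - s)))
        (modeAdjoint u κ ν σ η) := by
      have h6 := (((h2.weightOp (clampBC u (L + 1) (by linarith))).smul (Complex.I * κ)).add
        (h3.smul (ν : ℂ))).sub (h2.smul (ν * σ : ℂ))
      refine h6.congr fun y => ?_
      have h7 : (clampBC u (L + 1) (by linarith) y : ℂ) * η y = u y * η y := by
        by_cases h0 : η y = 0
        · simp [h0]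
        · rw [clampBC_apply u _ ((h4 y h0).trans (by linarith))]
      rw [h7, modeAdjoint]
    have h6 := hf.hasDerivWithinAt u.continuous h1 h2 h5 hs
    simp only [hx, hq, inner_smul_left]
    exact h6.const_mul _
  have hd : ∀ s ∈ Set.Icc 0 t, HasDerivWithinAt (fun r => inner ℂ (x r) (f r))
      (inner ℂ (x' s + q s) (f s)) (Set.Icc 0 t) s := fun s hs => by
    rw [inner_add_left]
    exact hasDerivWithinAt_inner_moving (hdx s hs) hM (hf.continuousOn u.continuous t _ s hs)
      (hdq s hs)
  have hsum : ∀ s, x' s + q s = (Real.exp (-(ν * σ * (t - s))) : ℂ) • (Q (g (t - s))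
      - smoothCut hρ χ ((Complex.I * κ) • weightOp (clampBC v L hL) (g (t - s))
        - (ν : ℂ) • covDiff' v h 0 (covDiff v h 0 (g (t - s))))) := fun s => by
    simp only [hx', hq, smul_sub]
    abel
  set D : ℝ → ℝ := fun s => ‖covDiff v h (-κ * (t - s)) (G (t - s))‖ with hD
  have hbound : ∀ s ∈ Set.Icc 0 t, ‖inner ℂ (x' s + q s) (f s)‖
      ≤ M * (((|κ| * E + ν * K + ν * c) * ‖G 0‖ + ν * c) + c / 2 * (2 * ν * D s ^ 2)) :=
    fun s hs => by
    have h1 := norm_adjoint_sub_le (κ := κ) hρ hδ hχ hL hE hν hh hK hK0 (g (t - s))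
    have h2 : ‖covDiff v h 0 (g (t - s))‖ = D s := by
      rw [hg, hD]
      simp only
      rw [norm_covDiff_phaseOp, neg_mul]
    have h3 : ‖g (t - s)‖ ≤ ‖G 0‖ := by
      rw [hg]
      simp only
      rw [norm_phaseOp]
      exact norm_flow_le hν hG (hmem s hs)
    have h4 : |Real.exp (-(ν * σ * (t - s)))| ≤ 1 := by
      rw [abs_of_pos (Real.exp_pos _), Real.exp_le_one_iff]
      have : 0 ≤ ν * σ * (t - s) := mul_nonneg (mul_nonneg hν hσ) (hmem s hs).1
      linarith
    -- Squares the gradient, so that the energy identity can integrate it in time.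
    have h5 : 2 * ν * c * D s ≤ ν * c + ν * c * D s ^ 2 := by
      have : 0 ≤ ν * c * (D s - 1) ^ 2 := by positivity
      linarith
    have h6 : 0 ≤ |κ| * E + ν * K + ν * c := by positivity
    rw [h2] at h1
    have h7 : ‖x' s + q s‖ ≤ ((|κ| * E + ν * K + ν * c) * ‖G 0‖ + ν * c)
        + c / 2 * (2 * ν * D s ^ 2) := by
      rw [hsum, norm_smul, Complex.norm_real, Real.norm_eq_abs]
      refine (mul_le_of_le_one_left (norm_nonneg _) h4).trans (h1.trans ?_)
      have := mul_le_mul_of_nonneg_left h3 h6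
      linarith
    refine (norm_inner_le_norm _ _).trans ?_
    rw [mul_comm]
    exact mul_le_mul (hM s hs) h7 (norm_nonneg _) hM0
  -- A primitive of the bound: the energy identity makes 2νD² the derivative of ‖G(t-s)‖².
  have hB : ∀ s ∈ Set.Icc 0 t, HasDerivWithinAt (fun s => M * (((|κ| * E + ν * K + ν * c) * ‖G 0‖
      + ν * c) * s + c / 2 * (‖G (t - s)‖ ^ 2 - ‖G t‖ ^ 2)))
      (M * (((|κ| * E + ν * K + ν * c) * ‖G 0‖ + ν * c) + c / 2 * (2 * ν * D s ^ 2)))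
      (Set.Icc 0 t) s := fun s hs => by
    have h1 : HasDerivWithinAt (fun s => ‖G (t - s)‖ ^ 2) _ (Set.Icc 0 t) s :=
      HasDerivWithinAt.scomp_of_eq (h := fun s => t - s) (t' := Set.Icc 0 t) s
        (hG.hasDeriv_norm_sq (hmem s hs)) ((hasDerivWithinAt_id s _).const_sub t) hmem rfl
    refine ((((hasDerivWithinAt_id s _).const_mul _).add
      ((h1.sub_const (‖G t‖ ^ 2)).const_mul (c / 2))).const_mul M).congr_deriv ?_
    simp only [mul_one, smul_eq_mul, neg_mul, one_mul, neg_neg, hD]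
  have hIci : ∀ {F : Type} [NormedAddCommGroup F] [NormedSpace ℝ F] {φ : ℝ → F} {φ' : F} {s : ℝ},
      s ∈ Set.Ico 0 t → HasDerivWithinAt φ φ' (Set.Icc 0 t) s →
      HasDerivWithinAt φ φ' (Set.Ici s) s := fun hs h =>
    h.mono_of_mem_nhdsWithin (Filter.mem_of_superset (Icc_mem_nhdsGE hs.2)
      (Set.Icc_subset_Icc_left hs.1))
  have key := image_norm_le_of_norm_deriv_right_le_deriv_boundary'
    (f := fun s => inner ℂ (x s) (f s) - inner ℂ (x 0) (f 0))
    (fun s hs => ((hd s hs).sub_const _).continuousWithinAt)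
    (fun s hs => hIci hs ((hd s ⟨hs.1, hs.2.le⟩).sub_const _)) (by simp)
    (fun s hs => (hB s hs).continuousWithinAt) (fun s hs => hIci hs (hB s ⟨hs.1, hs.2.le⟩))
    (fun s hs => hbound s ⟨hs.1, hs.2.le⟩) (Set.right_mem_Icc.2 ht)
  -- The weak equation at time 0 identifies f(0) with the initial datum against test functions.
  have hx0 : inner ℂ (x 0) (f 0) = (Real.exp (-(ν * σ * t)) : ℂ)
        * inner ℂ (smoothCut hρ χ (phaseOp v (κ * t) (G t))) fin := by
    obtain ⟨η, h1, h2, -, -⟩ := exists_lineTest hρ hχ.support (g t)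
    obtain ⟨a, ha⟩ := exists_rep_modeAdjoint u.continuous κ ν σ h1
    have h3 := hf.weak_eq η _ a h1 h2 ha 0 le_rfl
    rw [intervalIntegral.integral_same, add_zero] at h3
    simp only [hx, sub_zero, inner_smul_left, Complex.conj_ofReal, smoothCut_apply]
    rw [h3]
  have hxt : inner ℂ (x t) (f t) = inner ℂ (smoothCut hρ χ (G 0)) (f t) := by
    simp [hx, hg, phaseOp_zero]
  rw [hx0, hxt, sub_self] at key
  refine key.trans (mul_le_mul_of_nonneg_left ?_ hM0)
  have : 0 ≤ c / 2 * ‖G t‖ ^ 2 := by positivity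
  linarith

end Dual

/-! ### Estimates for a single Fourier mode -/

lemma exists_cutoff_approx (φ : L2R) {ε : ℝ} (hε : 0 < ε) :
    ∃ R, ∀ χ : ℝ →ᵇ ℝ, (∀ y, 0 ≤ χ y) → (∀ y, χ y ≤ 1) → (∀ y, |y| ≤ R → χ y = 1) →
      ‖weightOp χ φ - φ‖ ≤ ε := by
  have hd : Dense {f : L2R | ∃ g : ℝ → ℂ, f =ᵐ[volume] g ∧ HasCompactSupport g ∧ ContDiff ℝ ∞ g} :=
    Lp.dense_hasCompactSupport_contDiff (by norm_num)
  obtain ⟨e, h4, η, h1, h2, h3⟩ := Metric.dense_iff.1 hd φ (ε / 2) (by positivity)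
  obtain ⟨R, hR⟩ := h2.isCompact.isBounded.subset_closedBall (0 : ℝ)
  refine ⟨R, fun χ h5 h6 h7 => ?_⟩
  have he : weightOp χ e = e := (Rep.weightOp χ h1).eq (Filter.EventuallyEq.trans h1
    (Filter.Eventually.of_forall fun y => by
      by_cases h0 : η y = 0
      · simp [h0]
      · have := hR (subset_tsupport η h0)
        rw [mem_closedBall_zero_iff] at this
        simp [h7 y this]))
  have e1 : weightOp χ φ - φ = weightOp χ (φ - e) - (φ - e) := by
    rw [map_sub, he]; abel
  rw [mem_ball_iff_norm'] at h4
  rw [e1]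
  have := norm_sub_le (weightOp χ (φ - e)) (φ - e)
  have := norm_weightOp_le_of_le_one h5 h6 (φ - e)
  linarith

lemma exists_trans_approx (φ : L2R) {ε : ℝ} (hε : 0 < ε) :
    ∃ δ, 0 < δ ∧ ∀ s, |s| ≤ δ → ‖trans (-s) φ - φ‖ ≤ ε := by
  have h1 := (((continuous_trans φ).comp continuous_neg).tendsto 0)
  simp only [Function.comp_apply, neg_zero, trans_zero] at h1
  obtain ⟨δ, hδ, h2⟩ := Metric.tendsto_nhds_nhds.1 h1 ε hε
  refine ⟨δ / 2, by positivity, fun s hs => ?_⟩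
  have := h2 (x := s) (by rw [dist_zero_right, Real.norm_eq_abs]; linarith)
  rw [dist_eq_norm] at this
  exact this.le

lemma exists_exp_mul_le {V ε : ℝ} (hV : 0 ≤ V) (hε : 0 < ε) :
    ∃ δ, 0 < δ ∧ ∀ s, s ≤ δ → Real.exp (V * s) ≤ 1 + ε := by
  refine ⟨Real.log (1 + ε) / (V + 1), div_pos (Real.log_pos (by linarith)) (by positivity),
    fun s hs => ?_⟩
  rw [← Real.le_log_iff_exp_le (by positivity)]
  rw [le_div_iff₀ (by positivity)] at hs
  have := Real.log_pos (show 1 < 1 + ε by linarith)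
  rcases le_total 0 s with h | h
  · linarith
  · nlinarith

section Mode

variable {U κ ν σ t : ℝ} {u : ℝ → ℝ} {fin : L2R} {f : ℝ → L2R}

/-- The parameters are chosen in order: the tolerance θ, the cutoff and its radius L, the bound B of
u' on [-L-1, L+1], the mollification width δ, the truncation N, and last the step h, which has to
beat the mollifier constant and make K(Nh) ≤ 1. Here P is the smoothing, almost a contraction in
every admissible weight and almost commuting with the difference quotient. -/
lemma IsModeSol.exists_dual (hf : IsModeSol u κ ν σ fin f) (hu : IsAdmissibleShear U u) (hU : 1 ≤ U)
    (hν : 0 ≤ ν) (hσ : 0 ≤ σ) (ht : 0 ≤ t) (φ : L2R) {ε : ℝ} (hε : 0 < ε) (K : ℝ) :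
    ∃ (N h : ℝ) (v : C(ℝ, ℝ)) (P : L2R →L[ℂ] L2R), 0 ≤ N ∧ 0 < h ∧ 18 * U ^ 2 * h ≤ 1 ∧
      K * (N * h) ≤ 1 ∧ IsDiffShear (18 * U ^ 2) (18 * U ^ 2)⁻¹ N h v ∧
      (∀ w, IsWeight (18 * U ^ 2) w → ∀ g, ‖weightOp w (P g)‖ ≤ (1 + ε) * ‖weightOp w g‖) ∧
      (∀ g, ‖P (covDiff' v h 0 g) - covDiff' v h 0 (P g)‖ ≤ ε * ‖g‖) ∧
      ∀ G, IsFlow v (-κ) ν h t G → G 0 = φ → ‖inner ℂ φ (f t) - (Real.exp (-(ν * σ * t)) : ℂ)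
        * inner ℂ (P (phaseOp v (κ * t) (G t))) fin‖ ≤ ε := by
  obtain ⟨M, hM⟩ := hf.bounded t
  have hM0 : 0 ≤ M := (norm_nonneg _).trans (hM 0 ⟨le_rfl, ht⟩)
  -- When E, K and c are at most θ, the error in `IsModeSol.dual_error` is at most θW.
  set W : ℝ := M * (((|κ| + ν + ν) * ‖φ‖ + ν) * t + 1 / 2 * ‖φ‖ ^ 2) with hW
  have hW0 : 0 ≤ W := by positivity
  set θ : ℝ := min ε (ε / (2 * (W + 1))) with hθ
  have hθ0 : 0 < θ := lt_min hε (by positivity)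
  have hθε : θ ≤ ε := min_le_left _ _
  have hθW : θ * W ≤ ε / 2 := by
    calc θ * W ≤ ε / (2 * (W + 1)) * W := by gcongr; exact min_le_right _ _
      _ = ε / 2 * (W / (W + 1)) := by field_simp
      _ ≤ ε / 2 := mul_le_of_le_one_right (by positivity) ((div_le_one (by positivity)).2 (by linarith))
  set ε₁ : ℝ := ε / (4 * (M + 1)) with hε1
  have hε10 : 0 < ε₁ := by positivity
  obtain ⟨R, hR⟩ := exists_cutoff_approx φ hε10
  obtain ⟨L, χ, hL, hχ, hχR⟩ := exists_isCutoff hθ0 R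
  obtain ⟨B, hB⟩ := (isCompact_Icc (a := -(L + 1)) (b := L + 1)).exists_bound_of_continuousOn
    hu.continuous_deriv.continuousOn
  have hB' : ∀ y, |y| ≤ L + 1 → deriv u y ≤ B := fun y hy =>
    (le_abs_self _).trans (hB y (abs_le.1 hy))
  have hB0 : 0 < B := (hu.pos hU 0).trans_le (hB' 0 (by simp; positivity))
  obtain ⟨δ₁, hδ₁, hδ₁'⟩ := exists_trans_approx φ hε10
  obtain ⟨δ₂, hδ₂, hδ₂'⟩ := exists_exp_mul_le (V := 18 * U ^ 2) (by positivity) hε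
  set δ : ℝ := min (min δ₁ δ₂) (min 1 (θ / (2 * B))) with hδ
  have hδ0 : 0 < δ := by positivity
  have hδ1 : δ ≤ 1 := (min_le_right _ _).trans (min_le_left _ _)
  have hδB : B * δ ≤ θ / 2 := by
    have : δ ≤ θ / (2 * B) := (min_le_right _ _).trans (min_le_right _ _)
    rw [le_div_iff₀ (by positivity)] at this
    linarith
  obtain ⟨ρ, hρ⟩ := exists_isMollifier hδ0
  obtain ⟨K', hK'0, hK'⟩ := hρ.exists_second_diff_le
  set N : ℝ := max 1 (2 * (B ^ 2 * (L + 1)) / θ) with hN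
  have hN1 : 1 ≤ N := le_max_left _ _
  have hNθ : B ^ 2 * (L + 1) / N ≤ θ / 2 := by
    rw [div_le_iff₀ (by linarith)]
    have : 2 * (B ^ 2 * (L + 1)) / θ ≤ N := le_max_right _ _
    rw [div_le_iff₀ hθ0] at this
    linarith
  obtain ⟨v, hv1, hv2⟩ := hu.exists_trunc hU hN1
  set h : ℝ := min (min 1 (1 / (18 * U ^ 2))) (min (θ / (K' + 1)) (1 / ((|K| + 1) * N))) with hh
  have hh0 : 0 < h := by positivity
  have hh1 : h ≤ 1 := (min_le_left _ _).trans (min_le_left _ _)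
  have hhU : 18 * U ^ 2 * h ≤ 1 := by
    have : h ≤ 1 / (18 * U ^ 2) := (min_le_left _ _).trans (min_le_right _ _)
    rw [le_div_iff₀ (by positivity)] at this
    linarith
  have hhK' : K' * h ≤ θ := by
    have : h ≤ θ / (K' + 1) := (min_le_right _ _).trans (min_le_left _ _)
    rw [le_div_iff₀ (by positivity)] at this
    linarith
  have hhK : K * (N * h) ≤ 1 := by
    have : h ≤ 1 / ((|K| + 1) * N) := (min_le_right _ _).trans (min_le_right _ _)
    rw [le_div_iff₀ (by positivity)] at this
    have h2 : K * (N * h) ≤ (|K| + 1) * (N * h) := by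
      gcongr
      linarith [le_abs_self K]
    linarith
  have hE : ∀ y s, |y| ≤ L → |s| ≤ δ → |u (y + s) - v y| ≤ θ := fun y s hy hs => by
    have h1 : |u (y + s) - u y| ≤ B * |s| := by
      have h5 : |y + s| ≤ L + 1 := (abs_add_le _ _).trans (by linarith)
      have := (convex_Icc (-(L + 1)) (L + 1)).norm_image_sub_le_of_norm_hasDerivWithin_le
        (fun z _ => (hu.hasDerivAt z).hasDerivWithinAt) hB
        (abs_le.1 (show |y| ≤ L + 1 by linarith)) (abs_le.1 h5)
      simpa using this
    have h2 := hv2 (L + 1) B hB' y (by linarith)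
    have h3 := mul_le_mul_of_nonneg_left hs hB0.le
    have h4 := abs_sub_le (u (y + s)) (u y) (v y)
    rw [abs_sub_comm (u y)] at h4
    linarith
  refine ⟨N, h, v, smoothCut hρ χ, by linarith, hh0, hhU, hhK, hv1 h hh0 hhU, fun w hw g => ?_,
    fun g => ?_, fun G hG hG0 => ?_⟩
  · refine (hρ.norm_weightOp_conv_le hw (by positivity) _).trans ?_
    change _ * ‖weightOp w (weightOp χ g)‖ ≤ _
    rw [weightOp_comm]
    exact mul_le_mul (hδ₂' δ ((min_le_left _ _).trans (min_le_right _ _)))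
      (hχ.norm_weightOp_le _) (norm_nonneg _) (by positivity)
  · rw [smoothCut_apply, smoothCut_apply, diffQuot_conv, ← map_sub]
    refine (hρ.norm_conv_le _).trans ((hχ.norm_covDiff'_comm_le hh0 v g).trans ?_)
    gcongr
  · have h1 := IsModeSol.dual_error (u := ⟨u, hu.contDiff.continuous⟩) hf hν hσ hρ hδ1 hχ hL.le
      hθ0.le hE hh0 hθ0.le (fun g => hK' v h g hh0 hh1) (by positivity) ht hM hG
    rw [hG0] at h1
    have h2 : ‖smoothCut hρ χ φ - φ‖ ≤ ε₁ + ε₁ := by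
      have e : smoothCut hρ χ φ - φ
          = conv hρ.integrable (weightOp χ φ - φ) + (conv hρ.integrable φ - φ) := by
        rw [smoothCut_apply, map_sub]; abel
      rw [e]
      refine (norm_add_le _ _).trans (add_le_add ((hρ.norm_conv_le _).trans
        (hR χ hχ.nonneg hχ.le_one hχR)) (hρ.norm_conv_sub_le φ fun s hs => hδ₁' s (hs.trans ?_)))
      exact (min_le_left _ _).trans (min_le_left _ _)
    have h3 : ‖inner ℂ φ (f t) - inner ℂ (smoothCut hρ χ φ) (f t)‖ ≤ ε / 2 := by
      rw [← inner_sub_left]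
      refine (norm_inner_le_norm _ _).trans ?_
      rw [norm_sub_rev]
      calc _ ≤ (ε₁ + ε₁) * M := mul_le_mul h2 (hM t ⟨ht, le_rfl⟩) (norm_nonneg _) (by positivity)
        _ = ε / 2 * (M / (M + 1)) := by rw [hε1]; field_simp; ring
        _ ≤ ε / 2 := mul_le_of_le_one_right (by positivity)
          ((div_le_one (by positivity)).2 (by linarith))
    have h4 : M * (((|κ| * θ + ν * (K' * h) + ν * θ) * ‖φ‖ + ν * θ) * t + θ / 2 * ‖φ‖ ^ 2)
        ≤ ε / 2 := by
      refine le_trans ?_ hθW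
      calc _ ≤ M * (((|κ| * θ + ν * θ + ν * θ) * ‖φ‖ + ν * θ) * t + θ / 2 * ‖φ‖ ^ 2) := by
            gcongr
        _ = _ := by rw [hW]; ring
    have := norm_sub_le_norm_sub_add_norm_sub (inner ℂ φ (f t))
      (inner ℂ (smoothCut hρ χ φ) (f t)) ((Real.exp (-(ν * σ * t)) : ℂ)
        * inner ℂ (smoothCut hρ χ (phaseOp v (κ * t) (G t))) fin)
    linarith

lemma le_of_forall_pos_le_mul {a C : ℝ} (h : ∀ ε > 0, a ≤ ε + (1 + 2 * ε) * C) : a ≤ C := by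
  refine le_of_forall_pos_le_add fun ε hε => ?_
  have h1 := h (ε / (1 + 2 * |C|)) (by positivity)
  have h2 : ε / (1 + 2 * |C|) * (1 + 2 * C) ≤ ε / (1 + 2 * |C|) * (1 + 2 * |C|) := by
    gcongr
    exact le_abs_self C
  rw [div_mul_cancel₀ _ (by positivity)] at h2
  linarith

lemma norm_exp_mul_le {ν σ t : ℝ} (hν : 0 ≤ ν) (hσ : 0 ≤ σ) (ht : 0 ≤ t) {a b : ℂ} {ε : ℝ}
    (h : ‖a - (Real.exp (-(ν * σ * t)) : ℂ) * b‖ ≤ ε) : ‖a‖ ≤ ε + ‖b‖ := by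
  have h1 : ‖(Real.exp (-(ν * σ * t)) : ℂ) * b‖ ≤ ‖b‖ := by
    rw [norm_mul, Complex.norm_real, Real.norm_eq_abs, abs_of_pos (Real.exp_pos _)]
    refine mul_le_of_le_one_left (norm_nonneg _) (Real.exp_le_one_iff.2 ?_)
    have : 0 ≤ ν * σ * t := by positivity
    linarith
  have := norm_sub_norm_le a ((Real.exp (-(ν * σ * t)) : ℂ) * b)
  linarith

variable {m V : ℝ}

/-- Enhanced diffusion for one Fourier mode. -/
lemma IsModeSol.enhanced (hf : IsModeSol u κ (m ^ 3) σ fin f) (hu : IsAdmissibleShear U u)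
    (hU : 1 ≤ U) (hV : V = 18 * U ^ 2) (hm : 0 ≤ m) (hmV : 200 * V * energyConst V * m ^ 2 ≤ 1)
    (hκ : 1 ≤ |κ|) (hσ : 0 ≤ σ) (ht : 0 ≤ t) {w : ℝ →ᵇ ℝ} (hw : IsWeight V w) {F : L2R}
    (hF : fin = weightOp w F) (φ : L2R) :
    ‖inner ℂ φ (f t)‖ ≤ 4 * Real.exp (-(m / (200 * V) * t)) * ‖weightOp w φ‖ * ‖F‖ := by
  have hV1 : 1 ≤ V := by nlinarith
  have hν : 0 ≤ m ^ 3 := by positivity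
  refine le_of_forall_pos_le_mul fun ε hε => ?_
  obtain ⟨N, h, v, P, hN, hh, hhV, hK, hv, hPw, -, hP⟩ :=
    hf.exists_dual hu hU hν hσ ht φ hε (|κ| * (100 * V / m))
  rw [← hV] at hhV hv hPw
  obtain ⟨G, hG, hG0⟩ := exists_isFlow hv (by positivity) hh (-κ) (m ^ 3) ht φ
  have S : IsScheme V N h v w := ⟨hV1, hh, hhV, hv, hw⟩
  have h1 := S.decay hm (by rwa [abs_neg]) hmV (by rwa [abs_neg]) hG ⟨ht, le_rfl⟩
  refine (norm_exp_mul_le hν hσ ht (hP G hG hG0)).trans (add_le_add le_rfl ?_)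
  -- The datum is divided by w and the weight goes to the dual solution, where `IsScheme.decay`
  -- applies.
  rw [hF, ← inner_weightOp]
  refine (norm_inner_le_norm _ _).trans ?_
  have h2 := hPw w hw (phaseOp v (κ * t) (G t))
  rw [weightOp_phaseOp, norm_phaseOp] at h2
  rw [hG0] at h1
  calc _ ≤ ((1 + ε) * (4 * Real.exp (-(m / (200 * V) * t)) * ‖weightOp w φ‖)) * ‖F‖ := by
        refine mul_le_mul_of_nonneg_right (h2.trans ?_) (norm_nonneg _)
        gcongr
    _ ≤ ((1 + 2 * ε) * (4 * Real.exp (-(m / (200 * V) * t)) * ‖weightOp w φ‖)) * ‖F‖ := by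
        gcongr
        linarith
    _ = _ := by ring

/-- Stable mixing for one Fourier mode. -/
lemma IsModeSol.mixing (hf : IsModeSol u κ (m ^ 3) σ fin f) (hu : IsAdmissibleShear U u)
    (hU : 1 ≤ U) (hV : V = 18 * U ^ 2) (hm : 0 ≤ m) (hmV : 200 * V * energyConst V * m ^ 2 ≤ 1)
    (hκ : 1 ≤ |κ|) (hσ : 0 ≤ σ) (ht : 0 ≤ t) {φ : L2R} {A B : ℝ} (hA0 : 0 ≤ A)
    (hA : ∀ h, 0 < h → ‖trans h fin - fin‖ ≤ h * A) (hB : ∀ h, 0 < h → ‖trans h φ - φ‖ ≤ h * B) :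
    ‖inner ℂ φ (f t)‖ ≤ mixConst V * (Real.exp (-(m / (800 * V) * t)) / √(1 + t ^ 2))
      * ((‖fin‖ + A) * (‖φ‖ + B)) := by
  have hV1 : 1 ≤ V := by nlinarith
  have hν : 0 ≤ m ^ 3 := by positivity
  have hmix : 0 ≤ mixConst V := by unfold mixConst energyConst; positivity
  refine le_of_forall_pos_le_mul fun ε hε => ?_
  obtain ⟨N, h, v, P, hN, hh, hhV, hK, hv, hPw, hPc, hP⟩ :=
    hf.exists_dual hu hU hν hσ ht φ hε (|κ| * (100 * V / m) + |κ| * t)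
  rw [← hV] at hhV hv hPw
  obtain ⟨G, hG, hG0⟩ := exists_isFlow hv (by positivity) hh (-κ) (m ^ 3) ht φ
  -- The smoothing is moved onto the datum by its adjoint, and a second discrete flow starts from
  -- there, as the dual partner of G in `IsScheme.mixing`.
  obtain ⟨Γ, hΓ, hΓ0⟩ := exists_isFlow hv (by positivity) hh (-(-κ)) (m ^ 3) ht
    (ContinuousLinearMap.adjoint P fin)
  have S : IsScheme V N h v oneWeight := ⟨hV1, hh, hhV, hv, isWeight_oneWeight (by linarith)⟩
  have k1 : 0 ≤ |κ| * (100 * V / m) * (N * h) := by positivity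
  have k2 : 0 ≤ |κ| * t * (N * h) := by positivity
  rw [add_mul] at hK
  have h1 := S.mixing hm (by rwa [abs_neg]) hmV (by rw [abs_neg]; linarith) ht
    (by rw [abs_neg]; linarith) hG hΓ
  refine (norm_exp_mul_le hν hσ ht (hP G hG hG0)).trans (add_le_add le_rfl ?_)
  rw [← ContinuousLinearMap.adjoint_inner_right, ← inner_conj_symm, RCLike.norm_conj]
  rw [neg_mul, neg_neg, hΓ0, hG0] at h1
  have hPn : ∀ g, ‖P g‖ ≤ (1 + ε) * ‖g‖ := fun g => by
    simpa only [weightOp_oneWeight] using hPw _ (isWeight_oneWeight (by linarith)) g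
  have hd : ∀ {g : L2R} {D : ℝ}, (∀ h, 0 < h → ‖trans h g - g‖ ≤ h * D) → ‖covDiff v h 0 g‖ ≤ D :=
    fun hD => by
      have := hD h hh
      rw [norm_trans_sub hh v] at this
      exact le_of_mul_le_mul_left this hh
  have b1 : ‖ContinuousLinearMap.adjoint P fin‖ ≤ (1 + ε) * ‖fin‖ := by
    refine ContinuousLinearMap.le_of_opNorm_le _ ?_ fin
    rw [LinearIsometryEquiv.norm_map]
    exact ContinuousLinearMap.opNorm_le_bound _ (by positivity) hPn
  -- Writing ‖X‖² as a pairing with `fin` and commuting P with the adjoint quotient puts the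
  -- quotient on `fin`; the commutator is at most ε.
  have b2 : ‖covDiff v h 0 (ContinuousLinearMap.adjoint P fin)‖ ≤ (1 + ε) * A + ε * ‖fin‖ := by
    set X := covDiff v h 0 (ContinuousLinearMap.adjoint P fin)
    have e1 : inner ℂ (P (covDiff' v h 0 X)) fin = inner ℂ X X := by
      rw [← ContinuousLinearMap.adjoint_inner_right, ← inner_conj_symm, inner_covDiff',
        inner_conj_symm]
    have e2 : inner ℂ X X = inner ℂ (P X) (covDiff v h 0 fin)
        + inner ℂ (P (covDiff' v h 0 X) - covDiff' v h 0 (P X)) fin := by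
      rw [inner_sub_left, e1, ← inner_conj_symm (covDiff' v h 0 (P X)), inner_covDiff',
        inner_conj_symm]
      ring
    have e3 : ‖X‖ * ‖X‖ ≤ ‖X‖ * ((1 + ε) * A + ε * ‖fin‖) := by
      have e4 : ‖X‖ * ‖X‖ = ‖inner ℂ X X‖ := by
        rw [inner_self_eq_norm_sq_to_K, norm_pow, sq]; simp
      rw [e4, e2]
      refine (norm_add_le _ _).trans ((add_le_add (norm_inner_le_norm _ _)
        (norm_inner_le_norm _ _)).trans ?_)
      calc _ ≤ (1 + ε) * ‖X‖ * A + ε * ‖X‖ * ‖fin‖ := by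
            gcongr
            · exact hPn X
            · exact hd hA
            · exact hPc X
        _ = _ := by ring
    rcases (norm_nonneg X).eq_or_lt with h0 | h0
    · rw [← h0]; positivity
    · exact le_of_mul_le_mul_left e3 h0
  refine h1.trans ?_
  calc _ ≤ mixConst V * (Real.exp (-(m / (800 * V) * t)) / √(1 + t ^ 2))
        * (((1 + 2 * ε) * (‖fin‖ + A)) * (‖φ‖ + B)) := by
        gcongr
        · have := mul_nonneg hε.le hA0
          linarith
        · exact hd hB
    _ = _ := by ring

end Mode

/-! ### Weak derivatives and dual weighted norms -/

lemma dense_lineTest : Dense {e : L2R | ∃ η, IsLineTest η ∧ Rep e η} := by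
  refine (Lp.dense_hasCompactSupport_contDiff (by norm_num)).mono ?_
  rintro e ⟨η, h1, h2, h3⟩
  exact ⟨η, ⟨h3, h2⟩, h1⟩

lemma norm_le_of_forall_lineTest {x : L2R} {c : ℝ} (hc : 0 ≤ c)
    (h : ∀ η e, IsLineTest η → Rep e η → ‖inner ℂ e x‖ ≤ c * ‖e‖) : ‖x‖ ≤ c := by
  have hcl : IsClosed {e : L2R | ‖inner ℂ e x‖ ≤ c * ‖e‖} :=
    isClosed_le (by fun_prop) (by fun_prop)
  have hsub : {e : L2R | ∃ η, IsLineTest η ∧ Rep e η} ⊆ {e : L2R | ‖inner ℂ e x‖ ≤ c * ‖e‖} := by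
    rintro e ⟨η, h1, h2⟩
    exact h η e h1 h2
  have h1 : x ∈ {e : L2R | ‖inner ℂ e x‖ ≤ c * ‖e‖} := hcl.closure_subset_iff.2 hsub (dense_lineTest x)
  have h2 : ‖x‖ * ‖x‖ ≤ c * ‖x‖ := by
    simpa [inner_self_eq_norm_sq_to_K, sq] using h1
  rcases (norm_nonneg x).eq_or_lt with h0 | h0
  · rwa [← h0]
  · exact le_of_mul_le_mul_right h2 h0

lemma IsLineTest.comp_add {η : ℝ → ℂ} (hη : IsLineTest η) (s : ℝ) :
    IsLineTest (fun y => η (y + s)) :=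
  ⟨hη.smooth.comp (contDiff_id.add contDiff_const),
    hη.compact.comp_homeomorph (Homeomorph.addRight s)⟩

open scoped Convolution in
-- As a function of the translation, the pairing is the convolution of F with a smooth kernel, so it
-- is differentiable although F is only in L².
lemma IsLineTest.hasDerivAt_inner_trans {η : ℝ → ℂ} (hη : IsLineTest η) {e a : L2R} (he : Rep e η)
    (ha : Rep a (_root_.deriv η)) (F : L2R) (s : ℝ) :
    HasDerivAt (fun s => inner ℂ (trans (-s) e) F) (-inner ℂ (trans (-s) a) F) s := by
  set r : ℝ → ℂ := fun x => (starRingEnd ℂ) (η (-x)) with hr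
  have hd : ∀ x, HasDerivAt r (-(starRingEnd ℂ) (_root_.deriv η (-x))) x := fun x => by
    have h1 : HasDerivAt (fun x => η (-x)) (-_root_.deriv η (-x)) x := by
      exact ((hη.hasDerivAt (-x)).scomp x (hasDerivAt_neg x)).congr_deriv (by simp)
    simpa using h1.star
  have hc : HasCompactSupport r := by
    have h1 : HasCompactSupport fun x => η (-x) := hη.compact.comp_homeomorph (Homeomorph.neg ℝ)
    exact h1.comp_left (map_zero _)
  have hs : ContDiff ℝ 1 r := by
    have h1 : ContDiff ℝ 1 fun x => η (-x) := (hη.smooth.of_le (by simp)).comp contDiff_neg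
    exact Complex.conjCLE.contDiff.comp h1
  have hF : LocallyIntegrable F volume := (Lp.memLp F).locallyIntegrable (by norm_num)
  have h1 := hc.hasDerivAt_convolution_left (ContinuousLinearMap.mul ℝ ℂ) hs hF s
  have e1 : ∀ {b : L2R} {q : ℝ → ℂ}, Rep b q → ∀ s, inner ℂ (trans (-s) b) F
      = ((fun x => (starRingEnd ℂ) (q (-x))) ⋆[ContinuousLinearMap.mul ℝ ℂ] F) s := fun hb s => by
    rw [inner_eq_integral (hb.trans (-s)) (rep_self F), convolution_eq_swap]
    simp only [ContinuousLinearMap.mul_apply', sub_eq_add_neg, neg_add_rev, neg_neg]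
  rw [funext (hd · |>.deriv)] at h1
  have e2 : ((fun x => -(starRingEnd ℂ) (_root_.deriv η (-x))) ⋆[ContinuousLinearMap.mul ℝ ℂ] F) s
      = -inner ℂ (trans (-s) a) F := by
    rw [e1 ha]
    simp only [convolution, ContinuousLinearMap.mul_apply', neg_mul, integral_neg]
  rw [e2] at h1
  exact h1.congr_of_eventuallyEq (Filter.Eventually.of_forall fun s => e1 he s)

/-- A function with a weak derivative in `L²` has difference quotients bounded in `L²`. -/
lemma norm_trans_sub_le_of_weak {F g : L2R} (hw : ∀ η e a, IsLineTest η → Rep e η →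
    Rep a (deriv η) → inner ℂ a F = -inner ℂ e g) {h : ℝ} (hh : 0 < h) :
    ‖trans h F - F‖ ≤ h * ‖g‖ := by
  refine norm_le_of_forall_lineTest (by positivity) fun η e hη he => ?_
  obtain ⟨a, ha⟩ := hη.deriv.exists_rep (a := fun _ => 1) continuous_const
  have ha' : Rep a (deriv η) := ha.congr fun y => one_mul _
  have h1 := norm_image_sub_le_of_norm_deriv_le_segment' (C := ‖e‖ * ‖g‖) (a := 0) (b := h)
    (fun s _ => (hη.hasDerivAt_inner_trans he ha' F s).hasDerivWithinAt) (fun s _ => by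
      have hd : deriv (fun y => η (y + -s)) = fun y => deriv η (y + -s) :=
        funext fun y => deriv_comp_add_const η (-s) y
      rw [hw _ (trans (-s) e) (trans (-s) a) (hη.comp_add (-s)) (he.trans (-s))
        (by rw [hd]; exact ha'.trans (-s)), neg_neg, ← norm_trans (-s) e]
      exact norm_inner_le_norm _ _) h (Set.right_mem_Icc.2 hh.le)
  rw [neg_zero, trans_zero, ← inner_trans, ← inner_sub_right] at h1
  linarith

lemma enorm_sq_eq {v : L2R} {f : ℝ → ℂ} (hv : Rep v f) : ‖v‖ₑ ^ 2 = ∫⁻ y, ‖f y‖ₑ ^ 2 := by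
  rw [Lp.enorm_def, eLpNorm_congr_ae hv]
  have := eLpNorm_nnreal_pow_eq_lintegral (f := f) (μ := (volume : Measure ℝ)) (p := 2) two_ne_zero
  simpa using this

/-- The bounded function `min (1 / w) n`. -/
noncomputable def truncInv (w : ℝ →ᵇ ℝ) (hw : ∀ y, 0 < w y) (n : ℕ) : ℝ →ᵇ ℝ :=
  BoundedContinuousFunction.ofNormedAddCommGroup (fun y => min (w y)⁻¹ n)
    ((w.continuous.inv₀ fun y => (hw y).ne').min continuous_const) n (fun y => by
      rw [Real.norm_eq_abs, abs_of_nonneg (le_min (inv_nonneg.2 (hw y).le) n.cast_nonneg)]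
      exact min_le_right _ _)

/-- Duality for the weighted norm `‖v / w‖`. -/
lemma lintegral_inv_mul_le {w : ℝ →ᵇ ℝ} (hw : ∀ y, 0 < w y) {v : L2R} {f : ℝ → ℂ} (hv : Rep v f)
    {C : ℝ} (h : ∀ φ, ‖inner ℂ φ v‖ ≤ C * ‖weightOp w φ‖) :
    ∫⁻ y, ‖((w y)⁻¹ : ℂ) * f y‖ₑ ^ 2 ≤ ENNReal.ofReal C ^ 2 := by
  have hn : ∀ n, ∫⁻ y, ‖(truncInv w hw n y : ℂ) * f y‖ₑ ^ 2 ≤ ENNReal.ofReal C ^ 2 := fun n => by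
    set a := truncInv w hw n
    -- Testing with φ = a²v, where a = min(1/w, n), gives ‖av‖² ≤ C‖wa²v‖ ≤ C‖av‖. The truncation is
    -- needed since v/w need not be known to lie in L².
    have h1 := h (weightOp a (weightOp a v))
    rw [inner_weightOp, inner_self_eq_norm_sq_to_K, norm_pow] at h1
    simp only [Complex.coe_algebraMap, Complex.norm_real, norm_norm] at h1
    have h2 : ‖weightOp w (weightOp a (weightOp a v))‖ ≤ 1 * ‖weightOp a v‖ := by
      refine ((((rep_self v).weightOp a).weightOp a).weightOp w).norm_le
        ((rep_self v).weightOp a) 0 fun y => ?_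
      rw [← mul_assoc, norm_mul, add_zero, ← Complex.ofReal_mul, Complex.norm_real]
      refine mul_le_mul_of_nonneg_right ?_ (norm_nonneg _)
      have hp := hw y
      have h3 : 0 ≤ a y := le_min (inv_nonneg.2 hp.le) n.cast_nonneg
      rw [Real.norm_eq_abs, abs_of_nonneg (mul_nonneg hp.le h3)]
      calc w y * a y ≤ w y * (w y)⁻¹ := mul_le_mul_of_nonneg_left (min_le_left _ _) hp.le
        _ = 1 := mul_inv_cancel₀ hp.ne'
    have h4 : ‖weightOp a v‖ ≤ C ∨ ‖weightOp a v‖ = 0 := by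
      rcases (norm_nonneg (weightOp a v)).eq_or_lt with h0 | h0
      · exact Or.inr h0.symm
      · left
        rcases le_or_gt 0 C with hC | hC
        · refine le_of_mul_le_mul_right ?_ h0
          have := mul_le_mul_of_nonneg_left h2 hC
          rw [← sq]
          linarith
        · exfalso
          have : C * ‖weightOp w (weightOp a (weightOp a v))‖ ≤ 0 :=
            mul_nonpos_of_nonpos_of_nonneg hC.le (norm_nonneg _)
          nlinarith
    rw [← enorm_sq_eq (hv.weightOp a)]
    refine pow_le_pow_left' ?_ 2
    rw [← ofReal_norm]
    rcases h4 with h4 | h4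
    · exact ENNReal.ofReal_le_ofReal h4
    · rw [h4]; simp
  -- Fatou's lemma removes the truncation.
  calc ∫⁻ y, ‖((w y)⁻¹ : ℂ) * f y‖ₑ ^ 2
      = ∫⁻ y, Filter.liminf (fun n : ℕ => ‖(truncInv w hw n y : ℂ) * f y‖ₑ ^ 2) Filter.atTop := by
        congr 1
        ext1 y
        refine (Filter.Tendsto.liminf_eq ?_).symm
        refine tendsto_const_nhds.congr' ?_
        obtain ⟨n, hn⟩ := exists_nat_ge (w y)⁻¹
        filter_upwards [Filter.eventually_ge_atTop n] with k hk
        have : truncInv w hw k y = (w y)⁻¹ := min_eq_left (hn.trans (by exact_mod_cast hk))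
        rw [this]
        simp
    _ ≤ Filter.liminf (fun n : ℕ => ∫⁻ y, ‖(truncInv w hw n y : ℂ) * f y‖ₑ ^ 2) Filter.atTop := by
        refine lintegral_liminf_le' fun n => ?_
        have hf : AEStronglyMeasurable f volume := (Lp.aestronglyMeasurable v).congr hv
        have : Continuous fun y => (truncInv w hw n y : ℂ) := by fun_prop
        exact ((this.aestronglyMeasurable.mul hf).enorm).pow_const 2
    _ ≤ ENNReal.ofReal C ^ 2 :=
        Filter.liminf_le_of_le (by isBoundedDefault) fun b hb => by
          obtain ⟨n, h5⟩ := hb.exists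
          exact h5.trans (hn n)

/-! ### Fourier series in the periodic variable -/

open AddCircle in
lemma lintegral_torus_eq (f : Torus → ℝ≥0∞) :
    ∫⁻ x, f x = ENNReal.ofReal (2 * Real.pi) * ∫⁻ x, f x ∂haarAddCircle := by
  rw [volume_eq_smul_haarAddCircle, lintegral_smul_measure, smul_eq_mul]

open AddCircle in
lemma hasSum_conj_fourierCoeff_mul {f g : Torus → ℂ} (hf : MemLp f 2 volume)
    (hg : MemLp g 2 volume) :
    HasSum (fun k : ℤ => (starRingEnd ℂ) (fourierCoeff f k) * fourierCoeff g k)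
      (((2 * Real.pi)⁻¹ : ℝ) • ∫ x, (starRingEnd ℂ) (f x) * g x) := by
  have hf' := hf.haarAddCircle
  have hg' := hg.haarAddCircle
  have h := fourierBasis.hasSum_inner_mul_inner (hf'.toLp f) (hg'.toLp g)
  have hc : ∀ {q : Torus → ℂ} (hq : MemLp q 2 haarAddCircle) (k : ℤ),
      inner ℂ (fourierBasis k) (hq.toLp q) = fourierCoeff q k := by
    intro q hq k
    rw [← HilbertBasis.repr_apply_apply, fourierBasis_repr]
    exact congrFun (fourierCoeff_congr_ae hq.coeFn_toLp) k
  rw [← integral_haarAddCircle]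
  have hr : inner ℂ (hf'.toLp f) (hg'.toLp g) =
      ∫ x, (starRingEnd ℂ) (f x) * g x ∂haarAddCircle := by
    rw [L2.inner_def]
    refine integral_congr_ae ?_
    filter_upwards [hf'.coeFn_toLp, hg'.coeFn_toLp] with x h1 h2
    rw [h1, h2, RCLike.inner_apply, mul_comm]
  rw [← hr]
  have hk : ∀ k, (starRingEnd ℂ) (fourierCoeff f k) * fourierCoeff g k =
      inner ℂ (hf'.toLp f) (fourierBasis k) * inner ℂ (fourierBasis k) (hg'.toLp g) := by
    intro k
    rw [hc hg', ← inner_conj_symm, hc hf']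
  simp only [hk]
  exact h

open AddCircle in
lemma lintegral_enorm_sq_torus {f : Torus → ℂ} (hf : MemLp f 2 volume) :
    ∫⁻ x, ‖f x‖ₑ ^ 2 = ENNReal.ofReal (2 * Real.pi) * ∑' k : ℤ, ‖fourierCoeff f k‖ₑ ^ 2 := by
  have hf' := hf.haarAddCircle
  rw [lintegral_torus_eq]
  congr 1
  have h := hasSum_sq_fourierCoeff (hf'.toLp f)
  have h2 : ∫ t, ‖hf'.toLp f t‖ ^ 2 ∂haarAddCircle = ∫ t, ‖f t‖ ^ 2 ∂haarAddCircle := by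
    refine integral_congr_ae ?_
    filter_upwards [hf'.coeFn_toLp] with x h1
    rw [h1]
  have h3 : ∀ k, fourierCoeff (hf'.toLp f) k = fourierCoeff f k :=
    fun k => congrFun (fourierCoeff_congr_ae hf'.coeFn_toLp) k
  simp only [h2, h3] at h
  have e : ∀ z : ℂ, ‖z‖ₑ ^ 2 = ENNReal.ofReal (‖z‖ ^ 2) := fun z => by
    rw [ENNReal.ofReal_pow (norm_nonneg _), ofReal_norm]
  simp only [e]
  rw [← ofReal_integral_eq_lintegral_ofReal hf'.integrable_norm_pow'
    (Filter.Eventually.of_forall fun x => by positivity), ← h.tsum_eq,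
    ENNReal.ofReal_tsum_of_nonneg (fun k => by positivity) h.summable]

/-- The Fourier coefficient in `x` of a function on `𝕋 × ℝ`. -/
noncomputable def modeCoeff (k : ℤ) (F : Torus × ℝ → ℝ) (y : ℝ) : ℂ :=
  fourierCoeff (fun x : Torus => (F (x, y) : ℂ)) k

variable {F G : Torus × ℝ → ℝ} {k : ℤ}

lemma modeCoeff_eq (k : ℤ) (F : Torus × ℝ → ℝ) (y : ℝ) :
    modeCoeff k F y = ((2 * Real.pi)⁻¹ : ℝ) • ∫ x : Torus, fourier (-k) x • (F (x, y) : ℂ) := by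
  rw [modeCoeff, fourierCoeff, AddCircle.integral_haarAddCircle]

lemma aestronglyMeasurable_modeCoeff (hF : AEStronglyMeasurable F volume) (k : ℤ) :
    AEStronglyMeasurable (modeCoeff k F) volume := by
  simp only [funext (modeCoeff_eq k F)]
  have h1 : AEStronglyMeasurable (fun p : Torus × ℝ => fourier (-k) p.1 • (F p : ℂ))
      (volume.prod volume) :=
    ((map_continuous (fourier (-k))).comp continuous_fst).aestronglyMeasurable.smul
      (Complex.continuous_ofReal.comp_aestronglyMeasurable hF)
  exact (AEStronglyMeasurable.integral_prod_right' h1.prod_swap).const_smul ((2 * Real.pi)⁻¹ : ℝ)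

lemma memLp_section (hF : MemLp F 2 volume) :
    ∀ᵐ y : ℝ, MemLp (fun x : Torus => (F (x, y) : ℂ)) 2 volume := by
  have hF' : MemLp F 2 ((volume : Measure Torus).prod (volume : Measure ℝ)) := hF
  have h1 := (memLp_two_iff_integrable_sq_norm hF'.1).1 hF'
  have h2 := h1.prod_left_ae
  have h3 := hF'.1.prod_swap.prodMk_left
  filter_upwards [h2, h3] with y h2 h3
  have h3' : AEStronglyMeasurable (fun x : Torus => F (x, y)) volume := h3
  refine (memLp_two_iff_integrable_sq_norm
    (Complex.continuous_ofReal.comp_aestronglyMeasurable h3')).2 ?_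
  simpa using h2

/-- The weight does not depend on x, so Parseval applies on almost every section. Both sides may be
infinite, and no integrability of the weighted function is needed. -/
lemma lintegral_weight_mul_sq (hF : MemLp F 2 volume) {a : ℝ → ℝ≥0∞} (ha : Measurable a) :
    ∫⁻ p, a p.2 * ‖F p‖ₑ ^ 2 =
      ENNReal.ofReal (2 * Real.pi) * ∑' k : ℤ, ∫⁻ y, a y * ‖modeCoeff k F y‖ₑ ^ 2 := by
  have h1 : AEMeasurable (fun p : Torus × ℝ => a p.2 * ‖F p‖ₑ ^ 2)
      ((volume : Measure Torus).prod (volume : Measure ℝ)) :=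
    (ha.comp measurable_snd).aemeasurable.mul (hF.1.enorm.pow_const 2)
  have h2 : ∀ k : ℤ, AEMeasurable (fun y => a y * ‖modeCoeff k F y‖ₑ ^ 2) volume := fun k =>
    ha.aemeasurable.mul ((aestronglyMeasurable_modeCoeff hF.1 k).enorm.pow_const 2)
  rw [Measure.volume_eq_prod, lintegral_prod_symm _ h1, ← lintegral_tsum h2,
    ← lintegral_const_mul' _ _ ENNReal.ofReal_ne_top]
  refine lintegral_congr_ae ?_
  filter_upwards [memLp_section hF] with y hy
  have e : ∀ r : ℝ, ‖(r : ℂ)‖ₑ = ‖r‖ₑ := fun r => by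
    rw [← ofReal_norm, ← ofReal_norm, Complex.norm_real]
  have h4 : AEMeasurable (fun x : Torus => ‖F (x, y)‖ₑ ^ 2) volume := by
    have := hy.1.enorm.pow_const 2
    simpa only [e] using this
  rw [lintegral_const_mul'' _ h4, ENNReal.tsum_mul_left]
  have := lintegral_enorm_sq_torus hy
  simp only [e] at this
  rw [this]
  simp only [modeCoeff]
  ring

lemma lintegral_sq_eq_tsum (hF : MemLp F 2 volume) :
    ∫⁻ p, ‖F p‖ₑ ^ 2 =
      ENNReal.ofReal (2 * Real.pi) * ∑' k : ℤ, ∫⁻ y, ‖modeCoeff k F y‖ₑ ^ 2 := by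
  simpa using lintegral_weight_mul_sq hF (a := 1) measurable_one

lemma eLpNorm_two_sq {α E : Type*} [MeasurableSpace α] [NormedAddCommGroup E] {μ : Measure α}
    (f : α → E) : eLpNorm f 2 μ ^ 2 = ∫⁻ x, ‖f x‖ₑ ^ 2 ∂μ := by
  rw [eLpNorm_eq_lintegral_rpow_enorm_toReal (by norm_num) (by norm_num), ← ENNReal.rpow_natCast,
    ← ENNReal.rpow_mul]
  norm_num

lemma memLp_two_iff_lintegral {α E : Type*} [MeasurableSpace α] [NormedAddCommGroup E]
    {μ : Measure α} {f : α → E} (hf : AEStronglyMeasurable f μ) :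
    MemLp f 2 μ ↔ ∫⁻ x, ‖f x‖ₑ ^ 2 ∂μ < ⊤ := by
  rw [← eLpNorm_two_sq, MemLp, and_iff_right hf, ENNReal.pow_lt_top_iff]
  simp

lemma lt_top_of_two_pi_mul {b : ℝ≥0∞} (h : ENNReal.ofReal (2 * Real.pi) * b < ⊤) : b < ⊤ :=
  ENNReal.lt_top_of_mul_ne_top_right h.ne
    (by rw [Ne, ENNReal.ofReal_eq_zero, not_le]; exact Real.two_pi_pos)

lemma lintegral_modeCoeff_le (hF : MemLp F 2 volume) (k : ℤ) :
    ENNReal.ofReal (2 * Real.pi) * ∫⁻ y, ‖modeCoeff k F y‖ₑ ^ 2 ≤ ∫⁻ p, ‖F p‖ₑ ^ 2 := by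
  rw [lintegral_sq_eq_tsum hF]
  gcongr
  exact ENNReal.le_tsum k

lemma memLp_modeCoeff (hF : MemLp F 2 volume) (k : ℤ) : MemLp (modeCoeff k F) 2 volume := by
  rw [memLp_two_iff_lintegral (aestronglyMeasurable_modeCoeff hF.1 k)]
  have h := (lintegral_modeCoeff_le hF k).trans_lt ((memLp_two_iff_lintegral hF.1).1 hF)
  exact lt_top_of_two_pi_mul h

open scoped Classical in
/-- The Fourier coefficient in `x` as an element of `L²(ℝ)`. -/
noncomputable def modeLp (k : ℤ) (F : Torus × ℝ → ℝ) : L2R :=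
  if h : MemLp (modeCoeff k F) 2 volume then h.toLp else 0

lemma rep_modeLp (hF : MemLp F 2 volume) (k : ℤ) : Rep (modeLp k F) (modeCoeff k F) := by
  have h := memLp_modeCoeff hF k
  rw [modeLp, dif_pos h]
  exact h.coeFn_toLp

lemma enorm_modeLp_sq (hF : MemLp F 2 volume) (k : ℤ) :
    ‖modeLp k F‖ₑ ^ 2 = ∫⁻ y, ‖modeCoeff k F y‖ₑ ^ 2 :=
  enorm_sq_eq (rep_modeLp hF k)

lemma lintegral_sq_eq_tsum_modeLp (hF : MemLp F 2 volume) :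
    ∫⁻ p, ‖F p‖ₑ ^ 2 = ENNReal.ofReal (2 * Real.pi) * ∑' k : ℤ, ‖modeLp k F‖ₑ ^ 2 := by
  simp only [lintegral_sq_eq_tsum hF, enorm_modeLp_sq hF]

/-- Polarized Parseval. Sum and integral may be exchanged because each product is dominated by the
sum of two squares. -/
lemma enorm_integral_mul_le (hF : MemLp F 2 volume) (hG : MemLp G 2 volume) :
    ‖∫ p, F p * G p‖ₑ ≤
      ENNReal.ofReal (2 * Real.pi) * ∑' k : ℤ, ‖inner ℂ (modeLp k G) (modeLp k F)‖ₑ := by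
  have hint : Integrable (fun p => (F p * G p : ℝ)) (volume.prod volume) :=
    (MemLp.integrable_mul hF hG :)
  have hm : ∀ k : ℤ, AEStronglyMeasurable (fun y =>
      (starRingEnd ℂ) (modeCoeff k G y) * modeCoeff k F y) volume := fun k =>
    (Complex.continuous_conj.comp_aestronglyMeasurable
      (aestronglyMeasurable_modeCoeff hG.1 k)).mul (aestronglyMeasurable_modeCoeff hF.1 k)
  have hfin : ∑' k : ℤ, ∫⁻ y, ‖(starRingEnd ℂ) (modeCoeff k G y) * modeCoeff k F y‖ₑ ≠ ⊤ := by
    have hb : ∀ k : ℤ, ∫⁻ y, ‖(starRingEnd ℂ) (modeCoeff k G y) * modeCoeff k F y‖ₑ ≤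
        (∫⁻ y, ‖modeCoeff k G y‖ₑ ^ 2) + ∫⁻ y, ‖modeCoeff k F y‖ₑ ^ 2 := by
      intro k
      rw [← lintegral_add_left'
        (f := fun y => ‖modeCoeff k G y‖ₑ ^ 2)
        ((aestronglyMeasurable_modeCoeff hG.1 k).enorm.pow_const 2)]
      refine lintegral_mono fun y => ?_
      rw [enorm_mul, RCLike.enorm_conj]
      rcases le_total ‖modeCoeff k G y‖ₑ ‖modeCoeff k F y‖ₑ with h | h
      · exact le_add_left (by rw [sq]; gcongr)
      · exact le_add_right (by rw [sq]; gcongr)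
    refine ne_top_of_le_ne_top ?_ (ENNReal.tsum_le_tsum hb)
    rw [ENNReal.tsum_add]
    have hs : ∀ {Q : Torus × ℝ → ℝ}, MemLp Q 2 volume →
        ∑' k : ℤ, ∫⁻ y, ‖modeCoeff k Q y‖ₑ ^ 2 ≠ ⊤ := by
      intro Q hQ
      have h := (memLp_two_iff_lintegral hQ.1).1 hQ
      rw [lintegral_sq_eq_tsum hQ] at h
      exact (lt_top_of_two_pi_mul h).ne
    exact ENNReal.add_ne_top.2 ⟨hs hG, hs hF⟩
  have key : ((∫ p, F p * G p : ℝ) : ℂ) =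
      (2 * Real.pi : ℝ) • ∑' k : ℤ, inner ℂ (modeLp k G) (modeLp k F) := by
    have h1 : ∀ k : ℤ, inner ℂ (modeLp k G) (modeLp k F) =
        ∫ y, (starRingEnd ℂ) (modeCoeff k G y) * modeCoeff k F y := fun k =>
      inner_eq_integral (rep_modeLp hG k) (rep_modeLp hF k)
    simp only [h1]
    rw [← integral_tsum hm hfin, ← integral_smul, Measure.volume_eq_prod,
      integral_prod_symm _ hint, ← integral_complex_ofReal]
    refine integral_congr_ae ?_
    filter_upwards [memLp_section hF, memLp_section hG] with y hy hy'
    have h2 := (hasSum_conj_fourierCoeff_mul hy' hy).tsum_eq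
    simp only [modeCoeff]
    rw [h2, smul_smul, mul_inv_cancel₀ Real.two_pi_pos.ne', one_smul, ← integral_complex_ofReal]
    refine integral_congr_ae (Filter.Eventually.of_forall fun x => ?_)
    simp [mul_comm]
  have h3 : ‖∫ p, F p * G p‖ₑ = ‖((∫ p, F p * G p : ℝ) : ℂ)‖ₑ := by
    rw [← ofReal_norm, ← ofReal_norm, Complex.norm_real]
  rw [h3, key, enorm_smul, Real.enorm_of_nonneg Real.two_pi_pos.le]
  gcongr
  by_cases hs : ∑' k : ℤ, ‖inner ℂ (modeLp k G) (modeLp k F)‖ₑ = ⊤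
  · rw [hs]; exact le_top
  · exact enorm_tsum_le_tsum_enorm

/-! ### Plane waves as test functions -/

section Wave

variable {F G : Torus × ℝ → ℝ} {k : ℤ}

/-- The real part of `e^{ikx} ζ(y)`. -/
noncomputable def wave (k : ℤ) (ζ : ℝ → ℂ) (p : Torus × ℝ) : ℝ :=
  (fourier k p.1 * ζ p.2).re

lemma dX_wave (k : ℤ) (ζ : ℝ → ℂ) :
    dX (wave k ζ) = wave k fun y => Complex.I * k * ζ y := by
  funext p
  obtain ⟨x, y⟩ := p
  obtain ⟨x, rfl⟩ := QuotientAddGroup.mk_surjective x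
  have h1 : HasDerivAt (fun s : ℝ => (fourier k ((s : ℝ) : Torus) : ℂ))
      (2 * Real.pi * Complex.I * k / ((2 * Real.pi : ℝ) : ℂ) * fourier k (x : Torus)) (x + 0) := by
    rw [add_zero]
    exact hasDerivAt_fourier (2 * Real.pi) k x
  have h2 := (h1.comp_const_add x 0).mul_const (ζ y)
  have h3 := (Complex.reCLM.hasFDerivAt.comp_hasDerivAt (0 : ℝ) h2).deriv
  have h4 : (fun s : ℝ => wave k ζ (((x : ℝ) : Torus) + (s : Torus), y)) =
      Complex.reCLM ∘ fun s : ℝ => (fourier k ((x + s : ℝ) : Torus) : ℂ) * ζ y := by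
    funext s
    simp [wave]
  change deriv (fun s : ℝ => wave k ζ (((x : ℝ) : Torus) + (s : Torus), y)) 0 = _
  rw [h4, h3]
  have hpi : (Real.pi : ℂ) ≠ 0 := by exact_mod_cast Real.pi_ne_zero
  change (_ : ℂ).re = (_ : ℂ).re
  congr 1
  push_cast
  field_simp

lemma dY_wave {η : ℝ → ℂ} (hη : Differentiable ℝ η) (k : ℤ) :
    dY (wave k η) = wave k (deriv η) := by
  funext p
  have h2 := (hη p.2).hasDerivAt.const_mul (fourier k p.1 : ℂ)
  exact (Complex.reCLM.hasFDerivAt.comp_hasDerivAt p.2 h2).deriv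

lemma isTest_wave {η : ℝ → ℂ} (hη : IsLineTest η) (k : ℤ) : IsTest (wave k η) := by
  refine ⟨?_, ?_⟩
  · have h : (fun p : ℝ × ℝ => wave k η ((p.1 : Torus), p.2)) = fun p : ℝ × ℝ =>
        Complex.reCLM (Complex.exp (2 * Real.pi * Complex.I * k * Complex.ofRealCLM p.1 /
          ((2 * Real.pi : ℝ) : ℂ)) * η p.2) := by
      funext p
      simp only [wave, fourier_coe_apply, Complex.reCLM_apply, Complex.ofRealCLM_apply]
    rw [h]
    have := hη.smooth
    fun_prop
  · refine HasCompactSupport.intro (isCompact_univ.prod hη.compact) fun p hp => ?_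
    have : η p.2 = 0 := image_eq_zero_of_notMem_tsupport fun h => hp ⟨Set.mem_univ _, h⟩
    simp [wave, this]

lemma memLp_fourier_mul {ζ : ℝ → ℂ} {q : ℝ≥0∞} (hζ : MemLp ζ q volume) (k : ℤ) :
    MemLp (fun p : Torus × ℝ => (fourier k p.1 : ℂ) * ζ p.2) q volume := by
  have h1 : MemLp (fun p : Torus × ℝ => ζ p.2) q (volume.prod volume) := hζ.comp_snd volume
  refine h1.of_le ?_ (Filter.Eventually.of_forall fun p => ?_)
  · exact ((map_continuous (fourier k)).comp continuous_fst).aestronglyMeasurable.mul h1.1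
  · rw [norm_mul, fourier_apply, Circle.norm_coe, one_mul]

lemma memLp_wave {ζ : ℝ → ℂ} (hζ : MemLp ζ 2 volume) (k : ℤ) : MemLp (wave k ζ) 2 volume :=
  (memLp_fourier_mul hζ k).re

lemma Rep.memLp {e : L2R} {ζ : ℝ → ℂ} (he : Rep e ζ) : MemLp ζ 2 volume :=
  (memLp_congr_ae he).1 (Lp.memLp e)

/-- Test functions are real, so a wave detects only the real part of the pairing with the Fourier
mode; using iη besides η recovers the rest (`complex_eq_of_re`). -/
lemma integral_mul_wave (hF : MemLp F 2 volume) {e : L2R} {ζ : ℝ → ℂ} (he : Rep e ζ) (k : ℤ) :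
    ∫ p, F p * wave k ζ p = 2 * Real.pi * (inner ℂ e (modeLp k F)).re := by
  have hi : Integrable (fun p => F p * wave k ζ p) (volume.prod volume) :=
    (MemLp.integrable_mul hF (memLp_wave he.memLp k) :)
  have hi2 : Integrable (fun y => (starRingEnd ℂ) (ζ y) * modeCoeff k F y) volume :=
    MemLp.integrable_mul he.memLp.star (memLp_modeCoeff hF k)
  rw [inner_eq_integral he (rep_modeLp hF k), Measure.volume_eq_prod, integral_prod_symm _ hi]
  have h0 : (∫ y, (starRingEnd ℂ) (ζ y) * modeCoeff k F y).re =
      ∫ y, ((starRingEnd ℂ) (ζ y) * modeCoeff k F y).re := (integral_re hi2).symm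
  rw [h0, ← integral_const_mul]
  refine integral_congr_ae ?_
  filter_upwards [memLp_section hF] with y hy
  have hy1 : Integrable (fun x : Torus => fourier (-k) x • (F (x, y) : ℂ)) volume := by
    refine (hy.integrable (by norm_num)).norm.mono'
      ((map_continuous (fourier (-k))).aestronglyMeasurable.smul hy.1)
      (Filter.Eventually.of_forall fun x => ?_)
    rw [norm_smul, fourier_apply, Circle.norm_coe, one_mul]
  rw [modeCoeff_eq]
  have h1 : 2 * Real.pi * ((starRingEnd ℂ) (ζ y) * (((2 * Real.pi)⁻¹ : ℝ) •
      ∫ x : Torus, fourier (-k) x • (F (x, y) : ℂ))).re =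
      (∫ x : Torus, (starRingEnd ℂ) (ζ y) * (fourier (-k) x • (F (x, y) : ℂ))).re := by
    rw [integral_const_mul, mul_smul_comm, Complex.smul_re, smul_eq_mul, ← mul_assoc,
      mul_inv_cancel₀ Real.two_pi_pos.ne', one_mul]
  rw [h1]
  refine Eq.trans ?_ (integral_re (hy1.const_mul _))
  refine integral_congr_ae (Filter.Eventually.of_forall fun x => ?_)
  simp only [wave, fourier_neg, smul_eq_mul, RCLike.re_eq_complex_re]
  rw [← mul_assoc, ← map_mul, Complex.re_mul_ofReal, Complex.conj_re, mul_comm (ζ y), mul_comm]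

lemma complex_eq_of_re {z w : ℂ} (h : z.re = w.re) (h' : (-Complex.I * z).re = (-Complex.I * w).re) :
    z = w :=
  Complex.ext h (by simpa using h')

lemma fourier_integral_eq_zero (hk : k ≠ 0) : ∫ x : Torus, (fourier k x : ℂ) = 0 := by
  have h := fourierCoeff_fourier (T := 2 * Real.pi) k
  have h0 := congrFun h 0
  rw [Pi.single_eq_of_ne (Ne.symm hk), fourierCoeff, AddCircle.integral_haarAddCircle] at h0
  simpa [Real.pi_ne_zero] using h0

lemma aestronglyMeasurable_nonzeroModes (hF : AEStronglyMeasurable F volume) :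
    AEStronglyMeasurable (nonzeroModes F) volume := by
  have hF' : AEStronglyMeasurable F (volume.prod volume) := hF
  have h1 := (AEStronglyMeasurable.integral_prod_right' hF'.prod_swap).const_mul (2 * Real.pi)⁻¹
  exact hF'.sub h1.comp_snd

lemma modeCoeff_zero_nonzeroModes (F : Torus × ℝ → ℝ) (y : ℝ) :
    modeCoeff 0 (nonzeroModes F) y = 0 := by
  have h : ∫ x : Torus, nonzeroModes F (x, y) = 0 := by
    simp only [nonzeroModes]
    by_cases hi : Integrable (fun x : Torus => F (x, y)) volume
    · rw [integral_sub hi (integrable_const _), integral_const]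
      simp only [measureReal_def, AddCircle.measure_univ, smul_eq_mul,
        ENNReal.toReal_ofReal Real.two_pi_pos.le]
      field_simp
      ring
    -- On a section that is not integrable, both the average and the remaining integral are 0 by
    -- convention.
    · rw [integral_undef hi]
      simpa using integral_undef hi
  rw [modeCoeff_eq]
  simp only [neg_zero, fourier_zero, one_smul]
  rw [integral_complex_ofReal, h]
  simp

lemma modeLp_zero_nonzeroModes (F : Torus × ℝ → ℝ) (hF : MemLp (nonzeroModes F) 2 volume) :
    modeLp 0 (nonzeroModes F) = 0 := by
  have h := (rep_modeLp hF 0).congr (modeCoeff_zero_nonzeroModes F)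
  exact Lp.ext (Filter.EventuallyEq.trans h (Lp.coeFn_zero ℂ 2 volume).symm)

/-- The x-average is only locally integrable in y, but ζ has compact support and e^{ikx} has mean
zero. -/
lemma integral_nonzeroModes_mul_wave (hF : LocallyIntegrable F volume) {ζ : ℝ → ℂ}
    (hζ : Continuous ζ) (hc : HasCompactSupport ζ) (hk : k ≠ 0) :
    ∫ p, nonzeroModes F p * wave k ζ p = ∫ p, F p * wave k ζ p := by
  have hc' : HasCompactSupport fun p : Torus × ℝ => ζ p.2 := by
    refine HasCompactSupport.intro (isCompact_univ.prod hc) fun p hp => ?_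
    exact image_eq_zero_of_notMem_tsupport fun h => hp ⟨Set.mem_univ _, h⟩
  have h1 : Integrable (fun p : Torus × ℝ => (F p : ℂ) * ζ p.2) (volume.prod volume) := by
    have := hF.integrable_smul_right_of_hasCompactSupport (hζ.comp continuous_snd) hc'
    exact this.congr (Filter.Eventually.of_forall fun p => Complex.real_smul)
  have h2 : Integrable (fun y : ℝ => (((2 * Real.pi)⁻¹ * ∫ x : Torus, F (x, y) : ℝ) : ℂ) * ζ y)
      volume := by
    have := (h1.integral_prod_right).const_mul (((2 * Real.pi)⁻¹ : ℝ) : ℂ)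
    refine this.congr (Filter.Eventually.of_forall fun y => ?_)
    simp only
    rw [integral_mul_const, integral_complex_ofReal]
    push_cast
    ring
  have hmul : ∀ {R : Torus × ℝ → ℂ}, Integrable R (volume.prod volume) →
      Integrable (fun p => (fourier k p.1 : ℂ) * R p) (volume.prod volume) := by
    intro R hR
    refine hR.norm.mono' (((map_continuous (fourier k)).comp
      continuous_fst).aestronglyMeasurable.mul hR.1) (Filter.Eventually.of_forall fun p => ?_)
    rw [norm_mul, fourier_apply, Circle.norm_coe, one_mul]
  have h3 := hmul (h2.comp_snd (volume : Measure Torus))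
  have h4 : ∫ p : Torus × ℝ, ((2 * Real.pi)⁻¹ * ∫ x : Torus, F (x, p.2)) * wave k ζ p = 0 := by
    have h5 : ∫ p : Torus × ℝ, (fourier k p.1 : ℂ) *
        ((((2 * Real.pi)⁻¹ * ∫ x : Torus, F (x, p.2) : ℝ) : ℂ) * ζ p.2) = 0 := by
      rw [Measure.volume_eq_prod, integral_prod_symm _ h3]
      simp only [integral_mul_const, fourier_integral_eq_zero hk, zero_mul, integral_zero]
    have h6 := integral_re h3
    rw [Measure.volume_eq_prod] at h5 ⊢
    rw [h5] at h6
    simp only [RCLike.re_eq_complex_re, Complex.zero_re] at h6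
    rw [← h6]
    refine integral_congr_ae (Filter.Eventually.of_forall fun p => ?_)
    simp only [wave]
    rw [mul_left_comm, Complex.re_ofReal_mul]
  have h7 : Integrable (fun p : Torus × ℝ =>
      ((2 * Real.pi)⁻¹ * ∫ x : Torus, F (x, p.2)) * wave k ζ p) (volume.prod volume) := by
    refine h3.re.congr (Filter.Eventually.of_forall fun p => ?_)
    simp only [wave, RCLike.re_eq_complex_re]
    rw [mul_left_comm, Complex.re_ofReal_mul]
  have h8 : Integrable (fun p : Torus × ℝ => F p * wave k ζ p) (volume.prod volume) := by
    refine (hmul h1).re.congr (Filter.Eventually.of_forall fun p => ?_)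
    simp only [wave, RCLike.re_eq_complex_re]
    rw [mul_left_comm, Complex.re_ofReal_mul]
  simp only [nonzeroModes, sub_mul]
  rw [Measure.volume_eq_prod] at h4 ⊢
  rw [integral_sub h8 h7, h4, sub_zero]

end Wave

/-! ### From the weak equation to its Fourier modes -/

section WeakToMode

variable {u : ℝ → ℝ} {ν σ : ℝ} {A : (Torus × ℝ → ℝ) → Torus × ℝ → ℝ} {fin : Torus × ℝ → ℝ}
  {f : ℝ → Torus × ℝ → ℝ} {k : ℤ}

lemma IsLineTest.const_mul {η : ℝ → ℂ} (hη : IsLineTest η) (c : ℂ) :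
    IsLineTest fun y => c * η y :=
  ⟨contDiff_const.mul hη.smooth, hη.compact.mul_left⟩

lemma modeAdjoint_const_mul (u : ℝ → ℝ) (κ ν σ : ℝ) (η : ℝ → ℂ) (c : ℂ) :
    (modeAdjoint u κ ν σ fun y => c * η y) = fun y => c * modeAdjoint u κ ν σ η y := by
  funext y
  have h : deriv (fun y => c * η y) = fun y => c * deriv η y :=
    funext fun y => deriv_const_mul_field c
  simp only [modeAdjoint, h, deriv_const_mul_field]
  ring

lemma continuous_modeAdjoint (hu : Continuous u) (κ ν σ : ℝ) {η : ℝ → ℂ} (hη : IsLineTest η) :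
    Continuous (modeAdjoint u κ ν σ η) := by
  have h1 := hη.smooth.continuous
  have h2 := hη.deriv.deriv.smooth.continuous
  unfold modeAdjoint
  fun_prop

lemma hasCompactSupport_modeAdjoint (u : ℝ → ℝ) (κ ν σ : ℝ) {η : ℝ → ℂ} (hη : IsLineTest η) :
    HasCompactSupport (modeAdjoint u κ ν σ η) := by
  have h := (HasCompactSupport.mul_left (f := fun y => Complex.I * κ * u y - ν * σ) hη.compact).add
    (HasCompactSupport.mul_left (f := fun _ => (ν : ℂ)) hη.deriv.deriv.compact)
  have e : modeAdjoint u κ ν σ η = (fun y => Complex.I * κ * u y - ν * σ) * η +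
      (fun _ => (ν : ℂ)) * deriv (deriv η) := by
    funext y
    simp only [modeAdjoint, Pi.add_apply, Pi.mul_apply]
    ring
  rw [e]
  exact h

lemma inner_I_smul (e x : L2R) : inner ℂ (Complex.I • e) x = -Complex.I * inner ℂ e x := by
  rw [inner_smul_left, Complex.conj_I]

lemma norm_modeLp_le {F : Torus × ℝ → ℝ} (hF : MemLp F 2 volume) {M : ℝ}
    (h : eLpNorm F 2 volume ≤ ENNReal.ofReal M) (k : ℤ) : ‖modeLp k F‖ ≤ max M 0 := by
  have h1 := lintegral_modeCoeff_le hF k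
  rw [← enorm_modeLp_sq hF, ← eLpNorm_two_sq] at h1
  have h2 : ‖modeLp k F‖ₑ ^ 2 ≤ ENNReal.ofReal M ^ 2 := by
    calc ‖modeLp k F‖ₑ ^ 2 = 1 * ‖modeLp k F‖ₑ ^ 2 := (one_mul _).symm
      _ ≤ ENNReal.ofReal (2 * Real.pi) * ‖modeLp k F‖ₑ ^ 2 := by
        gcongr
        rw [ENNReal.one_le_ofReal]
        linarith [Real.pi_gt_three]
      _ ≤ eLpNorm F 2 volume ^ 2 := h1
      _ ≤ _ := by gcongr
  have h3 : ‖modeLp k F‖ₑ ≤ ENNReal.ofReal M := (ENNReal.pow_le_pow_left_iff two_ne_zero).1 h2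
  rw [← ofReal_norm, ENNReal.ofReal_le_ofReal_iff'] at h3
  exact h3.elim (fun h => h.trans (le_max_left _ _)) fun h => h.trans (le_max_right _ _)

/-- The hypothesis `hA` treats both diffusions at once: on waves they act as ν(∂_yy - σ), with σ = 0
or σ = k². -/
lemma IsWeakSolution.isModeSol (hf : IsWeakSolution u A fin f) (hu : Continuous u) (hk : k ≠ 0)
    (hfin : MemLp (nonzeroModes fin) 2 volume)
    (hft : ∀ t, 0 ≤ t → MemLp (nonzeroModes (f t)) 2 volume)
    (hA : ∀ η, IsLineTest η → ∀ p,
      u p.2 * dX (wave k η) p + A (wave k η) p = wave k (modeAdjoint u k ν σ η) p) :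
    IsModeSol u k ν σ (modeLp k (nonzeroModes fin)) fun t => modeLp k (nonzeroModes (f t)) := by
  have hpi := Real.two_pi_pos
  have hI : ∀ {η : ℝ → ℂ} {e : L2R}, Rep e η → Rep (Complex.I • e) fun y => Complex.I * η y :=
    fun h => h.smul _
  have hIa : ∀ {η : ℝ → ℂ} {a : L2R}, Rep a (modeAdjoint u k ν σ η) →
      Rep (Complex.I • a) (modeAdjoint u k ν σ fun y => Complex.I * η y) := by
    intro η a h
    rw [modeAdjoint_const_mul]
    exact h.smul _
  have hgen : ∀ η e, IsLineTest η → Rep e η → ∀ {F : Torus × ℝ → ℝ},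
      LocallyIntegrable F volume → MemLp (nonzeroModes F) 2 volume →
      ∫ p, F p * wave k η p = 2 * Real.pi * (inner ℂ e (modeLp k (nonzeroModes F))).re := by
    intro η e hη he F hF hF2
    rw [← integral_mul_wave hF2 he,
      integral_nonzeroModes_mul_wave hF hη.smooth.continuous hη.compact hk]
  have hrhs : ∀ η a, IsLineTest η → Rep a (modeAdjoint u k ν σ η) → ∀ s, 0 ≤ s →
      ∫ p, f s p * (u p.2 * dX (wave k η) p + A (wave k η) p) =
        2 * Real.pi * (inner ℂ a (modeLp k (nonzeroModes (f s)))).re := by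
    intro η a hη ha s hs
    simp only [hA η hη]
    rw [← integral_mul_wave (hft s hs) ha, integral_nonzeroModes_mul_wave
      (hf.locallyIntegrable s hs) (continuous_modeAdjoint hu _ _ _ hη)
      (hasCompactSupport_modeAdjoint u _ _ _ hη) hk]
  have hnn : ∀ {t s : ℝ}, 0 ≤ t → s ∈ Set.uIoc 0 t → 0 ≤ s := by
    intro t s ht hs
    rw [Set.uIoc_of_le ht] at hs
    exact hs.1.le
  have hint : ∀ η a, IsLineTest η → Rep a (modeAdjoint u k ν σ η) → ∀ t, 0 ≤ t →
      IntervalIntegrable (fun s => (inner ℂ a (modeLp k (nonzeroModes (f s)))).re) volume 0 t := by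
    intro η a hη ha t ht
    refine ((hf.intervalIntegrable _ (isTest_wave hη k) t ht).const_mul (2 * Real.pi)⁻¹).congr ?_
    refine fun s hs => ?_
    simp only
    rw [hrhs η a hη ha s (hnn ht hs), inv_mul_cancel_left₀ hpi.ne']
  have hintC : ∀ η a, IsLineTest η → Rep a (modeAdjoint u k ν σ η) → ∀ t, 0 ≤ t →
      IntervalIntegrable (fun s => inner ℂ a (modeLp k (nonzeroModes (f s)))) volume 0 t := by
    intro η a hη ha t ht
    have h1 := hint η a hη ha t ht
    have h2 := hint _ _ (hη.const_mul Complex.I) (hIa ha) t ht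
    rw [intervalIntegrable_iff] at h1 h2 ⊢
    have h3 := h1.ofReal (𝕜 := ℂ) |>.add ((h2.ofReal (𝕜 := ℂ)).mul_const Complex.I)
    refine h3.congr (Filter.Eventually.of_forall fun s => ?_)
    simp only [inner_I_smul, Pi.add_apply]
    apply Complex.ext <;> simp
  have hre : ∀ η e a, IsLineTest η → Rep e η → Rep a (modeAdjoint u k ν σ η) → ∀ t, 0 ≤ t →
      (inner ℂ e (modeLp k (nonzeroModes (f t)))).re =
        (inner ℂ e (modeLp k (nonzeroModes fin)) +
          ∫ s in (0 : ℝ)..t, inner ℂ a (modeLp k (nonzeroModes (f s)))).re := by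
    intro η e a hη he ha t ht
    have h1 := hf.weak_eq _ (isTest_wave hη k) t ht
    rw [hgen η e hη he (hf.locallyIntegrable t ht) (hft t ht),
      hgen η e hη he hf.locallyIntegrable_init hfin,
      intervalIntegral.integral_congr_ae (Filter.Eventually.of_forall fun s hs =>
        hrhs η a hη ha s (hnn ht hs)), intervalIntegral.integral_const_mul, ← mul_add] at h1
    rw [mul_left_cancel₀ hpi.ne' h1, Complex.add_re]
    congr 1
    exact Complex.reCLM.intervalIntegral_comp_comm (hintC η a hη ha t ht)
  refine ⟨fun T => ?_, hintC, fun η e a hη he ha t ht => ?_⟩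
  · obtain ⟨M, hM⟩ := hf.locallyBounded (max T 0) (le_max_right _ _)
    exact ⟨max M 0, fun t ht => norm_modeLp_le (hft t ht.1)
      (hM t ht.1 (ht.2.trans (le_max_left _ _))) k⟩
  · refine complex_eq_of_re (hre η e a hη he ha t ht) ?_
    have h := hre _ _ _ (hη.const_mul Complex.I) (hI he) (hIa ha) t ht
    simp only [inner_I_smul, intervalIntegral.integral_const_mul] at h
    rw [h, mul_add]

lemma IsWeakSolution.memLp_nonzeroModes (hf : IsWeakSolution u A fin f) {t : ℝ} (ht : 0 ≤ t) :
    MemLp (nonzeroModes (f t)) 2 volume := by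
  obtain ⟨M, hM⟩ := hf.locallyBounded t ht
  exact ⟨aestronglyMeasurable_nonzeroModes (hf.locallyIntegrable t ht).aestronglyMeasurable,
    (hM t ht le_rfl).trans_lt ENNReal.ofReal_lt_top⟩

lemma wave_adjoint_hypo (u : ℝ → ℝ) (ν : ℝ) {η : ℝ → ℂ} (hη : IsLineTest η) (p : Torus × ℝ) :
    u p.2 * dX (wave k η) p + hypoDiffusion ν (wave k η) p =
      wave k (modeAdjoint u k ν 0 η) p := by
  rw [hypoDiffusion, dY_wave (hη.smooth.differentiable (by simp)),
    dY_wave (hη.deriv.smooth.differentiable (by simp)), dX_wave]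
  simp only [wave, modeAdjoint]
  rw [← Complex.re_ofReal_mul, ← Complex.re_ofReal_mul, ← Complex.add_re]
  congr 1
  push_cast
  ring

lemma wave_adjoint_full (u : ℝ → ℝ) (ν : ℝ) {η : ℝ → ℂ} (hη : IsLineTest η) (p : Torus × ℝ) :
    u p.2 * dX (wave k η) p + fullDiffusion ν (wave k η) p =
      wave k (modeAdjoint u k ν ((k : ℝ) ^ 2) η) p := by
  rw [fullDiffusion, dY_wave (hη.smooth.differentiable (by simp)),
    dY_wave (hη.deriv.smooth.differentiable (by simp)), dX_wave, dX_wave]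
  simp only [wave, modeAdjoint]
  rw [← Complex.re_ofReal_mul, ← Complex.add_re, ← Complex.re_ofReal_mul, ← Complex.add_re]
  congr 1
  push_cast
  linear_combination (ν * fourier k p.1 * k ^ 2 * η p.2) * Complex.I_sq

end WeakToMode

/-! ### Derivatives of test functions and of modes -/

section TestDerivatives

variable {φ ψ : Torus × ℝ → ℝ}

lemma isOpenQuotientMap_lift :
    IsOpenQuotientMap (fun p : ℝ × ℝ => (((p.1 : ℝ) : Torus), p.2)) :=
  (QuotientAddGroup.isOpenQuotientMap_mk (N := AddSubgroup.zmultiples (2 * Real.pi))).prodMap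
    IsOpenQuotientMap.id

lemma IsTest.continuous (hφ : IsTest φ) : Continuous φ :=
  isOpenQuotientMap_lift.isQuotientMap.continuous_iff.2 hφ.smooth.continuous

lemma IsTest.memLp (hφ : IsTest φ) (q : ℝ≥0∞) : MemLp φ q volume :=
  hφ.continuous.memLp_of_hasCompactSupport hφ.compact

lemma IsTest.hasDerivAt_dX (hφ : IsTest φ) (x y : ℝ) :
    HasDerivAt (fun s : ℝ => φ ((s : Torus), y)) (dX φ ((x : Torus), y)) x := by
  have h1 : Differentiable ℝ fun s : ℝ => φ ((s : Torus), y) :=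
    (hφ.smooth.comp (contDiff_id.prodMk contDiff_const)).differentiable (by simp)
  have h2 : dX φ ((x : Torus), y) = deriv (fun s : ℝ => φ ((s : Torus), y)) x := by
    have h3 := deriv_comp_const_add (fun s : ℝ => φ ((s : Torus), y)) x 0
    rw [add_zero] at h3
    rw [← h3]
    rfl
  rw [h2]
  exact (h1 x).hasDerivAt

lemma IsTest.differentiable_section (hφ : IsTest φ) (x : Torus) :
    Differentiable ℝ fun s : ℝ => φ (x, s) := by
  obtain ⟨x, rfl⟩ := QuotientAddGroup.mk_surjective x
  exact (hφ.smooth.comp (contDiff_const.prodMk contDiff_id)).differentiable (by simp)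

lemma IsTest.hasDerivAt_dY (hφ : IsTest φ) (x : Torus) (y : ℝ) :
    HasDerivAt (fun s : ℝ => φ (x, s)) (dY φ (x, y)) y :=
  (hφ.differentiable_section x y).hasDerivAt

lemma IsTest.dX (hφ : IsTest φ) : IsTest (dX φ) := by
  refine ⟨?_, HasCompactSupport.intro hφ.compact fun p hp => ?_⟩
  · have h : (fun p : ℝ × ℝ => ShearFlow.dX φ ((p.1 : Torus), p.2)) = fun p =>
        fderiv ℝ (fun p : ℝ × ℝ => φ ((p.1 : Torus), p.2)) p (1, 0) := by
      funext p
      have h1 := (hφ.smooth.differentiable (by simp) p).hasFDerivAt.comp_hasDerivAt p.1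
        ((hasDerivAt_id p.1).prodMk (hasDerivAt_const p.1 p.2))
      exact (hφ.hasDerivAt_dX p.1 p.2).unique h1
    rw [h]
    exact (hφ.smooth.fderiv_right (m := ∞) le_rfl).clm_apply contDiff_const
  · have h1 : φ =ᶠ[nhds p] 0 := notMem_tsupport_iff_eventuallyEq.1 hp
    have h2 : Filter.Tendsto (fun s : ℝ => ((p.1 + (s : Torus), p.2) : Torus × ℝ)) (nhds 0)
        (nhds p) := by
      have hc : Continuous fun s : ℝ => ((p.1 + (s : Torus), p.2) : Torus × ℝ) :=
        (continuous_const.add (AddCircle.continuous_mk' _)).prodMk continuous_const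
      simpa using hc.tendsto 0
    have h3 := h2.eventually h1
    rw [ShearFlow.dX, Filter.EventuallyEq.deriv_eq (f := fun _ => (0 : ℝ)) h3, deriv_const]

lemma IsTest.dY (hφ : IsTest φ) : IsTest (dY φ) := by
  refine ⟨?_, HasCompactSupport.intro hφ.compact fun p hp => ?_⟩
  · have h : (fun p : ℝ × ℝ => ShearFlow.dY φ ((p.1 : Torus), p.2)) = fun p =>
        fderiv ℝ (fun p : ℝ × ℝ => φ ((p.1 : Torus), p.2)) p (0, 1) := by
      funext p
      have h1 := (hφ.smooth.differentiable (by simp) p).hasFDerivAt.comp_hasDerivAt p.2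
        ((hasDerivAt_const p.2 p.1).prodMk (hasDerivAt_id p.2))
      exact (hφ.hasDerivAt_dY (p.1 : Torus) p.2).unique h1
    rw [h]
    exact (hφ.smooth.fderiv_right (m := ∞) le_rfl).clm_apply contDiff_const
  · have h1 : φ =ᶠ[nhds p] 0 := notMem_tsupport_iff_eventuallyEq.1 hp
    have h2 : Filter.Tendsto (fun s : ℝ => ((p.1, s) : Torus × ℝ)) (nhds p.2) (nhds p) :=
      (continuous_const.prodMk continuous_id).tendsto p.2
    have h3 := h2.eventually h1
    rw [ShearFlow.dY, Filter.EventuallyEq.deriv_eq (f := fun _ => (0 : ℝ)) h3, deriv_const]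

lemma IsTest.hasCompactSupport_section (hφ : IsTest φ) (x : Torus) :
    HasCompactSupport fun s : ℝ => φ (x, s) := by
  refine HasCompactSupport.intro (hφ.compact.image continuous_snd) fun y hy => ?_
  exact image_eq_zero_of_notMem_tsupport fun h => hy ⟨_, h, rfl⟩

lemma IsTest.integrable_section_mul (hφ : IsTest φ) (hψ : IsTest ψ) (x : Torus) :
    Integrable (fun s : ℝ => φ (x, s) * ψ (x, s)) volume := by
  refine Continuous.integrable_of_hasCompactSupport ?_ (hφ.hasCompactSupport_section x).mul_right
  have h1 := (hφ.differentiable_section x).continuous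
  have h2 := (hψ.differentiable_section x).continuous
  exact h1.mul h2

lemma IsTest.isWeakDerivY (hφ : IsTest φ) : IsWeakDerivY φ (ShearFlow.dY φ) where
  locallyIntegrable := hφ.continuous.locallyIntegrable
  locallyIntegrable_deriv := hφ.dY.continuous.locallyIntegrable
  integral_eq ψ hψ := by
    have h1 : Integrable (fun p => φ p * ShearFlow.dY ψ p) (volume.prod volume) :=
      (MemLp.integrable_mul (hφ.memLp 2) (hψ.dY.memLp 2) :)
    have h2 : Integrable (fun p => ShearFlow.dY φ p * ψ p) (volume.prod volume) :=
      (MemLp.integrable_mul (hφ.dY.memLp 2) (hψ.memLp 2) :)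
    rw [Measure.volume_eq_prod, integral_prod _ h1, integral_prod _ h2, ← integral_neg]
    refine integral_congr_ae (Filter.Eventually.of_forall fun x => ?_)
    exact integral_mul_deriv_eq_deriv_mul_of_integrable (fun y _ => hφ.hasDerivAt_dY x y)
      (fun y _ => hψ.hasDerivAt_dY x y) (hφ.integrable_section_mul hψ.dY x)
      (hφ.dY.integrable_section_mul hψ x) (hφ.integrable_section_mul hψ x)

lemma modeCoeff_dX (hφ : IsTest φ) (k : ℤ) (y : ℝ) :
    modeCoeff k (dX φ) y = Complex.I * k * modeCoeff k φ y := by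
  have hpi : (Real.pi : ℂ) ≠ 0 := by exact_mod_cast Real.pi_ne_zero
  set g : ℝ → ℂ := fun x => (fourier (-k) (x : Torus) : ℂ) with hg
  have hgd : ∀ x, HasDerivAt g (-(Complex.I * k) * g x) x := by
    intro x
    have := hasDerivAt_fourier_neg (2 * Real.pi) k x
    convert this using 1
    simp only [hg]
    push_cast
    field_simp
  have hφd : ∀ x : ℝ, HasDerivAt (fun s : ℝ => (φ ((s : Torus), y) : ℂ))
      ((dX φ ((x : Torus), y) : ℝ) : ℂ) x := fun x => (hφ.hasDerivAt_dX x y).ofReal_comp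
  have hcg : Continuous g := continuous_iff_continuousAt.2 fun x => (hgd x).continuousAt
  have hsec : ∀ {χ : Torus × ℝ → ℝ}, IsTest χ →
      Continuous fun s : ℝ => (χ ((s : Torus), y) : ℂ) := fun hχ =>
    Complex.continuous_ofReal.comp (hχ.continuous.comp
      ((AddCircle.continuous_mk' _).prodMk continuous_const))
  have h := intervalIntegral.integral_eq_sub_of_hasDerivAt (a := 0) (b := 0 + 2 * Real.pi)
    (fun x _ => (hgd x).mul (hφd x)) (by
      have h1 := hsec hφ
      have h2 := hsec hφ.dX
      exact ((continuous_const.mul hcg).mul h1 |>.add (hcg.mul h2)).intervalIntegrable _ _)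
  have hper : ((0 + 2 * Real.pi : ℝ) : Torus) = ((0 : ℝ) : Torus) := by
    rw [zero_add]
    exact AddCircle.coe_period _
  simp only [hg, Pi.mul_apply, hper, sub_self] at h
  rw [modeCoeff, modeCoeff, fourierCoeff_eq_intervalIntegral _ _ 0,
    fourierCoeff_eq_intervalIntegral _ _ 0, mul_smul_comm]
  congr 1
  rw [intervalIntegral.integral_add] at h
  · simp only [smul_eq_mul, ← intervalIntegral.integral_const_mul]
    rw [← sub_eq_zero, ← h, sub_eq_add_neg, add_comm, ← intervalIntegral.integral_neg]
    congr 1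
    refine intervalIntegral.integral_congr fun x _ => ?_
    ring
  · exact ((continuous_const.mul hcg).mul (hsec hφ)).intervalIntegrable _ _
  · exact (hcg.mul (hsec hφ.dX)).intervalIntegrable _ _

/-- Since |k| ≥ 1, the homogeneous norm of the test function controls its non-zero modes, as the
Ḣ^{-1} bound requires. -/
lemma norm_modeLp_le_dX (hφ : IsTest φ) {k : ℤ} (hk : k ≠ 0) :
    ‖modeLp k φ‖ ≤ ‖modeLp k (dX φ)‖ := by
  have h1 : Rep (modeLp k (dX φ)) fun y => (Complex.I * k) * modeCoeff k φ y :=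
    (rep_modeLp (hφ.dX.memLp 2) k).congr (modeCoeff_dX hφ k)
  rw [h1.eq ((rep_modeLp (hφ.memLp 2) k).smul (Complex.I * k)), norm_smul, norm_mul,
    Complex.norm_I, one_mul]
  refine le_mul_of_one_le_left (norm_nonneg _) ?_
  rw [Complex.norm_intCast]
  exact_mod_cast Int.one_le_abs hk

lemma norm_trans_modeLp_sub_le {F G : Torus × ℝ → ℝ} (hFG : IsWeakDerivY F G)
    (hF : MemLp F 2 volume) (hG : MemLp G 2 volume) (k : ℤ) {h : ℝ} (hh : 0 < h) :
    ‖trans h (modeLp k F) - modeLp k F‖ ≤ h * ‖modeLp k G‖ := by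
  refine norm_trans_sub_le_of_weak (fun η e a hη he ha => ?_) hh
  have hre : ∀ η e a, IsLineTest η → Rep e η → Rep a (deriv η) →
      (inner ℂ a (modeLp k F)).re = (-inner ℂ e (modeLp k G)).re := by
    intro η e a hη he ha
    have h1 := hFG.integral_eq _ (isTest_wave hη k)
    rw [dY_wave (hη.smooth.differentiable (by simp)), integral_mul_wave hF ha,
      integral_mul_wave hG he, ← mul_neg] at h1
    exact mul_left_cancel₀ Real.two_pi_pos.ne' h1
  refine complex_eq_of_re (hre η e a hη he ha) ?_
  have h2 := hre _ _ (Complex.I • a) (hη.const_mul Complex.I) (he.smul _) (by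
    rw [show deriv (fun y => Complex.I * η y) = fun y => Complex.I * deriv η y from
      funext fun y => deriv_const_mul_field _]
    exact ha.smul _)
  simp only [inner_I_smul] at h2
  rw [h2, mul_neg]

end TestDerivatives

/-! ### Summation over the modes -/

lemma weightedNorm_sq (u : ℝ → ℝ) (F : Torus × ℝ → ℝ) :
    weightedNorm u F ^ 2 = (∫⁻ p, ‖F p‖ₑ ^ 2) + ∫⁻ p, ‖deriv u p.2 * F p‖ₑ ^ 2 := by
  rw [weightedNorm, eLpNorm_two_sq, eLpNorm_two_sq, ← ENNReal.rpow_natCast, ← ENNReal.rpow_mul]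
  norm_num

lemma lintegral_sq_le_weightedNorm_sq (u : ℝ → ℝ) (F : Torus × ℝ → ℝ) :
    ∫⁻ p, ‖F p‖ₑ ^ 2 ≤ weightedNorm u F ^ 2 := by
  rw [weightedNorm_sq]
  exact le_self_add

lemma tsum_mul_sq_le (a b : ℤ → ℝ≥0∞) :
    (∑' k, a k * b k) ^ 2 ≤ (∑' k, a k ^ 2) * ∑' k, b k ^ 2 := by
  have h := ENNReal.lintegral_mul_le_Lp_mul_Lq (Measure.count : Measure ℤ) Real.HolderConjugate.two_two
    (f := a) (g := b) Measurable.of_discrete.aemeasurable Measurable.of_discrete.aemeasurable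
  simp only [lintegral_count, Pi.mul_apply] at h
  calc (∑' k, a k * b k) ^ 2 ≤ ((∑' k, a k ^ (2 : ℝ)) ^ (1 / 2 : ℝ) *
        (∑' k, b k ^ (2 : ℝ)) ^ (1 / 2 : ℝ)) ^ 2 := pow_le_pow_left' h 2
    _ = _ := by
      rw [mul_pow, ← ENNReal.rpow_natCast, ← ENNReal.rpow_natCast, ← ENNReal.rpow_mul,
        ← ENNReal.rpow_mul]
      norm_num

lemma add_sq_le_four_mul (a b : ℝ≥0∞) : (a + b) ^ 2 ≤ 4 * (a ^ 2 + b ^ 2) := by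
  rcases le_total a b with h | h
  · calc (a + b) ^ 2 ≤ (b + b) ^ 2 := by gcongr
      _ = 4 * b ^ 2 := by ring
      _ ≤ _ := by gcongr; exact le_add_self
  · calc (a + b) ^ 2 ≤ (a + a) ^ 2 := by gcongr
      _ = 4 * a ^ 2 := by ring
      _ ≤ _ := by gcongr; exact le_self_add

lemma tsum_add_mul_add_sq_le (a b c d : ℤ → ℝ≥0∞) :
    (∑' k, (a k + b k) * (c k + d k)) ^ 2 ≤
      16 * ((∑' k, a k ^ 2 + ∑' k, b k ^ 2) * (∑' k, c k ^ 2 + ∑' k, d k ^ 2)) := by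
  have h : ∀ a b : ℤ → ℝ≥0∞, ∑' k, (a k + b k) ^ 2 ≤ 4 * (∑' k, a k ^ 2 + ∑' k, b k ^ 2) := by
    intro a b
    rw [← ENNReal.tsum_add, ← ENNReal.tsum_mul_left]
    exact ENNReal.tsum_le_tsum fun k => add_sq_le_four_mul _ _
  calc _ ≤ _ := tsum_mul_sq_le _ _
    _ ≤ (4 * (∑' k, a k ^ 2 + ∑' k, b k ^ 2)) * (4 * (∑' k, c k ^ 2 + ∑' k, d k ^ 2)) := by
      gcongr
      · exact h a b
      · exact h c d
    _ = _ := by ring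

lemma modeCoeff_mul (k : ℤ) (a : ℝ → ℝ) (F : Torus × ℝ → ℝ) (y : ℝ) :
    modeCoeff k (fun p => a p.2 * F p) y = a y * modeCoeff k F y := by
  simp only [modeCoeff, Complex.ofReal_mul]
  exact fourierCoeff.const_mul _ _ _

section Assembly

variable {U V m t : ℝ} {u : ℝ → ℝ} {σ : ℤ → ℝ} {fin : Torus × ℝ → ℝ} {f : ℝ → Torus × ℝ → ℝ}

/-- Each mode of the datum is w times a mode of Q. The decay of the dual problem in the weight w
becomes, by `lintegral_inv_mul_le`, decay of the solution in the weight 1/w. -/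
lemma lintegral_inv_mul_nonzeroModes_le (hu : IsAdmissibleShear U u) (hU : 1 ≤ U)
    (hV : V = 18 * U ^ 2) (hm : 0 ≤ m) (hmV : 200 * V * energyConst V * m ^ 2 ≤ 1)
    (hf : ∀ k : ℤ, k ≠ 0 → IsModeSol u k (m ^ 3) (σ k) (modeLp k (nonzeroModes fin))
      fun t => modeLp k (nonzeroModes (f t))) (hσ : ∀ k, 0 ≤ σ k) (ht : 0 ≤ t)
    (hfin : MemLp (nonzeroModes fin) 2 volume) (hft : MemLp (nonzeroModes (f t)) 2 volume)
    {w : ℝ →ᵇ ℝ} (hw : IsWeight V w) :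
    ∫⁻ p, ‖(w p.2)⁻¹ * nonzeroModes (f t) p‖ₑ ^ 2 ≤
      ENNReal.ofReal (4 * Real.exp (-(m / (200 * V) * t))) ^ 2 *
        ∫⁻ p, ‖(w p.2)⁻¹ * nonzeroModes fin p‖ₑ ^ 2 := by
  have hwc : Measurable fun y => (w y)⁻¹ := w.continuous.measurable.inv
  set D := 4 * Real.exp (-(m / (200 * V) * t)) with hD
  have hD0 : 0 ≤ D := by positivity
  set Q : Torus × ℝ → ℝ := fun p => (w p.2)⁻¹ * nonzeroModes fin p with hQ
  have hQm : AEStronglyMeasurable Q volume :=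
    (hwc.comp measurable_snd).aestronglyMeasurable.mul hfin.1
  rcases eq_or_ne (∫⁻ p, ‖Q p‖ₑ ^ 2) ⊤ with htop | htop
  · rw [htop, ENNReal.mul_top]
    · exact le_top
    · rw [Ne, pow_eq_zero_iff two_ne_zero, ENNReal.ofReal_eq_zero, not_le]
      positivity
  have hQ2 : MemLp Q 2 volume := (memLp_two_iff_lintegral hQm).2 htop.lt_top
  have hQk : ∀ k, modeLp k (nonzeroModes fin) = weightOp w (modeLp k Q) := fun k => by
    refine (rep_modeLp hfin k).eq (((rep_modeLp hQ2 k).weightOp w).congr fun y => ?_)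
    rw [hQ, modeCoeff_mul k fun y => (w y)⁻¹]
    have : (w y : ℂ) ≠ 0 := by exact_mod_cast (hw.pos y).ne'
    push_cast
    rw [mul_inv_cancel_left₀ this]
  have hk : ∀ k : ℤ, ∫⁻ y, ‖(w y)⁻¹‖ₑ ^ 2 * ‖modeCoeff k (nonzeroModes (f t)) y‖ₑ ^ 2 ≤
      ENNReal.ofReal D ^ 2 * ‖modeLp k Q‖ₑ ^ 2 := by
    intro k
    rcases eq_or_ne k 0 with rfl | hk0
    · simp [modeCoeff_zero_nonzeroModes]
    · have hκ : 1 ≤ |(k : ℝ)| := by exact_mod_cast Int.one_le_abs hk0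
      have h1 := lintegral_inv_mul_le hw.pos (rep_modeLp hft k) (C := D * ‖modeLp k Q‖) fun φ => by
        have := (hf k hk0).enhanced hu hU hV hm hmV hκ (hσ k) ht hw (hQk k) φ
        rw [← hD] at this
        linarith
      rw [ENNReal.ofReal_mul hD0, mul_pow, ofReal_norm] at h1
      refine le_of_eq_of_le (lintegral_congr fun y => ?_) h1
      rw [enorm_mul, mul_pow]
      congr 2
      rw [← Complex.ofReal_inv, ← ofReal_norm, ← ofReal_norm, Complex.norm_real]
  rw [lintegral_sq_eq_tsum_modeLp hQ2]
  simp only [enorm_mul, mul_pow]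
  rw [lintegral_weight_mul_sq hft (a := fun y => ‖(w y)⁻¹‖ₑ ^ 2) (hwc.enorm.pow_const 2),
    mul_left_comm]
  gcongr
  rw [← ENNReal.tsum_mul_left]
  exact ENNReal.tsum_le_tsum hk

/-- The two parts of the norm come from w = 1 and w = 1/u'. -/
lemma weightedNorm_nonzeroModes_le (hu : IsAdmissibleShear U u) (hU : 1 ≤ U)
    (hV : V = 18 * U ^ 2) (hm : 0 ≤ m) (hmV : 200 * V * energyConst V * m ^ 2 ≤ 1)
    (hf : ∀ k : ℤ, k ≠ 0 → IsModeSol u k (m ^ 3) (σ k) (modeLp k (nonzeroModes fin))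
      fun t => modeLp k (nonzeroModes (f t))) (hσ : ∀ k, 0 ≤ σ k) (ht : 0 ≤ t)
    (hfin : MemLp (nonzeroModes fin) 2 volume) (hft : MemLp (nonzeroModes (f t)) 2 volume) :
    weightedNorm u (nonzeroModes (f t)) ≤
      ENNReal.ofReal (4 * Real.exp (-(m / (200 * V) * t))) *
        weightedNorm u (nonzeroModes fin) := by
  have hUV : U ≤ V := by nlinarith
  have h1 := lintegral_inv_mul_nonzeroModes_le hu hU hV hm hmV hf hσ ht hfin hft
    (isWeight_oneWeight (V := V) (by linarith))
  have h2 := lintegral_inv_mul_nonzeroModes_le hu hU hV hm hmV hf hσ ht hfin hft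
    (isWeight_invDeriv hu hU hUV)
  have e1 : ∀ y, (oneWeight y)⁻¹ = 1 := fun y => inv_one
  have e2 : ∀ y, (invDeriv hu hU y)⁻¹ = deriv u y := fun y => inv_inv _
  simp only [e1, one_mul] at h1
  simp only [e2] at h2
  rw [← ENNReal.pow_le_pow_left_iff two_ne_zero, mul_pow, weightedNorm_sq, weightedNorm_sq, mul_add]
  exact add_le_add h1 h2

/-- The bound for one mode is a product of a factor of the datum and a factor of the test function,
so Cauchy–Schwarz in k applies. The factor 2π of Parseval is used up once by each of the two sums,
and the 4 is the square root of the 16 in `tsum_add_mul_add_sq_le`. -/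
lemma hDotNegOneNorm_nonzeroModes_le (hu : IsAdmissibleShear U u) (hU : 1 ≤ U)
    (hV : V = 18 * U ^ 2) (hm : 0 ≤ m) (hmV : 200 * V * energyConst V * m ^ 2 ≤ 1)
    (hf : ∀ k : ℤ, k ≠ 0 → IsModeSol u k (m ^ 3) (σ k) (modeLp k (nonzeroModes fin))
      fun t => modeLp k (nonzeroModes (f t))) (hσ : ∀ k, 0 ≤ σ k) (ht : 0 ≤ t)
    (hfin : MemLp (nonzeroModes fin) 2 volume) (hft : MemLp (nonzeroModes (f t)) 2 volume)
    {g : Torus × ℝ → ℝ} (hg : IsWeakDerivY (nonzeroModes fin) g) :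
    hDotNegOneNorm (nonzeroModes (f t)) ≤
      ENNReal.ofReal (4 * mixConst V * (Real.exp (-(m / (800 * V) * t)) / √(1 + t ^ 2))) *
        (weightedNorm u (nonzeroModes fin) + weightedNorm u g) := by
  have hV0 : 0 < V := by nlinarith
  have hmix : 0 < mixConst V := by unfold mixConst energyConst; positivity
  set D := mixConst V * (Real.exp (-(m / (800 * V) * t)) / √(1 + t ^ 2)) with hD
  have hD0 : 0 < D := by positivity
  rw [mul_assoc 4, ← hD]
  clear_value D
  rcases eq_or_ne (weightedNorm u g) ⊤ with htop | htop
  · rw [htop, add_top, ENNReal.mul_top]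
    · exact le_top
    · rw [Ne, ENNReal.ofReal_eq_zero, not_le]
      positivity
  have hg2 : MemLp g 2 volume :=
    (memLp_two_iff_lintegral hg.locallyIntegrable_deriv.aestronglyMeasurable).2
      ((lintegral_sq_le_weightedNorm_sq u g).trans_lt (ENNReal.pow_lt_top htop.lt_top))
  refine iSup_le fun φ => iSup_le fun hφ => iSup_le fun hφ1 => ?_
  rw [eLpNorm_two_sq, eLpNorm_two_sq] at hφ1
  have hk : ∀ k : ℤ, ‖inner ℂ (modeLp k φ) (modeLp k (nonzeroModes (f t)))‖ₑ ≤
      ENNReal.ofReal D * ((‖modeLp k (nonzeroModes fin)‖ₑ + ‖modeLp k g‖ₑ) *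
        (‖modeLp k (dX φ)‖ₑ + ‖modeLp k (dY φ)‖ₑ)) := by
    intro k
    rcases eq_or_ne k 0 with rfl | hk0
    · rw [modeLp_zero_nonzeroModes _ hft, inner_zero_right, enorm_zero]
      exact zero_le
    · have hκ : 1 ≤ |(k : ℝ)| := by exact_mod_cast Int.one_le_abs hk0
      have h1 := (hf k hk0).mixing hu hU hV hm hmV hκ (hσ k) ht (φ := modeLp k φ) (norm_nonneg _)
        (fun h hh => norm_trans_modeLp_sub_le hg hfin hg2 k hh)
        (fun h hh => norm_trans_modeLp_sub_le hφ.isWeakDerivY (hφ.memLp 2) (hφ.dY.memLp 2) k hh)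
      rw [← hD] at h1
      have h2 : ‖inner ℂ (modeLp k φ) (modeLp k (nonzeroModes (f t)))‖ ≤
          D * ((‖modeLp k (nonzeroModes fin)‖ + ‖modeLp k g‖) *
            (‖modeLp k (dX φ)‖ + ‖modeLp k (dY φ)‖)) :=
        h1.trans (by gcongr; exact norm_modeLp_le_dX hφ hk0)
      have h3 := ENNReal.ofReal_le_ofReal h2
      rwa [ENNReal.ofReal_mul hD0.le, ENNReal.ofReal_mul (by positivity),
        ENNReal.ofReal_add (norm_nonneg _) (norm_nonneg _),
        ENNReal.ofReal_add (norm_nonneg _) (norm_nonneg _), ofReal_norm, ofReal_norm, ofReal_norm,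
        ofReal_norm, ofReal_norm] at h3
  rw [← Real.norm_eq_abs, ofReal_norm, ← ENNReal.pow_le_pow_left_iff two_ne_zero]
  calc ‖∫ p, nonzeroModes (f t) p * φ p‖ₑ ^ 2
      ≤ (ENNReal.ofReal (2 * Real.pi) * ∑' k : ℤ, ENNReal.ofReal D *
          ((‖modeLp k (nonzeroModes fin)‖ₑ + ‖modeLp k g‖ₑ) *
            (‖modeLp k (dX φ)‖ₑ + ‖modeLp k (dY φ)‖ₑ))) ^ 2 := by
        gcongr
        refine (enorm_integral_mul_le hft (hφ.memLp 2)).trans ?_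
        gcongr with k
        exact hk k
    _ ≤ (ENNReal.ofReal (2 * Real.pi) * ENNReal.ofReal D) ^ 2 *
        (16 * ((∑' k, ‖modeLp k (nonzeroModes fin)‖ₑ ^ 2 + ∑' k, ‖modeLp k g‖ₑ ^ 2) *
          (∑' k, ‖modeLp k (dX φ)‖ₑ ^ 2 + ∑' k, ‖modeLp k (dY φ)‖ₑ ^ 2))) := by
        rw [ENNReal.tsum_mul_left, ← mul_assoc, mul_pow]
        gcongr
        exact tsum_add_mul_add_sq_le _ _ _ _
    _ = 16 * ENNReal.ofReal D ^ 2 *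
        ((∫⁻ p, ‖nonzeroModes fin p‖ₑ ^ 2) + ∫⁻ p, ‖g p‖ₑ ^ 2) *
          ((∫⁻ p, ‖dX φ p‖ₑ ^ 2) + ∫⁻ p, ‖dY φ p‖ₑ ^ 2) := by
        rw [lintegral_sq_eq_tsum_modeLp hfin, lintegral_sq_eq_tsum_modeLp hg2,
          lintegral_sq_eq_tsum_modeLp (hφ.dX.memLp 2), lintegral_sq_eq_tsum_modeLp (hφ.dY.memLp 2)]
        ring
    _ ≤ 16 * ENNReal.ofReal D ^ 2 *
        (weightedNorm u (nonzeroModes fin) ^ 2 + weightedNorm u g ^ 2) * 1 := by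
        gcongr
        · exact lintegral_sq_le_weightedNorm_sq _ _
        · exact lintegral_sq_le_weightedNorm_sq _ _
    _ ≤ 16 * ENNReal.ofReal D ^ 2 *
        (weightedNorm u (nonzeroModes fin) + weightedNorm u g) ^ 2 * 1 := by
        gcongr
        rw [add_sq]
        gcongr
        exact le_self_add
    _ = _ := by
        rw [ENNReal.ofReal_mul (by norm_num : (0 : ℝ) ≤ 4),
          show ENNReal.ofReal 4 = 4 by norm_num]
        ring

end Assembly

end ShearFlow

/-! ### Choice of the constants and conclusion -/

theorem theorem1p1 (U : ℝ) (hU : 1 ≤ U) :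
    ∃ C₀ ε₀ ν₀ : ℝ, 1 ≤ C₀ ∧ 0 < ε₀ ∧ ε₀ < 1 ∧ 0 < ν₀ ∧ ν₀ < 1 ∧
      ∀ u : ℝ → ℝ, ShearFlow.IsAdmissibleShear U u →
      ∀ ν : ℝ, 0 ≤ ν → ν ≤ ν₀ →
      ∀ (fin : ShearFlow.Torus × ℝ → ℝ) (f : ℝ → ShearFlow.Torus × ℝ → ℝ),
        (ShearFlow.IsWeakSolution u (ShearFlow.hypoDiffusion ν) fin f ∨
          ShearFlow.IsWeakSolution u (ShearFlow.fullDiffusion ν) fin f) →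
        ShearFlow.weightedNorm u (ShearFlow.nonzeroModes fin) < ⊤ →
        -- enhanced diffusion
        (∀ t : ℝ, 0 ≤ t →
          ShearFlow.weightedNorm u (ShearFlow.nonzeroModes (f t)) ≤
            ENNReal.ofReal (C₀ * Real.exp (-(ε₀ * ν ^ (1 / 3 : ℝ) * t))) *
              ShearFlow.weightedNorm u (ShearFlow.nonzeroModes fin)) ∧
        -- stable mixing, where `g` is the weak derivative of `fin_≠` in `y`
        (∀ g : ShearFlow.Torus × ℝ → ℝ,
          ShearFlow.IsWeakDerivY (ShearFlow.nonzeroModes fin) g →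
          ∀ t : ℝ, 0 ≤ t →
            ShearFlow.hDotNegOneNorm (ShearFlow.nonzeroModes (f t)) ≤
              ENNReal.ofReal
                  (C₀ * (Real.exp (-(ε₀ * ν ^ (1 / 3 : ℝ) * t)) / Real.sqrt (1 + t ^ 2))) *
                (ShearFlow.weightedNorm u (ShearFlow.nonzeroModes fin) +
                  ShearFlow.weightedNorm u g)) ∧
        -- inviscid mixing
        (ν = 0 → ∀ g : ShearFlow.Torus × ℝ → ℝ,
          ShearFlow.IsWeakDerivY (ShearFlow.nonzeroModes fin) g →
          ∀ t : ℝ, 0 ≤ t →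
            ShearFlow.hDotNegOneNorm (ShearFlow.nonzeroModes (f t)) ≤
              ENNReal.ofReal (C₀ / Real.sqrt (1 + t ^ 2)) *
                (ShearFlow.weightedNorm u (ShearFlow.nonzeroModes fin) +
                  ShearFlow.weightedNorm u g)) := by
  set V : ℝ := 18 * U ^ 2 with hV
  have hV1 : 1 ≤ V := by nlinarith
  have hE : 1 ≤ ShearFlow.energyConst V := by
    have := one_le_pow₀ (n := 4) hV1
    unfold ShearFlow.energyConst
    linarith
  have hmix : 1 ≤ ShearFlow.mixConst V := by
    have h2 := one_le_pow₀ (n := 2) hV1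
    unfold ShearFlow.mixConst
    nlinarith
  set q : ℝ := (200 * V * ShearFlow.energyConst V)⁻¹ with hq
  have hVE : 1 ≤ V * ShearFlow.energyConst V := one_le_mul_of_one_le_of_one_le hV1 hE
  have hq0 : 0 < q := by positivity
  have hq1 : q < 1 := inv_lt_one_of_one_lt₀ (by nlinarith)
  -- ν ≤ q³ means m = ν^{1/3} ≤ q < 1, so m² ≤ q = 1/(200VK), the smallness used in every window.
  -- The decay rate 1/(200V) of the energy is weakened to the rate 1/(800V) of the mixing estimate.
  refine ⟨4 * ShearFlow.mixConst V, 1 / (800 * V), q ^ 3, by linarith, by positivity,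
    by rw [div_lt_one (by positivity)]; linarith, by positivity,
    pow_lt_one₀ hq0.le hq1 (by norm_num), ?_⟩
  intro u hu ν hν0 hν fin f hf hfin
  have hmain : (∀ t : ℝ, 0 ≤ t →
      ShearFlow.weightedNorm u (ShearFlow.nonzeroModes (f t)) ≤
        ENNReal.ofReal (4 * ShearFlow.mixConst V *
          Real.exp (-(1 / (800 * V) * ν ^ (1 / 3 : ℝ) * t))) *
          ShearFlow.weightedNorm u (ShearFlow.nonzeroModes fin)) ∧
      ∀ g : ShearFlow.Torus × ℝ → ℝ, ShearFlow.IsWeakDerivY (ShearFlow.nonzeroModes fin) g →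
        ∀ t : ℝ, 0 ≤ t → ShearFlow.hDotNegOneNorm (ShearFlow.nonzeroModes (f t)) ≤
          ENNReal.ofReal (4 * ShearFlow.mixConst V *
            (Real.exp (-(1 / (800 * V) * ν ^ (1 / 3 : ℝ) * t)) / Real.sqrt (1 + t ^ 2))) *
          (ShearFlow.weightedNorm u (ShearFlow.nonzeroModes fin) +
            ShearFlow.weightedNorm u g) := by
    obtain ⟨m, hm0, rfl⟩ : ∃ m : ℝ, 0 ≤ m ∧ ν = m ^ 3 :=
      ⟨ν ^ (1 / 3 : ℝ), by positivity, by
        rw [← Real.rpow_natCast, ← Real.rpow_mul hν0]; norm_num⟩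
    have hroot : (m ^ 3) ^ (1 / 3 : ℝ) = m := by
      rw [← Real.rpow_natCast, ← Real.rpow_mul hm0]; norm_num
    have hmq : m ≤ q := le_of_pow_le_pow_left₀ (by norm_num) hq0.le hν
    have hmV : 200 * V * ShearFlow.energyConst V * m ^ 2 ≤ 1 := by
      have h1 : 200 * V * ShearFlow.energyConst V * q = 1 := mul_inv_cancel₀ (by positivity)
      have h2 : m ^ 2 ≤ q := by nlinarith
      calc _ ≤ 200 * V * ShearFlow.energyConst V * q := by gcongr
        _ = 1 := h1
    have huc : Continuous u := hu.contDiff.continuous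
    obtain ⟨σ, hσ, hfin2, hft, hsol⟩ : ∃ σ : ℤ → ℝ, (∀ k, 0 ≤ σ k) ∧
        MemLp (ShearFlow.nonzeroModes fin) 2 volume ∧
        (∀ t, 0 ≤ t → MemLp (ShearFlow.nonzeroModes (f t)) 2 volume) ∧
        ∀ k : ℤ, k ≠ 0 → ShearFlow.IsModeSol u k (m ^ 3) (σ k)
          (ShearFlow.modeLp k (ShearFlow.nonzeroModes fin))
          fun t => ShearFlow.modeLp k (ShearFlow.nonzeroModes (f t)) := by
      have hfin2 : LocallyIntegrable fin volume →
          MemLp (ShearFlow.nonzeroModes fin) 2 volume := fun h =>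
        (ShearFlow.memLp_two_iff_lintegral
          (ShearFlow.aestronglyMeasurable_nonzeroModes h.aestronglyMeasurable)).2
          ((ShearFlow.lintegral_sq_le_weightedNorm_sq u _).trans_lt (ENNReal.pow_lt_top hfin))
      rcases hf with hf | hf
      · have h1 := hfin2 hf.locallyIntegrable_init
        have h2 := fun t (ht : 0 ≤ t) => hf.memLp_nonzeroModes ht
        exact ⟨fun _ => 0, fun _ => le_rfl, h1, h2, fun k hk =>
          hf.isModeSol huc hk h1 h2 fun η hη => ShearFlow.wave_adjoint_hypo u _ hη⟩
      · have h1 := hfin2 hf.locallyIntegrable_init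
        have h2 := fun t (ht : 0 ≤ t) => hf.memLp_nonzeroModes ht
        exact ⟨fun k => (k : ℝ) ^ 2, fun _ => by positivity, h1, h2, fun k hk =>
          hf.isModeSol huc hk h1 h2 fun η hη => ShearFlow.wave_adjoint_full u _ hη⟩
    rw [hroot]
    have he : ∀ t, -(1 / (800 * V) * m * t) = -(m / (800 * V) * t) := fun t => by ring
    refine ⟨fun t ht => ?_, fun g hg t ht => ?_⟩
    · refine (ShearFlow.weightedNorm_nonzeroModes_le hu hU hV hm0 hmV hsol hσ ht hfin2
        (hft t ht)).trans ?_
      rw [he]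
      gcongr
      · linarith
      · linarith
    · rw [he]
      exact ShearFlow.hDotNegOneNorm_nonzeroModes_le hu hU hV hm0 hmV hsol hσ ht hfin2
        (hft t ht) hg
  refine ⟨hmain.1, hmain.2, ?_⟩
  rintro rfl g hg t ht
  have h := hmain.2 g hg t ht
  rw [Real.zero_rpow (by norm_num), mul_zero, zero_mul, neg_zero, Real.exp_zero, mul_one_div] at h
  exact h
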